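/- Let $M$ be a connected smooth manifold (Hausdorff, second countable, without boundary) with $H^1(M,\mathbb R)=0$ (de Rham cohomology). Let $G$ be a connected and simply connected solvable real Lie group of dimension $q$, and let $\mathcal F$ be a smooth foliation of codimension $q$ on $M$ which is invariant under a transverse action of $G$. That is, there is a smooth action $\Phi\colon G\times M\to M$ whose orbits have dimension $q$ and meet the leaves of $\mathcal F$ transversely, and such that every $\Phi_g\colon x\mapsto \Phi(g,x)$ maps leaves of $\mathcal F$ onto leaves of $\mathcal F$. Then: (1) For every leaf $L$ of $\mathcal F$, with its leaf topology and leaf smooth structure, there is a diffeomorphism $\psi\colon M\to G\times L$ such that $\mathcal F$ is given by the projection to the first factor: writing $\mathrm{pr}_G\colon G\times L\to G$ for the projection, the leaves of $\mathcal F$ are exactly the fibres of the surjective submersion $\mathrm{pr}_G\circ\psi\colon M\to G$, and the tangent spaces of the leaves are the kernels of its differential. (2) $G$ is diffeomorphic to the vector space $\mathbb R^q$. -/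

import Mathlib

open Set Topology
open scoped Manifold ContDiff

noncomputable section

/-! ### Foliations -/

/-- A smooth foliation of a manifold `M` (modelled on `E`), given by an atlas of foliated charts:
smooth diffeomorphisms `e` from open subsets of `M` onto open subsets of `F × Q`, covering `M`,
whose transition maps are locally of the form `(u, c) ↦ (h₁ (u, c), h₂ c)`.
The leaves have dimension `dim F` and the codimension is `dim Q`. -/
structure Foliation (E F Q M : Type*)
    [NormedAddCommGroup E] [NormedSpace ℝ E] [NormedAddCommGroup F] [NormedSpace ℝ F]
    [NormedAddCommGroup Q] [NormedSpace ℝ Q] [TopologicalSpace M] [ChartedSpace E M] where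
  /-- The foliated charts. -/
  charts : Set (OpenPartialHomeomorph M (F × Q))
  cover : ∀ x : M, ∃ e ∈ charts, x ∈ e.source
  smooth : ∀ e ∈ charts, ContMDiffOn 𝓘(ℝ, E) 𝓘(ℝ, F × Q) ∞ e e.source
  smooth_symm : ∀ e ∈ charts, ContMDiffOn 𝓘(ℝ, F × Q) 𝓘(ℝ, E) ∞ e.symm e.target
  compatible : ∀ e ∈ charts, ∀ e' ∈ charts, ∀ z ∈ (e.symm.trans e').source,
    ∃ U ∈ 𝓝 z, ∃ h : Q → Q, ∀ w ∈ U, (e' (e.symm w)).2 = h w.2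

/-- The tangent space at `x` of the orbit of `x` under an action of `G` on `M`, as a subspace of
`T_x M`: the image of the differential at `1` of the orbit map `g ↦ g • x`. -/
def orbitTangent (EG E G : Type*) {M : Type*} [NormedAddCommGroup EG] [NormedSpace ℝ EG]
    [NormedAddCommGroup E] [NormedSpace ℝ E] [TopologicalSpace G] [ChartedSpace EG G] [Group G]
    [TopologicalSpace M] [ChartedSpace E M] [MulAction G M] (x : M) :
    Submodule ℝ (TangentSpace 𝓘(ℝ, E) x) :=
  LinearMap.range (M := EG) (M₂ := E)
    (mfderiv 𝓘(ℝ, EG) 𝓘(ℝ, E) (fun g : G => g • x) 1).toLinearMap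

namespace Foliation

variable {E F Q M : Type*}
  [NormedAddCommGroup E] [NormedSpace ℝ E] [NormedAddCommGroup F] [NormedSpace ℝ F]
  [NormedAddCommGroup Q] [NormedSpace ℝ Q] [TopologicalSpace M] [ChartedSpace E M]

/-- The tangent space at `x` of the leaf through `x`, as a subspace of `T_x M`: the vectors killed
by the differentials of the transverse coordinates of the foliated charts around `x`. -/
def tangent (𝓕 : Foliation E F Q M) (x : M) : Submodule ℝ (TangentSpace 𝓘(ℝ, E) x) :=
  ⨅ e : {e : OpenPartialHomeomorph M (F × Q) // e ∈ 𝓕.charts ∧ x ∈ e.source},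
    LinearMap.ker (mfderiv 𝓘(ℝ, E) 𝓘(ℝ, Q) (fun y => (e.1 y).2) x).toLinearMap

/-- The manifold `M` as a set, to be equipped with the leaf topology of the foliation. -/
def LeafSpace (_𝓕 : Foliation E F Q M) : Type _ := M

/-- The leaf topology: `U` is open iff its trace on every plaque of every foliated chart is open
in the plaque. -/
instance (𝓕 : Foliation E F Q M) : TopologicalSpace 𝓕.LeafSpace where
  IsOpen U := ∀ e ∈ 𝓕.charts, ∀ c : Q,
    IsOpen {u : F | (u, c) ∈ e.target ∧ (show Set M from U) (e.symm (u, c))}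
  isOpen_univ := by
    intro e he c
    have : IsOpen ((fun u : F => (u, c)) ⁻¹' e.target) :=
      e.open_target.preimage (by fun_prop)
    convert this using 1
    ext u
    exact ⟨fun h => h.1, fun h => ⟨h, trivial⟩⟩
  isOpen_inter := by
    intro s t hs ht e he c
    convert (hs e he c).inter (ht e he c) using 1
    ext u
    constructor
    · rintro ⟨h1, h2, h3⟩
      exact ⟨⟨h1, h2⟩, ⟨h1, h3⟩⟩
    · rintro ⟨⟨h1, h2⟩, ⟨_, h3⟩⟩
      exact ⟨h1, h2, h3⟩
  isOpen_sUnion := by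
    intro S hS e he c
    have : IsOpen (⋃ s ∈ S,
        {u : F | (u, c) ∈ e.target ∧ (show Set M from s) (e.symm (u, c))}) :=
      isOpen_biUnion fun s hs => hS s hs e he c
    convert this using 1
    ext u
    simp only [mem_iUnion]
    constructor
    · rintro ⟨h1, s, hs, h2⟩
      exact ⟨s, hs, h1, h2⟩
    · rintro ⟨s, hs, h1, h2⟩
      exact ⟨h1, s, hs, h2⟩

lemma isOpen_leafSpace_iff (𝓕 : Foliation E F Q M) (U : Set 𝓕.LeafSpace) :
    IsOpen U ↔ ∀ e ∈ 𝓕.charts, ∀ c : Q,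
      IsOpen {u : F | (u, c) ∈ e.target ∧ (e.symm (u, c) : 𝓕.LeafSpace) ∈ U} :=
  Iff.rfl

lemma isOpen_plaque_inter (𝓕 : Foliation E F Q M) (e : OpenPartialHomeomorph M (F × Q))
    (he : e ∈ 𝓕.charts) (c : Q) (V : Set F) (hV : IsOpen V) :
    IsOpen (X := 𝓕.LeafSpace) {w : M | w ∈ e.source ∧ (e w).2 = c ∧ (e w).1 ∈ V} := by
  rw [isOpen_leafSpace_iff]
  intro e' he' c'
  rw [isOpen_iff_mem_nhds]
  rintro u₀ ⟨h1, h2, h3, h4⟩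
  have hz : (u₀, c') ∈ (e'.symm.trans e).source := by
    rw [OpenPartialHomeomorph.trans_source]
    exact ⟨h1, h2⟩
  obtain ⟨U, hU, h, hh⟩ := 𝓕.compatible e' he' e he _ hz
  have hc : Continuous (fun u : F => (u, c')) := by fun_prop
  have hsrc : (e'.symm.trans e).source ∈ 𝓝 (u₀, c') :=
    (e'.symm.trans e).open_source.mem_nhds hz
  have hcont : ContinuousAt (fun w => (e (e'.symm w)).1) (u₀, c') :=
    continuous_fst.continuousAt.comp ((e'.symm.trans e).continuousAt hz)
  have hV' : (fun w => (e (e'.symm w)).1) ⁻¹' V ∈ 𝓝 (u₀, c') :=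
    hcont.preimage_mem_nhds (hV.mem_nhds h4)
  filter_upwards [hc.continuousAt.preimage_mem_nhds (x := u₀) hU,
    hc.continuousAt.preimage_mem_nhds (x := u₀) hsrc,
    hc.continuousAt.preimage_mem_nhds (x := u₀) hV'] with u hu1 hu2 hu3
  have hu2' : (u, c') ∈ (e'.symm.trans e).source := hu2
  rw [OpenPartialHomeomorph.trans_source] at hu2'
  refine ⟨hu2'.1, hu2'.2, ?_, hu3⟩
  have e1 := hh (u, c') hu1
  have e2 := hh (u₀, c') (mem_of_mem_nhds hU)
  exact (e1.trans e2.symm).trans h3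

/-- The plaque `{(e w).2 = c}` of a foliated chart `e`, as a chart of the leaf topology; the
coordinate is the first component of `e`. -/
def plaqueChart (𝓕 : Foliation E F Q M) (e : OpenPartialHomeomorph M (F × Q))
    (he : e ∈ 𝓕.charts) (c : Q) : OpenPartialHomeomorph 𝓕.LeafSpace F where
  toFun := fun w : M => (e w).1
  invFun := fun u => (e.symm (u, c) : M)
  source := {w : M | w ∈ e.source ∧ (e w).2 = c}
  target := {u | (u, c) ∈ e.target}
  map_source' := by
    rintro w ⟨h1, rfl⟩
    exact e.map_source h1
  map_target' := by
    intro u hu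
    refine ⟨e.map_target hu, ?_⟩
    rw [e.right_inv hu]
  left_inv' := by
    rintro w ⟨h1, rfl⟩
    exact e.left_inv h1
  right_inv' := by
    intro u hu
    rw [e.right_inv hu]
  open_source := by
    convert 𝓕.isOpen_plaque_inter e he c univ isOpen_univ using 1
    ext w
    constructor
    · rintro ⟨h1, h2⟩
      exact ⟨h1, h2, trivial⟩
    · rintro ⟨h1, h2, _⟩
      exact ⟨h1, h2⟩
  open_target := e.open_target.preimage (f := fun u : F => (u, c)) (by fun_prop)
  continuousOn_toFun := by
    intro w hw
    refine ContinuousAt.continuousWithinAt (continuousAt_def.2 fun A hA => ?_)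
    obtain ⟨V, hVA, hV, hwV⟩ := mem_nhds_iff.1 hA
    refine Filter.mem_of_superset
      ((𝓕.isOpen_plaque_inter e he c V hV).mem_nhds ⟨hw.1, hw.2, hwV⟩) ?_
    rintro w' ⟨_, _, h⟩
    exact hVA h
  continuousOn_invFun := by
    intro u hu
    refine ContinuousAt.continuousWithinAt (continuousAt_def.2 fun A hA => ?_)
    obtain ⟨U, hUA, hU, huU⟩ := mem_nhds_iff.1 hA
    refine Filter.mem_of_superset
      (((𝓕.isOpen_leafSpace_iff U).1 hU e he c).mem_nhds ⟨hu, huU⟩) ?_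
    rintro u' ⟨_, h⟩
    exact hUA h

/-- A choice of foliated chart around each point. -/
def chartNear (𝓕 : Foliation E F Q M) (x : M) : OpenPartialHomeomorph M (F × Q) :=
  (𝓕.cover x).choose

lemma chartNear_mem (𝓕 : Foliation E F Q M) (x : M) : 𝓕.chartNear x ∈ 𝓕.charts :=
  (𝓕.cover x).choose_spec.1

lemma mem_chartNear_source (𝓕 : Foliation E F Q M) (x : M) : x ∈ (𝓕.chartNear x).source :=
  (𝓕.cover x).choose_spec.2

/-- With the leaf topology, `M` is charted on `F` by the plaques. -/
instance (𝓕 : Foliation E F Q M) : ChartedSpace F 𝓕.LeafSpace where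
  atlas := {f | ∃ (e : OpenPartialHomeomorph M (F × Q)) (he : e ∈ 𝓕.charts) (c : Q),
    f = 𝓕.plaqueChart e he c}
  chartAt := fun x : M => 𝓕.plaqueChart (𝓕.chartNear x) (𝓕.chartNear_mem x) (𝓕.chartNear x x).2
  mem_chart_source := fun x : M => ⟨𝓕.mem_chartNear_source x, rfl⟩
  chart_mem_atlas := fun x : M => ⟨𝓕.chartNear x, 𝓕.chartNear_mem x, (𝓕.chartNear x x).2, rfl⟩

instance (𝓕 : Foliation E F Q M) : IsManifold 𝓘(ℝ, F) ∞ 𝓕.LeafSpace := by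
  apply isManifold_of_contDiffOn
  rintro _ _ ⟨e, he, c, rfl⟩ ⟨e', he', c', rfl⟩
  have h1 : ContMDiffOn 𝓘(ℝ, F × Q) 𝓘(ℝ, F × Q) ∞ (e' ∘ e.symm) (e.symm.trans e').source := by
    rw [OpenPartialHomeomorph.trans_source]
    refine (𝓕.smooth e' he').comp ((𝓕.smooth_symm e he).mono inter_subset_left) ?_
    exact inter_subset_right
  have h2 : ContDiffOn ℝ ∞ (fun u : F => ((e' ∘ e.symm) (u, c)).1)
      ((fun u : F => (u, c)) ⁻¹' (e.symm.trans e').source) :=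
    contDiff_fst.comp_contDiffOn
      (h1.contDiffOn.comp (contDiff_id.prodMk contDiff_const).contDiffOn fun u hu => hu)
  refine h2.mono ?_
  rintro u ⟨⟨hu1, hu2⟩, -⟩
  change (u, c) ∈ (e.symm.trans e').source
  rw [OpenPartialHomeomorph.trans_source]
  exact ⟨hu1, hu2.1⟩

/-- The leaf through `x`: the connected component of `x` in the leaf topology. As an open subset of
`𝓕.LeafSpace` it carries the leaf topology and the smooth structure given by the plaques. -/
def leaf (𝓕 : Foliation E F Q M) (x : M) : TopologicalSpace.Opens 𝓕.LeafSpace where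
  carrier := connectedComponent (α := 𝓕.LeafSpace) x
  is_open' := by
    have : LocallyConnectedSpace 𝓕.LeafSpace := ChartedSpace.locallyConnectedSpace F _
    exact isOpen_connectedComponent

/-- The leaf through `x` as a subset of `M`. -/
def leafSet (𝓕 : Foliation E F Q M) (x : M) : Set M := (𝓕.leaf x : Set 𝓕.LeafSpace)

/-- The set of leaves, as subsets of `M`. -/
def leaves (𝓕 : Foliation E F Q M) : Set (Set M) := range 𝓕.leafSet

/-- The foliation `𝓕` is invariant under the given action of `G` on `M`, and this action is a smooth
transverse one: `dim G` is the codimension of `𝓕`, the orbits have that dimension and are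
transverse to the leaves, and each element of `G` maps leaves onto leaves. -/
structure IsInvariantUnderTransverseAction (𝓕 : Foliation E F Q M) (EG G : Type*)
    [NormedAddCommGroup EG] [NormedSpace ℝ EG] [TopologicalSpace G] [ChartedSpace EG G]
    [Group G] [MulAction G M] : Prop where
  contMDiff_action :
    ContMDiff (𝓘(ℝ, EG).prod 𝓘(ℝ, E)) 𝓘(ℝ, E) ∞ (fun p : G × M => p.1 • p.2)
  finrank_group : Module.finrank ℝ EG = Module.finrank ℝ Q
  finrank_orbit : ∀ x : M, Module.finrank ℝ (orbitTangent EG E G x) = Module.finrank ℝ Q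
  transverse : ∀ x : M, orbitTangent EG E G x ⊔ 𝓕.tangent x = ⊤
  invariant : ∀ g : G, ∀ L ∈ 𝓕.leaves, (fun x : M => g • x) '' L ∈ 𝓕.leaves

/-- The foliation `𝓕` is given by the map `f : M → B`: this is a surjective submersion, the leaves
are exactly its fibres, and the tangent spaces of the leaves are the kernels of its differential. -/
structure IsGivenBy (𝓕 : Foliation E F Q M) (EB : Type*) {B : Type*} [NormedAddCommGroup EB]
    [NormedSpace ℝ EB] [TopologicalSpace B] [ChartedSpace EB B] (f : M → B) : Prop where
  contMDiff : ContMDiff 𝓘(ℝ, E) 𝓘(ℝ, EB) ∞ f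
  surjective : Function.Surjective f
  surjective_mfderiv : ∀ x : M, Function.Surjective (mfderiv 𝓘(ℝ, E) 𝓘(ℝ, EB) f x)
  leaves_eq : 𝓕.leaves = range fun b : B => f ⁻¹' {b}
  tangent_eq : ∀ x : M,
    𝓕.tangent x = LinearMap.ker (mfderiv 𝓘(ℝ, E) 𝓘(ℝ, EB) f x).toLinearMap

end Foliation

/-! ### First de Rham cohomology -/

section DeRham

variable (E M : Type*) [NormedAddCommGroup E] [NormedSpace ℝ E] [TopologicalSpace M]
  [ChartedSpace E M]

/-- Fields of linear forms on the tangent spaces of `M` (no regularity assumed). -/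
def OneForm : Type _ := ∀ x : M, TangentSpace 𝓘(ℝ, E) x →L[ℝ] ℝ

instance : AddCommGroup (OneForm E M) :=
  inferInstanceAs (AddCommGroup (∀ x : M, TangentSpace 𝓘(ℝ, E) x →L[ℝ] ℝ))

instance : Module ℝ (OneForm E M) :=
  inferInstanceAs (Module ℝ (∀ x : M, TangentSpace 𝓘(ℝ, E) x →L[ℝ] ℝ))

variable {E M}

/-- The expression of a 1-form in a chart `e`: the pullback of `η` by `e.symm`. -/
def OneForm.inChart (η : OneForm E M) (e : OpenPartialHomeomorph M E) (y : E) : E →L[ℝ] ℝ :=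
  (η (e.symm y)).comp (mfderiv 𝓘(ℝ, E) 𝓘(ℝ, E) e.symm y)

/-- A 1-form is smooth if its expression in every chart is. -/
def OneForm.IsSmooth (η : OneForm E M) : Prop :=
  ∀ e ∈ atlas E M, ContDiffOn ℝ ∞ (η.inChart e) e.target

/-- A 1-form is closed if the exterior derivative of its expression in every chart vanishes. -/
def OneForm.IsClosed (η : OneForm E M) : Prop :=
  ∀ e ∈ atlas E M, ∀ y ∈ e.target,
    extDeriv (fun z => ContinuousAlternatingMap.ofSubsingleton ℝ E ℝ (0 : Fin 1)
      (η.inChart e z)) y = 0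

/-- A 1-form is exact if it is the differential of a smooth function. -/
def OneForm.IsExact (η : OneForm E M) : Prop :=
  ∃ f : M → ℝ, ContMDiff 𝓘(ℝ, E) 𝓘(ℝ, ℝ) ∞ f ∧
    ∀ x : M, η x = mfderiv 𝓘(ℝ, E) 𝓘(ℝ, ℝ) f x

variable (E M)

lemma OneForm.differentiableAt_inChart {E M : Type*} [NormedAddCommGroup E] [NormedSpace ℝ E]
    [TopologicalSpace M] [ChartedSpace E M] {η : OneForm E M} (hη : η.IsSmooth)
    {e : OpenPartialHomeomorph M E} (he : e ∈ atlas E M) {y : E} (hy : y ∈ e.target) :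
    DifferentiableAt ℝ (fun z => ContinuousAlternatingMap.ofSubsingleton ℝ E ℝ (0 : Fin 1)
      (η.inChart e z)) y := by
  have h : DifferentiableAt ℝ (η.inChart e) y :=
    ((hη e he).contDiffAt (e.open_target.mem_nhds hy)).differentiableAt (by simp)
  have h' : DifferentiableAt ℝ (ContinuousAlternatingMap.ofSubsingletonLIE (𝕜 := ℝ) (E := E)
      (F := ℝ) (0 : Fin 1)) (η.inChart e y) :=
    (ContinuousAlternatingMap.ofSubsingletonLIE (𝕜 := ℝ) (E := E) (F := ℝ)
      (0 : Fin 1)).toContinuousLinearEquiv.differentiableAt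
  exact h'.comp y h

/-- The space of closed smooth 1-forms. -/
def closedOneForms : Submodule ℝ (OneForm E M) where
  carrier := {η | η.IsSmooth ∧ η.IsClosed}
  zero_mem' := by
    have h : ∀ e : OpenPartialHomeomorph M E,
        OneForm.inChart (0 : OneForm E M) e = fun _ => 0 := fun e => rfl
    refine ⟨fun e he => ?_, fun e he y hy => ?_⟩
    · rw [h]
      exact contDiffOn_const
    · have key := extDeriv_smul (x := y) (0 : ℝ) (fun _ : E =>
        ContinuousAlternatingMap.ofSubsingleton ℝ E ℝ (0 : Fin 1) (0 : E →L[ℝ] ℝ))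
      refine Eq.trans ?_ (key.trans (zero_smul ℝ _))
      congr 1
      funext z
      ext v
      simp [h]
  add_mem' := by
    rintro η θ ⟨h1, h2⟩ ⟨h3, h4⟩
    have h : ∀ e : OpenPartialHomeomorph M E,
        OneForm.inChart (η + θ) e = fun y => η.inChart e y + θ.inChart e y := fun e => rfl
    refine ⟨fun e he => ?_, fun e he y hy => ?_⟩
    · rw [h]
      exact (h1 e he).add (h3 e he)
    · have key := extDeriv_fun_add (OneForm.differentiableAt_inChart h1 he hy)
        (OneForm.differentiableAt_inChart h3 he hy)
      rw [h2 e he y hy, h4 e he y hy, add_zero] at key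
      exact key
  smul_mem' := by
    rintro c η ⟨h1, h2⟩
    have h : ∀ e : OpenPartialHomeomorph M E,
        OneForm.inChart (c • η) e = fun y => c • η.inChart e y := fun e => rfl
    refine ⟨fun e he => ?_, fun e he y hy => ?_⟩
    · rw [h]
      exact (h1 e he).const_smul c
    · have key := extDeriv_smul (x := y) c (fun z =>
        ContinuousAlternatingMap.ofSubsingleton ℝ E ℝ (0 : Fin 1) (η.inChart e z))
      rw [h2 e he y hy, smul_zero] at key
      exact key

/-- The space of differentials of smooth functions. -/
def exactOneForms : Submodule ℝ (OneForm E M) where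
  carrier := {η | η.IsExact}
  zero_mem' := ⟨fun _ => 0, contMDiff_const, fun x => by rw [mfderiv_const]; rfl⟩
  add_mem' := by
    rintro η θ ⟨f, hf, h1⟩ ⟨g, hg, h2⟩
    refine ⟨fun x => f x + g x, hf.add hg, fun x => ?_⟩
    have := mfderiv_add (hf.mdifferentiable (by simp) x) (hg.mdifferentiable (by simp) x)
    change η x + θ x = _
    rw [h1, h2]
    exact this.symm
  smul_mem' := by
    rintro c η ⟨f, hf, h1⟩
    refine ⟨fun x => c • f x, (contDiff_const_smul c).contMDiff.comp hf, fun x => ?_⟩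
    have := const_smul_mfderiv (hf.mdifferentiable (by simp) x) c
    change c • η x = _
    rw [h1]
    exact this.symm

/-- The first de Rham cohomology `H¹(M, ℝ)`: closed smooth 1-forms modulo exact ones. -/
abbrev DeRhamH1 : Type _ :=
  closedOneForms E M ⧸ (exactOneForms E M).comap (closedOneForms E M).subtype

end DeRham

end

noncomputable section

/-! Fix a leaf `L` through `x₀`. Everything reduces to showing that its stabilizer `H = {a | a • x₀
∈ L}` is trivial. By transversality, points near `x` are translates of points of the plaque of `x`
by unique elements of `G` near `1` (`exists_flowBox`), so on a connected `M` the translates of `L`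
fill `M`. If `H` is trivial, the translating element is unique, and `(g, y) ↦ g • y` is a
diffeomorphism from `G × L` onto `M` (`exists_diffeomorph`).

The group side is `exists_solvable_coordinates`: `G` has global coordinates `T` in which the `j`-th
one is additive under left translation by elements whose earlier coordinates vanish. This already
makes `G` diffeomorphic to a vector space. The induction splits off a nontrivial smooth character `χ
: G → ℝ`. Its kernel is a solvable Lie group of one dimension less; a smooth section of `χ` makes
the kernel a retract of `G`, hence simply connected. The character exists because a nontrivial
solvable group is not its own commutator subgroup: a nonzero `Ad`-invariant linear form then extends
to a closed left invariant form, whose local primitives are local homomorphisms, and simple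
connectedness makes one of them global.

The foliation side is `apply_eq_apply_one_of_smul_mem_leafSet`. Suppose that `t : G → ℝ` is additive
under left translation by `H`. If `γ y` moves a point of `L` to `y`, smoothly in `y`, the functions
`y ↦ t (γ y)⁻¹` for different choices of `γ` differ by local constants, so their differentials glue
to a closed form on `M`. As `H¹(M) = 0`, it has a primitive `v`, and `t g⁻¹ - v (g • y)` is constant
on the connected space `G × L`. Comparing `(1, x₀)` with `(a⁻¹, a • x₀)`, both lying over `x₀`,
gives `t a = t 1`. Applied to the coordinates of `T` successively, this gives `H = 1`. The local
constancy rests on second countability: a leaf meets a foliated chart in countably many plaques, and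
a countable subset of the transversal is totally disconnected. -/

/-- The inverse function theorem, for smooth maps: a local inverse which is smooth on its domain. -/
theorem exists_openPartialHomeomorph_of_fderiv_bijective {V W : Type*}
    [NormedAddCommGroup V] [NormedSpace ℝ V] [CompleteSpace V]
    [NormedAddCommGroup W] [NormedSpace ℝ W] [CompleteSpace W]
    {f : V → W} {U : Set V} (hU : IsOpen U) (hf : ContDiffOn ℝ ∞ f U) {x : V} (hx : x ∈ U)
    (hbij : Function.Bijective (fderiv ℝ f x)) :
    ∃ e : OpenPartialHomeomorph V W, x ∈ e.source ∧ e.source ⊆ U ∧ (∀ y, e y = f y) ∧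
      ContDiffOn ℝ ∞ e.symm e.target := by
  set L : V ≃L[ℝ] W := ContinuousLinearEquiv.ofBijective (fderiv ℝ f x)
    (LinearMap.ker_eq_bot.2 hbij.1) (LinearMap.range_eq_top.2 hbij.2) with hL
  have hLx : (L : V →L[ℝ] W) = fderiv ℝ f x := ContinuousLinearEquiv.coe_ofBijective _ _ _
  have hfx : ContDiffAt ℝ ∞ f x := hf.contDiffAt (hU.mem_nhds hx)
  have hd : HasFDerivAt f (L : V →L[ℝ] W) x := by
    rw [hLx]; exact (hfx.differentiableAt (by simp)).hasFDerivAt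
  have hcont : ContinuousOn (fderiv ℝ f) U := hf.continuousOn_fderiv_of_isOpen hU (by simp)
  have hO : IsOpen (U ∩ fderiv ℝ f ⁻¹' range ((↑) : (V ≃L[ℝ] W) → V →L[ℝ] W)) :=
    hcont.isOpen_inter_preimage hU ContinuousLinearEquiv.isOpen
  set e := (hfx.toOpenPartialHomeomorph f hd (by simp)).restrOpen _ hO with he
  have hes : e.source = (hfx.toOpenPartialHomeomorph f hd (by simp)).source ∩
    (U ∩ fderiv ℝ f ⁻¹' range ((↑) : (V ≃L[ℝ] W) → V →L[ℝ] W)) := rfl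
  refine ⟨e, ?_, ?_, fun y => rfl, ?_⟩
  · rw [hes]
    exact ⟨hfx.mem_toOpenPartialHomeomorph_source hd (by simp), hx, L, hLx⟩
  · rw [hes]; exact fun y hy => hy.2.1
  · intro w hw
    have hz : e.symm w ∈ e.source := e.map_target hw
    have hz' := hz
    rw [hes] at hz'
    obtain ⟨-, hzU, L', hL'⟩ := hz'
    have hfz : ContDiffAt ℝ ∞ f (e.symm w) := hf.contDiffAt (hU.mem_nhds hzU)
    refine (e.contDiffAt_symm hw (f₀' := L') ?_ hfz).contDiffWithinAt
    rw [hL']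
    exact (hfz.differentiableAt (by simp)).hasFDerivAt

/-! ### Differentials as maps between model spaces -/

section HasDiffAt

variable {E E' E'' : Type*} [NormedAddCommGroup E] [NormedSpace ℝ E]
  [NormedAddCommGroup E'] [NormedSpace ℝ E'] [NormedAddCommGroup E''] [NormedSpace ℝ E'']
  {X Y Z : Type*} [TopologicalSpace X] [ChartedSpace E X] [TopologicalSpace Y] [ChartedSpace E' Y]
  [TopologicalSpace Z] [ChartedSpace E'' Z]

/-- `HasMFDerivAt` for manifolds without boundary, the tangent spaces being identified with the
model spaces. -/
def HasDiffAt (f : X → Y) (x : X) (T : E →L[ℝ] E') : Prop :=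
  HasMFDerivAt 𝓘(ℝ, E) 𝓘(ℝ, E') f x T

theorem HasDiffAt.comp {g : Y → Z} {y : Y} {S : E' →L[ℝ] E''} {f : X → Y} {x : X}
    {T : E →L[ℝ] E'} (hg : HasDiffAt g y S) (hf : HasDiffAt f x T) (h : f x = y) :
    HasDiffAt (fun z => g (f z)) x (S.comp T) := by
  subst h
  exact HasMFDerivAt.comp x hg hf

theorem HasDiffAt.unique {f : X → Y} {x : X} {S T : E →L[ℝ] E'} (hS : HasDiffAt f x S)
    (hT : HasDiffAt f x T) : S = T := by
  unfold HasDiffAt at hS hT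
  exact hasMFDerivAt_unique hS hT

theorem HasDiffAt.congr {f g : X → Y} {x : X} {T : E →L[ℝ] E'} (hf : HasDiffAt f x T)
    (h : g =ᶠ[𝓝 x] f) : HasDiffAt g x T :=
  HasMFDerivAt.congr_of_eventuallyEq hf h

theorem hasDiffAt_id (x : X) : HasDiffAt (fun y : X => y) x (ContinuousLinearMap.id ℝ E) :=
  hasMFDerivAt_id x

theorem hasDiffAt_const (y : Y) (x : X) : HasDiffAt (fun _ : X => y) x (0 : E →L[ℝ] E') :=
  hasMFDerivAt_const y x

variable (E E') in
/-- The differential of `f` at `x`, as a map between the model spaces. -/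
def diffAt (f : X → Y) (x : X) : E →L[ℝ] E' :=
  mfderiv 𝓘(ℝ, E) 𝓘(ℝ, E') f x

theorem HasDiffAt.diffAt_eq {f : X → Y} {x : X} {T : E →L[ℝ] E'} (h : HasDiffAt f x T) :
    diffAt E E' f x = T :=
  HasMFDerivAt.mfderiv h

theorem ContMDiffAt.hasDiffAt {f : X → Y} {x : X} (h : ContMDiffAt 𝓘(ℝ, E) 𝓘(ℝ, E') ∞ f x) :
    HasDiffAt f x (diffAt E E' f x) :=
  (h.mdifferentiableAt (by simp)).hasMFDerivAt

theorem hasDiffAt_iff_hasFDerivAt {f : E → E'} {x : E} {T : E →L[ℝ] E'} :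
    HasDiffAt f x T ↔ HasFDerivAt f T x :=
  hasMFDerivAt_iff_hasFDerivAt

/-- The tangent space at `x` is identified with the model space through `chartAt E x`, so this chart
reads as the identity at `x`; at other points of its domain this can fail. -/
theorem hasDiffAt_chartAt_symm (x : X) :
    HasDiffAt (chartAt E x).symm (chartAt E x x) (ContinuousLinearMap.id ℝ E) := by
  have h := mem_chart_target E x
  refine ⟨(chartAt E x).continuousAt_symm h, ?_⟩
  refine HasFDerivAt.hasFDerivWithinAt ?_
  refine (hasFDerivAt_id _).congr_of_eventuallyEq ?_
  have h2 : (chartAt E x).target ∈ 𝓝 (chartAt E x x) := (chartAt E x).open_target.mem_nhds h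
  filter_upwards [h2] with y hy
  simp [writtenInExtChartAt, extChartAt, (chartAt E x).right_inv hy,
    (chartAt E x).left_inv (mem_chart_source E x), chartAt_self_eq]

theorem hasDiffAt_chartAt (x : X) :
    HasDiffAt (chartAt E x) x (ContinuousLinearMap.id ℝ E) := by
  have h := mem_chart_source E x
  refine ⟨(chartAt E x).continuousAt h, ?_⟩
  refine HasFDerivAt.hasFDerivWithinAt ?_
  refine (hasFDerivAt_id _).congr_of_eventuallyEq ?_
  have h2 : (chartAt E x).target ∈ 𝓝 (chartAt E x x) :=
    (chartAt E x).open_target.mem_nhds (mem_chart_target E x)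
  filter_upwards [h2] with y hy
  simp [writtenInExtChartAt, extChartAt, (chartAt E x).right_inv hy, chartAt_self_eq]

theorem contMDiffAt_chartAt_symm [IsManifold 𝓘(ℝ, E) ∞ X] (x : X) {y : E}
    (hy : y ∈ (chartAt E x).target) : ContMDiffAt 𝓘(ℝ, E) 𝓘(ℝ, E) ∞ (chartAt E x).symm y :=
  (contMDiffOn_chart_symm (x := x)).contMDiffAt ((chartAt E x).open_target.mem_nhds hy)

theorem contMDiffAt_chartAt [IsManifold 𝓘(ℝ, E) ∞ X] (x : X) {y : X}
    (hy : y ∈ (chartAt E x).source) : ContMDiffAt 𝓘(ℝ, E) 𝓘(ℝ, E) ∞ (chartAt E x) y :=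
  (contMDiffOn_chart (x := x)).contMDiffAt ((chartAt E x).open_source.mem_nhds hy)

end HasDiffAt

/-! ### An `Ad`-invariant linear form on a group that is not perfect -/

section LieGroup

variable {E : Type*} [NormedAddCommGroup E] [NormedSpace ℝ E]
  {G : Type*} [TopologicalSpace G] [ChartedSpace E G] [Group G]
  {E' : Type*} [NormedAddCommGroup E'] [NormedSpace ℝ E'] {X : Type*} [TopologicalSpace X]
  [ChartedSpace E' X]

theorem hasMFDerivAt_mul_one_one [LieGroup 𝓘(ℝ, E) ∞ G] :
    HasMFDerivAt (𝓘(ℝ, E).prod 𝓘(ℝ, E)) 𝓘(ℝ, E) (fun p : G × G => p.1 * p.2) (1, 1)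
      (ContinuousLinearMap.coprod (ContinuousLinearMap.id ℝ E) (ContinuousLinearMap.id ℝ E) :
        E × E →L[ℝ] E) := by
  have h : MDifferentiableAt (𝓘(ℝ, E).prod 𝓘(ℝ, E)) 𝓘(ℝ, E) (fun p : G × G => p.1 * p.2) (1, 1) :=
    (contMDiff_mul 𝓘(ℝ, E) ∞).mdifferentiable (by simp) _
  have key : mfderiv (𝓘(ℝ, E).prod 𝓘(ℝ, E)) 𝓘(ℝ, E) (fun p : G × G => p.1 * p.2) (1, 1) =
      (ContinuousLinearMap.coprod (ContinuousLinearMap.id ℝ E) (ContinuousLinearMap.id ℝ E) :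
        E × E →L[ℝ] E) := by
    refine ContinuousLinearMap.ext fun v => ?_
    rw [mfderiv_prod_eq_add_apply h]
    have h1 : HasDiffAt (fun z : G => z * (1 : G)) 1 (ContinuousLinearMap.id ℝ E) := by
      simp only [mul_one]; exact hasDiffAt_id 1
    have h2 : HasDiffAt (fun z : G => (1 : G) * z) 1 (ContinuousLinearMap.id ℝ E) := by
      simp only [one_mul]; exact hasDiffAt_id 1
    have h1' := HasMFDerivAt.mfderiv h1
    have h2' := HasMFDerivAt.mfderiv h2
    exact congrArg₂ (· + ·) (DFunLike.congr_fun h1' v.1) (DFunLike.congr_fun h2' v.2)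
  rw [← key]
  exact h.hasMFDerivAt

/-- Both values must be `1`: only there do the two factors and the product share one tangent space,
on which multiplication differentiates to addition. -/
theorem HasDiffAt.mul [LieGroup 𝓘(ℝ, E) ∞ G] {P Q : X → G} {x : X} {S T : E' →L[ℝ] E}
    (hP : HasDiffAt P x S) (hQ : HasDiffAt Q x T) (hP1 : P x = 1) (hQ1 : Q x = 1) :
    HasDiffAt (fun y => P y * Q y) x (S + T) := by
  have h := HasMFDerivAt.prodMk hP hQ
  have hm : ∀ p : G × G, p = (1, 1) →
      HasMFDerivAt (𝓘(ℝ, E).prod 𝓘(ℝ, E)) 𝓘(ℝ, E) (fun p : G × G => p.1 * p.2) p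
      (ContinuousLinearMap.coprod (ContinuousLinearMap.id ℝ E) (ContinuousLinearMap.id ℝ E) :
        E × E →L[ℝ] E) := by
    rintro _ rfl
    exact hasMFDerivAt_mul_one_one
  refine (HasMFDerivAt.comp x (hm (P x, Q x) (by rw [hP1, hQ1])) h).congr_mfderiv ?_
  refine ContinuousLinearMap.ext fun v => ?_
  rfl

/-- Differentiate `g * g⁻¹ = 1` at `1`. -/
theorem hasDiffAt_inv_one [LieGroup 𝓘(ℝ, E) ∞ G] :
    HasDiffAt (fun g : G => g⁻¹) 1 (-(ContinuousLinearMap.id ℝ E)) := by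
  have h : HasDiffAt (fun g : G => g⁻¹) 1 (diffAt E E (fun g : G => g⁻¹) 1) :=
    (contMDiff_inv 𝓘(ℝ, E) ∞).contMDiffAt.hasDiffAt
  have h1 := (hasDiffAt_id (1 : G)).mul h rfl inv_one
  simp only [mul_inv_cancel] at h1
  have h3 := h1.unique (hasDiffAt_const (1 : G) (1 : G))
  rw [eq_neg_of_add_eq_zero_right h3] at h
  exact h

theorem contMDiff_const_mul [LieGroup 𝓘(ℝ, E) ∞ G] (a : G) :
    ContMDiff 𝓘(ℝ, E) 𝓘(ℝ, E) ∞ (fun g : G => a * g) :=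
  contMDiff_const.mul contMDiff_id

theorem contMDiff_conj [LieGroup 𝓘(ℝ, E) ∞ G] (a : G) :
    ContMDiff 𝓘(ℝ, E) 𝓘(ℝ, E) ∞ (fun g : G => a * g * a⁻¹) :=
  (contMDiff_const.mul contMDiff_id).mul contMDiff_const

variable (E) in
/-- The adjoint action of `a` on the tangent space at `1`, identified with the model space. -/
def adjointMap (a : G) : E →L[ℝ] E :=
  diffAt E E (fun g : G => a * g * a⁻¹) 1

theorem hasDiffAt_conj_one [LieGroup 𝓘(ℝ, E) ∞ G] (a : G) :
    HasDiffAt (fun g : G => a * g * a⁻¹) 1 (adjointMap E a) :=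
  (contMDiff_conj (E := E) a).contMDiffAt.hasDiffAt

/-- The maps which occur as the differential at `0` of a smooth map into the commutator subgroup. -/
def IsCommutatorDifferential (G : Type*) [TopologicalSpace G] [ChartedSpace E G] [Group G]
    (T : E →L[ℝ] E) : Prop :=
  ∃ P : E → G, P 0 = 1 ∧ (∀ s, P s ∈ commutator G) ∧ ContMDiffAt 𝓘(ℝ, E) 𝓘(ℝ, E) ∞ P 0 ∧
    HasDiffAt P 0 T

theorem IsCommutatorDifferential.zero : IsCommutatorDifferential G (0 : E →L[ℝ] E) :=
  ⟨fun _ => 1, rfl, fun _ => one_mem _, contMDiffAt_const, hasDiffAt_const _ _⟩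

theorem IsCommutatorDifferential.add [LieGroup 𝓘(ℝ, E) ∞ G] {S T : E →L[ℝ] E}
    (hS : IsCommutatorDifferential G S)
    (hT : IsCommutatorDifferential G T) : IsCommutatorDifferential G (S + T) := by
  obtain ⟨P, hP1, hP2, hP3, hP4⟩ := hS
  obtain ⟨Q, hQ1, hQ2, hQ3, hQ4⟩ := hT
  exact ⟨fun s => P s * Q s, by simp [hP1, hQ1], fun s => mul_mem (hP2 s) (hQ2 s), hP3.mul hQ3,
    hP4.mul hQ4 hP1 hQ1⟩

theorem IsCommutatorDifferential.comp {S : E →L[ℝ] E} (hS : IsCommutatorDifferential G S)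
    (T : E →L[ℝ] E) : IsCommutatorDifferential G (S.comp T) := by
  obtain ⟨P, hP1, hP2, hP3, hP4⟩ := hS
  have h0 : T 0 = 0 := map_zero T
  refine ⟨fun s => P (T s), by simp [hP1], fun s => hP2 _, ?_, ?_⟩
  · exact ContMDiffAt.comp (0 : E) (by rw [h0]; exact hP3) T.contMDiff.contMDiffAt
  · exact hP4.comp (hasDiffAt_iff_hasFDerivAt.2 T.hasFDerivAt) h0

/-- The witness is the commutator of `a` with `c s`, where `c` is the inverse chart at `1`,
recentred at `0`. -/
theorem isCommutatorDifferential_adjointMap_sub [LieGroup 𝓘(ℝ, E) ∞ G] (a : G) :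
    IsCommutatorDifferential G (adjointMap E a - ContinuousLinearMap.id ℝ E) := by
  set φ := chartAt E (1 : G) with hφ
  have h1 : (1 : G) ∈ φ.source := mem_chart_source E 1
  set c : E → G := fun s => φ.symm (φ 1 + s) with hc
  have hc0 : c 0 = 1 := by simp [hc, φ.left_inv h1]
  have hcs : ContMDiffAt 𝓘(ℝ, E) 𝓘(ℝ, E) ∞ c 0 := by
    have := contMDiffAt_chartAt_symm (1 : G) (mem_chart_target E (1 : G))
    refine ContMDiffAt.comp (I' := 𝓘(ℝ, E)) (0 : E) (g := φ.symm) (f := fun s : E => φ 1 + s) ?_ ?_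
    · rw [add_zero]; exact this
    · exact (contDiff_const.add contDiff_id).contMDiff.contMDiffAt
  have hcd : HasDiffAt c 0 (ContinuousLinearMap.id ℝ E) := by
    have := (hasDiffAt_chartAt_symm (1 : G)).comp (f := fun s : E => φ 1 + s) (x := 0)
      (hasDiffAt_iff_hasFDerivAt.2 ((hasFDerivAt_id (𝕜 := ℝ) (0 : E)).const_add (φ 1)))
      (by simp [hφ])
    simpa using this
  have hconj := (hasDiffAt_conj_one a).comp hcd hc0
  have hinv := hasDiffAt_inv_one.comp hcd hc0
  refine ⟨fun s => a * c s * a⁻¹ * (c s)⁻¹, by simp [hc0], fun s => ?_, ?_, ?_⟩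
  · rw [commutator_def]
    exact Subgroup.commutator_mem_commutator (Subgroup.mem_top a) (Subgroup.mem_top (c s))
  · exact ((contMDiffAt_const.mul hcs).mul contMDiffAt_const).mul hcs.inv
  · have := hconj.mul hinv (by simp [hc0]) (by simp [hc0])
    simpa [sub_eq_add_neg] using this

/-- By the inverse function theorem the commutator subgroup contains a neighbourhood of `1`, so it
is open, hence closed, hence everything. This concerns the abstract commutator subgroup and not its
closure, as solvability requires. -/
theorem commutator_eq_top_of_isCommutatorDifferential_id [CompleteSpace E]
    [LieGroup 𝓘(ℝ, E) ∞ G] [ConnectedSpace G]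
    (h : IsCommutatorDifferential G (ContinuousLinearMap.id ℝ E)) : commutator G = ⊤ := by
  have : IsTopologicalGroup G := topologicalGroup_of_lieGroup 𝓘(ℝ, E) ∞
  obtain ⟨P, hP1, hP2, hP3, hP4⟩ := h
  set φ := chartAt E (1 : G) with hφ
  have h1 : (1 : G) ∈ φ.source := mem_chart_source E 1
  have hs : ContDiffAt ℝ ∞ (fun s => φ (P s)) 0 := by
    refine contMDiffAt_iff_contDiffAt.1 (ContMDiffAt.comp (0 : E) ?_ hP3)
    rw [hP1]; exact contMDiffAt_chartAt 1 h1
  have hd : HasFDerivAt (fun s => φ (P s)) (ContinuousLinearMap.id ℝ E) 0 :=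
    hasDiffAt_iff_hasFDerivAt.1 ((hasDiffAt_chartAt (1 : G)).comp hP4 hP1)
  have hsd : HasStrictFDerivAt (fun s => φ (P s))
      ((ContinuousLinearEquiv.refl ℝ E : E ≃L[ℝ] E) : E →L[ℝ] E) 0 :=
    hs.hasStrictFDerivAt' hd (by simp)
  have hmap := hsd.map_nhds_eq_of_equiv
  have hcont : ContinuousAt P 0 := hP3.continuousAt
  have hmem : (commutator G : Set G) ∈ 𝓝 (1 : G) := by
    have hev : ∀ᶠ s in 𝓝 (0 : E), φ.symm (φ (P s)) ∈ commutator G := by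
      have := hcont.preimage_mem_nhds (t := φ.source)
        (by rw [hP1]; exact φ.open_source.mem_nhds h1)
      filter_upwards [this] with s hs
      rw [φ.left_inv hs]; exact hP2 s
    have hev2 : ∀ᶠ y in 𝓝 (φ 1), φ.symm y ∈ commutator G := by
      have h3 : ∀ᶠ y in Filter.map (fun s => φ (P s)) (𝓝 0), φ.symm y ∈ commutator G := hev
      rw [hmap, hP1] at h3
      exact h3
    have h4 := (φ.continuousAt h1).eventually hev2
    filter_upwards [h4, φ.open_source.mem_nhds h1] with g hg hgs
    rw [φ.left_inv hgs] at hg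
    exact hg
  have hopen : IsOpen (commutator G : Set G) := Subgroup.isOpen_of_mem_nhds _ hmem
  have hclopen : IsClopen (commutator G : Set G) :=
    ⟨Subgroup.isClosed_of_isOpen _ hopen, hopen⟩
  have := hclopen.eq_univ ⟨1, one_mem _⟩
  exact SetLike.coe_injective (by simpa using this)

/-- The vectors tangent to the commutator subgroup form a proper subspace `W` containing every `Ad a
v - v`; any nonzero form vanishing on `W` will do. -/
theorem exists_ne_zero_comp_adjointMap_eq [FiniteDimensional ℝ E]
    [LieGroup 𝓘(ℝ, E) ∞ G] [ConnectedSpace G] (hG : commutator G ≠ ⊤) :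
    ∃ l : E →L[ℝ] ℝ, l ≠ 0 ∧ ∀ a : G, l.comp (adjointMap E a) = l := by
  have : CompleteSpace E := FiniteDimensional.complete ℝ E
  -- Membership is tested on all rank-one maps with value `w`, because the identity is a sum of such
  -- maps over a basis; so `W = ⊤` would make the identity a commutator differential.
  let W : Submodule ℝ E :=
    { carrier := {w | ∀ f : E →L[ℝ] ℝ, IsCommutatorDifferential G (f.smulRight w)}
      zero_mem' := fun f => by
        have : f.smulRight (0 : E) = 0 := by ext; simp
        rw [this]; exact .zero
      add_mem' := fun {v w} hv hw f => by
        have : f.smulRight (v + w) = f.smulRight v + f.smulRight w := by ext; simp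
        rw [this]; exact (hv f).add (hw f)
      smul_mem' := fun c w hw f => by
        have : f.smulRight (c • w) = (c • f).smulRight w := by
          ext; simp [smul_smul, mul_comm]
        rw [this]; exact hw _ }
  have hW : W ≠ ⊤ := by
    intro htop
    apply hG
    apply commutator_eq_top_of_isCommutatorDifferential_id (E := E)
    set b := Module.finBasis ℝ E
    have hid : ContinuousLinearMap.id ℝ E =
        ∑ i, (LinearMap.toContinuousLinearMap (b.coord i)).smulRight (b i) := by
      ext v
      simp [b.sum_repr]
    rw [hid]
    refine Finset.sum_induction _ (IsCommutatorDifferential G) (fun _ _ => .add) .zero ?_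
    intro i _
    have : b i ∈ W := htop ▸ Submodule.mem_top
    exact this _
  have hW' : ∀ (a : G) (v : E), adjointMap E a v - v ∈ W := by
    intro a v f
    convert! (isCommutatorDifferential_adjointMap_sub a).comp (f.smulRight v) using 1
    ext w
    simp [smul_sub]
  obtain ⟨l, hl0, hlW⟩ := Submodule.exists_le_ker_of_lt_top W (lt_top_iff_ne_top.2 hW)
  refine ⟨LinearMap.toContinuousLinearMap l, by simpa using hl0, fun a => ?_⟩
  ext v
  have := hlW (hW' a v)
  rw [LinearMap.mem_ker, map_sub, sub_eq_zero] at this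
  exact this

theorem commutator_ne_top_of_isSolvable (G : Type*) [Group G] [Group.IsSolvable G]
    [Nontrivial G] : commutator G ≠ ⊤ :=
  (Group.IsSolvable.commutator_lt_top_of_nontrivial G).ne

end LieGroup

/-! ### Left invariant forms and local homomorphisms -/

section LeftInvariantForm

open scoped Pointwise

variable {E : Type*} [NormedAddCommGroup E] [NormedSpace ℝ E]
  {G : Type*} [TopologicalSpace G] [ChartedSpace E G] [Group G]

variable (E G) in
/-- The quotient `(y, z) ↦ y⁻¹ * z` in the chart at `1`. -/
def chartQuot (p : E × E) : E :=
  chartAt E (1 : G) (((chartAt E (1 : G)).symm p.1)⁻¹ * (chartAt E (1 : G)).symm p.2)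

variable (G) in
/-- The left invariant `1`-form with value `l` at `1`, in the chart at `1`. -/
def leftForm (l : E →L[ℝ] ℝ) (y : E) : E →L[ℝ] ℝ :=
  l.comp ((fderiv ℝ (chartQuot E G) (y, y)).comp (ContinuousLinearMap.inr ℝ E E))

variable [LieGroup 𝓘(ℝ, E) ∞ G]

theorem contDiffAt_chartQuot {y : E} (hy : y ∈ (chartAt E (1 : G)).target) :
    ContDiffAt ℝ ∞ (chartQuot E G) (y, y) := by
  have h := contMDiffAt_chartAt_symm (1 : G) hy
  have h1 : ContMDiffAt 𝓘(ℝ, E × E) 𝓘(ℝ, E) ∞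
      (fun p : E × E => ((chartAt E (1 : G)).symm p.1)⁻¹ * (chartAt E (1 : G)).symm p.2) (y, y) :=
    (ContMDiffAt.comp (y, y) (g := (chartAt E (1 : G)).symm) h
        contDiff_fst.contMDiff.contMDiffAt).inv.mul
      (ContMDiffAt.comp (y, y) (g := (chartAt E (1 : G)).symm) h
        contDiff_snd.contMDiff.contMDiffAt)
  refine contMDiffAt_iff_contDiffAt.1 (ContMDiffAt.comp (y, y) ?_ h1)
  apply contMDiffAt_chartAt
  simp

theorem contDiffAt_leftForm (l : E →L[ℝ] ℝ) {y : E} (hy : y ∈ (chartAt E (1 : G)).target) :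
    ContDiffAt ℝ ∞ (leftForm G l) y := by
  have h : ContDiffAt ℝ ∞ (fderiv ℝ (chartQuot E G)) (y, y) :=
    (contDiffAt_chartQuot hy).fderiv_right (by simp)
  have h2 : ContDiffAt ℝ ∞ (fun z => fderiv ℝ (chartQuot E G) (z, z)) y :=
    ContDiffAt.comp y (f := fun z : E => (z, z)) h (contDiff_id.prodMk contDiff_id).contDiffAt
  exact contDiffAt_const.clm_comp (h2.clm_comp contDiffAt_const)

/-- At `z = y` the quotient equals `1`, where the chart has identity differential. Hence the second
partial derivative of `chartQuot` on the diagonal is the Maurer–Cartan form in coordinates. -/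
theorem hasDiffAt_inv_mul_chartAt_symm {y : E} (hy : y ∈ (chartAt E (1 : G)).target) :
    HasDiffAt (fun z => ((chartAt E (1 : G)).symm y)⁻¹ * (chartAt E (1 : G)).symm z) y
      ((fderiv ℝ (chartQuot E G) (y, y)).comp (ContinuousLinearMap.inr ℝ E E)) := by
  have h := contMDiffAt_chartAt_symm (1 : G) hy
  have h1 : ContMDiffAt 𝓘(ℝ, E) 𝓘(ℝ, E) ∞
      (fun z => ((chartAt E (1 : G)).symm y)⁻¹ * (chartAt E (1 : G)).symm z) y :=
    contMDiffAt_const.mul h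
  have h2 := (hasDiffAt_chartAt (1 : G)).comp h1.hasDiffAt (by simp)
  have h3 : HasFDerivAt (fun z => chartQuot E G (y, z))
      ((fderiv ℝ (chartQuot E G) (y, y)).comp (ContinuousLinearMap.inr ℝ E E)) y :=
    HasFDerivAt.comp y (((contDiffAt_chartQuot hy).differentiableAt (by simp)).hasFDerivAt)
      (hasFDerivAt_prodMk_right y y)
  have h4 := h2.unique (hasDiffAt_iff_hasFDerivAt.2 h3)
  rw [← h4]
  exact h1.hasDiffAt

theorem leftForm_comp_fderiv (l : E →L[ℝ] ℝ) {y : E} (hy : y ∈ (chartAt E (1 : G)).target)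
    {h : E → E} {T : E →L[ℝ] E} (hh : HasFDerivAt h T y) (hhy : h y ∈ (chartAt E (1 : G)).target)
    {a : G} (hha : ∀ᶠ z in 𝓝 y, (chartAt E (1 : G)).symm (h z) = a * (chartAt E (1 : G)).symm z) :
    (leftForm G l (h y)).comp T = leftForm G l y := by
  have h1 := (hasDiffAt_inv_mul_chartAt_symm hhy).comp (hasDiffAt_iff_hasFDerivAt.2 hh) rfl
  have h2 : HasDiffAt (fun z => ((chartAt E (1 : G)).symm (h y))⁻¹ * (chartAt E (1 : G)).symm (h z))
      y ((fderiv ℝ (chartQuot E G) (y, y)).comp (ContinuousLinearMap.inr ℝ E E)) := by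
    refine (hasDiffAt_inv_mul_chartAt_symm hy).congr ?_
    filter_upwards [hha] with z hz
    rw [hz, hha.self_of_nhds]
    group
  unfold leftForm
  rw [← h1.unique h2]
  rfl

/-- With `u` the point at `y`, `(g u⁻¹ g)⁻¹ (g z⁻¹ g)` is the conjugate of `(u⁻¹ z)⁻¹` by `g⁻¹ u`.
Inversion contributes the sign, and the conjugation disappears by `Ad`-invariance. -/
theorem leftForm_comp_fderiv_of_inv (l : E →L[ℝ] ℝ) (hl : ∀ a : G, l.comp (adjointMap E a) = l)
    {y : E} (hy : y ∈ (chartAt E (1 : G)).target)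
    {h : E → E} {T : E →L[ℝ] E} (hh : HasFDerivAt h T y) (hhy : h y ∈ (chartAt E (1 : G)).target)
    {g : G} (hha : ∀ᶠ z in 𝓝 y,
      (chartAt E (1 : G)).symm (h z) = g * ((chartAt E (1 : G)).symm z)⁻¹ * g) :
    (leftForm G l (h y)).comp T = -leftForm G l y := by
  have h1 := (hasDiffAt_inv_mul_chartAt_symm hhy).comp (hasDiffAt_iff_hasFDerivAt.2 hh) rfl
  set u := (chartAt E (1 : G)).symm y with hu
  have h0 := hasDiffAt_inv_one.comp (hasDiffAt_inv_mul_chartAt_symm hy) (inv_mul_cancel _)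
  have h2 := ((hasDiffAt_conj_one (g⁻¹ * u)).comp h0 (by simp)).congr
    (g := fun z => ((chartAt E (1 : G)).symm (h y))⁻¹ * (chartAt E (1 : G)).symm (h z)) (by
      filter_upwards [hha] with z hz
      rw [hz, hha.self_of_nhds, ← hu]
      group)
  have h3 := h1.unique h2
  have h4 : (leftForm G l (h y)).comp T = l.comp (((fderiv ℝ (chartQuot E G) (h y, h y)).comp
    (ContinuousLinearMap.inr ℝ E E)).comp T) := rfl
  rw [h4, h3, ← ContinuousLinearMap.comp_assoc, hl]
  ext v
  simp [leftForm]

/-- The symmetry `z ↦ g z⁻¹ g` about `g` becomes inversion after left translation by `g⁻¹`, since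
`g⁻¹ (g z⁻¹ g) = (g⁻¹ z)⁻¹`. -/
theorem fderiv_eq_neg_of_inv {g : G} {y : E} (hy : y ∈ (chartAt E (1 : G)).target)
    {h : E → E} {T : E →L[ℝ] E} (hh : HasFDerivAt h T y) (hhy : h y = y)
    (hg : (chartAt E (1 : G)).symm y = g)
    (hha : ∀ᶠ z in 𝓝 y,
      (chartAt E (1 : G)).symm (h z) = g * ((chartAt E (1 : G)).symm z)⁻¹ * g) :
    T = -ContinuousLinearMap.id ℝ E := by
  set D := (fderiv ℝ (chartQuot E G) (y, y)).comp (ContinuousLinearMap.inr ℝ E E) with hD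
  have hDy : HasDiffAt (fun z => g⁻¹ * (chartAt E (1 : G)).symm z) y D := by
    rw [← hg]; exact hasDiffAt_inv_mul_chartAt_symm hy
  have h1 := hDy.comp (hasDiffAt_iff_hasFDerivAt.2 hh) hhy
  have h2 := (hasDiffAt_inv_one.comp hDy (by simp [hg])).congr
    (g := fun z => g⁻¹ * (chartAt E (1 : G)).symm (h z)) (by
      filter_upwards [hha] with z hz
      rw [hz]
      group)
  have h3 := h1.unique h2
  have hgs : g ∈ (chartAt E (1 : G)).source := hg ▸ (chartAt E (1 : G)).map_target hy
  have hinv : ContMDiffAt 𝓘(ℝ, E) 𝓘(ℝ, E) ∞ (fun z : G => chartAt E (1 : G) (g * z)) 1 := by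
    refine ContMDiffAt.comp (1 : G) ?_ (contMDiff_const_mul (E := E) g).contMDiffAt
    rw [mul_one]
    exact contMDiffAt_chartAt 1 hgs
  have h5 := (hinv.hasDiffAt.comp hDy (by simp [hg])).congr (g := fun z => z) (by
    filter_upwards [(chartAt E (1 : G)).open_target.mem_nhds hy] with z hz
    simp [(chartAt E (1 : G)).right_inv hz])
  have h6 := h5.unique (hasDiffAt_id y)
  ext v
  have h7 := DFunLike.congr_fun h3 v
  have h8 := DFunLike.congr_fun h6 (T v)
  have h9 := DFunLike.congr_fun h6 v
  simp only [ContinuousLinearMap.comp_apply, ContinuousLinearMap.id_apply,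
    neg_apply] at h7 h8 h9 ⊢
  rw [← h8, h7, map_neg, h9]

/-- This is closedness of the form `η`. The symmetry `j` about `g` satisfies `j^*η = -η`, so `j^*dη
= -dη`; but its differential at `g` is `-1`, which acts trivially on 2-forms, so `dη = 0` at `g`.
Concretely, the identity `j^*η = -η` is differentiated at `y`, where the second derivative of `j`
drops out on antisymmetrizing. -/
theorem fderiv_leftForm_symm (l : E →L[ℝ] ℝ) (hl : ∀ a : G, l.comp (adjointMap E a) = l)
    {y : E} (hy : y ∈ (chartAt E (1 : G)).target) (v w : E) :
    fderiv ℝ (leftForm G l) y v w = fderiv ℝ (leftForm G l) y w v := by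
  set φ := chartAt E (1 : G) with hφ
  set g := φ.symm y with hg
  have hgs : g ∈ φ.source := φ.map_target hy
  set j : E → E := fun z => φ (g * (φ.symm z)⁻¹ * g) with hj
  have hjG : ContMDiffAt 𝓘(ℝ, E) 𝓘(ℝ, E) ∞ (fun z => g * (φ.symm z)⁻¹ * g) y :=
    (contMDiffAt_const.mul (contMDiffAt_chartAt_symm (1 : G) hy).inv).mul contMDiffAt_const
  have hjy0 : g * (φ.symm y)⁻¹ * g = g := by simp [hg]
  have hjs : ContDiffAt ℝ ∞ j y := by
    refine contMDiffAt_iff_contDiffAt.1 (ContMDiffAt.comp y ?_ hjG)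
    rw [hjy0]; exact contMDiffAt_chartAt 1 hgs
  have hjy : j y = y := by simp only [hj, hjy0]; exact φ.right_inv hy
  have hev : ∀ᶠ z in 𝓝 y, φ.symm (j z) = g * (φ.symm z)⁻¹ * g := by
    have := hjG.continuousAt.preimage_mem_nhds (t := φ.source)
      (by rw [hjy0]; exact φ.open_source.mem_nhds hgs)
    filter_upwards [this] with z hz
    exact φ.left_inv hz
  have hdj : ∀ᶠ z in 𝓝 y, DifferentiableAt ℝ j z := by
    have h1 := (hjs.of_le (m := 1) (by simp)).eventually (by simp)
    filter_upwards [h1] with z hz using hz.differentiableAt (by simp)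
  have key : ∀ᶠ z in 𝓝 y, (leftForm G l (j z)).comp (fderiv ℝ j z) = -leftForm G l z := by
    have htar : φ.target ∈ 𝓝 y := φ.open_target.mem_nhds hy
    have htar2 : ∀ᶠ z in 𝓝 y, j z ∈ φ.target :=
      hjs.continuousAt.eventually_mem (by rw [hjy]; exact htar)
    filter_upwards [htar, htar2, hdj, hev.eventually_nhds] with z h1 h2 h3 h4
    exact leftForm_comp_fderiv_of_inv l hl h1 h3.hasFDerivAt h2 h4
  have hT : fderiv ℝ j y = -ContinuousLinearMap.id ℝ E :=
    fderiv_eq_neg_of_inv hy hdj.self_of_nhds.hasFDerivAt hjy rfl hev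
  have hη : HasFDerivAt (leftForm G l) (fderiv ℝ (leftForm G l) y) (j y) := by
    rw [hjy]
    exact ((contDiffAt_leftForm l hy).differentiableAt (by simp)).hasFDerivAt
  have hη' : HasFDerivAt (leftForm G l) (fderiv ℝ (leftForm G l) y) y := by rwa [hjy] at hη
  have hd2 : HasFDerivAt (fderiv ℝ j) (fderiv ℝ (fderiv ℝ j) y) y :=
    ((hjs.fderiv_right (m := ∞) (by simp)).differentiableAt (by simp)).hasFDerivAt
  have hlhs := (hη.comp y hdj.self_of_nhds.hasFDerivAt).clm_comp hd2
  have heq := (hlhs.congr_of_eventuallyEq (key.mono fun z hz => hz.symm)).unique hη'.neg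
  have hsymm : fderiv ℝ (fderiv ℝ j) y v w = fderiv ℝ (fderiv ℝ j) y w v :=
    (hjs.isSymmSndFDerivAt (by
      rw [minSmoothness_of_isRCLikeNormedField]
      exact WithTop.coe_le_coe.2 (le_top : (2 : ℕ∞) ≤ ⊤))).eq v w
  have e1 := DFunLike.congr_fun (DFunLike.congr_fun heq v) w
  have e2 := DFunLike.congr_fun (DFunLike.congr_fun heq w) v
  simp [hT] at e1 e2
  rw [hsymm] at e1
  linarith

/-- An `Ad`-invariant linear form is the differential at `1` of a smooth local homomorphism. -/
theorem exists_local_hom [FiniteDimensional ℝ E] (l : E →L[ℝ] ℝ)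
    (hl : ∀ a : G, l.comp (adjointMap E a) = l) :
    ∃ (V : Set G) (c : G → ℝ), IsOpen V ∧ (1 : G) ∈ V ∧
      (∀ x ∈ V, ContMDiffAt 𝓘(ℝ, E) 𝓘(ℝ, ℝ) ∞ c x) ∧
      HasDiffAt c 1 l ∧ ∀ x ∈ V, ∀ y ∈ V, c (x * y) = c x + c y := by
  have : IsTopologicalGroup G := topologicalGroup_of_lieGroup 𝓘(ℝ, E) ∞
  set φ := chartAt E (1 : G) with hφ
  have h1 : (1 : G) ∈ φ.source := mem_chart_source E 1
  obtain ⟨r, hr, hball⟩ := Metric.mem_nhds_iff.1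
    (φ.open_target.mem_nhds (mem_chart_target E (1 : G)))
  obtain ⟨f, hf⟩ := (convex_ball (φ 1) r).exists_forall_hasFDerivAt_of_fderiv_symmetric
    Metric.isOpen_ball
    (show DifferentiableOn ℝ (leftForm G l) _ from fun y hy =>
      ((contDiffAt_leftForm l (hball hy)).differentiableAt (by simp)).differentiableWithinAt)
    (fun y hy v w => fderiv_leftForm_symm l hl (hball hy) v w)
  have hfs : ContDiffOn ℝ ∞ f (Metric.ball (φ 1) r) := by
    rw [contDiffOn_infty_iff_fderiv_of_isOpen Metric.isOpen_ball]
    refine ⟨fun y hy => (hf y hy).differentiableAt.differentiableWithinAt, ?_⟩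
    refine ContDiffOn.congr (f := leftForm G l) ?_ fun y hy => (hf y hy).fderiv
    exact fun y hy => (contDiffAt_leftForm l (hball hy)).contDiffWithinAt
  set c : G → ℝ := fun x => f (φ x) - f (φ 1) with hc
  set W : Set G := φ.source ∩ φ ⁻¹' Metric.ball (φ 1) r with hW
  have hWo : IsOpen W := φ.isOpen_inter_preimage Metric.isOpen_ball
  have hW1 : (1 : G) ∈ W := ⟨h1, Metric.mem_ball_self hr⟩
  obtain ⟨V', hV'o, hV'1, hV'⟩ := exists_open_nhds_one_mul_subset (hWo.mem_nhds hW1)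
  have hV'W : (φ.symm ⁻¹' V') ∩ φ.target ∈ 𝓝 (φ 1) := by
    refine Filter.inter_mem ?_ (φ.open_target.mem_nhds (mem_chart_target E (1 : G)))
    refine (φ.continuousAt_symm (mem_chart_target E (1 : G))).preimage_mem_nhds ?_
    rw [φ.left_inv h1]
    exact hV'o.mem_nhds hV'1
  obtain ⟨ε, hε, hεb⟩ := Metric.mem_nhds_iff.1 hV'W
  -- Since `1 ∈ V'`, the set `V'` lies in `V' * V'`, hence in `W`.
  have hmemW : ∀ x ∈ φ.source, φ x ∈ Metric.ball (φ 1) ε → x ∈ W := by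
    intro x hxs hx
    have := (hεb hx).1
    rw [mem_preimage, φ.left_inv hxs] at this
    simpa using hV' (mul_mem_mul hV'1 this)
  have hfG : ∀ x ∈ W, ContMDiffAt 𝓘(ℝ, E) 𝓘(ℝ, ℝ) ∞ c x := by
    intro x hx
    refine ContMDiffAt.sub ?_ contMDiffAt_const
    refine ContMDiffAt.comp x (g := f) (I' := 𝓘(ℝ, E)) ?_ (contMDiffAt_chartAt 1 hx.1)
    exact (hfs.contDiffAt (Metric.isOpen_ball.mem_nhds hx.2)).contMDiffAt
  refine ⟨φ.source ∩ φ ⁻¹' Metric.ball (φ 1) ε, c, φ.isOpen_inter_preimage Metric.isOpen_ball,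
    ⟨h1, Metric.mem_ball_self hε⟩, ?_, ?_, ?_⟩
  · rintro x ⟨hxs, hx⟩
    exact hfG x (hmemW x hxs hx)
  · have hd := (hasDiffAt_iff_hasFDerivAt.2 (hf (φ 1) (Metric.mem_ball_self hr))).comp
      (hasDiffAt_chartAt (1 : G)) rfl
    have hl1 : leftForm G l (φ 1) = l := by
      have h2 := hasDiffAt_inv_mul_chartAt_symm (mem_chart_target E (1 : G))
      have h3 : HasDiffAt (fun z => ((chartAt E (1 : G)).symm (chartAt E (1 : G) 1))⁻¹ *
          (chartAt E (1 : G)).symm z) (chartAt E (1 : G) 1) (ContinuousLinearMap.id ℝ E) := by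
        rw [(chartAt E (1 : G)).left_inv h1]
        simpa using hasDiffAt_chartAt_symm (1 : G)
      have h4 := h2.unique h3
      unfold leftForm
      rw [h4]
      rfl
    rw [hl1] at hd
    exact (hasDiffAt_iff_hasFDerivAt.2 ((hasFDerivAt_id (𝕜 := ℝ) (f (φ 1))).sub_const
      (f (φ 1)))).comp hd rfl
  · rintro x ⟨hxs, hx⟩ y ⟨hys, hy⟩
    have hx' : x ∈ V' := by
      have := (hεb hx).1
      rwa [mem_preimage, φ.left_inv hxs] at this
    set h : E → E := fun z => φ (x * φ.symm z) with hh
    have hmul : ∀ z ∈ Metric.ball (φ 1) ε, x * φ.symm z ∈ W := fun z hz =>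
      hV' (mul_mem_mul hx' (hεb hz).1)
    -- By left invariance, left translation by `x` changes the primitive `f` only by a constant on
    -- the ball; its values at `y` and `1` give additivity.
    have hder : ∀ z ∈ Metric.ball (φ 1) ε,
        HasFDerivAt (fun z => f (h z) - f z) (0 : E →L[ℝ] ℝ) z := by
      intro z hz
      have hzt : z ∈ φ.target := (hεb hz).2
      have hzr : z ∈ Metric.ball (φ 1) r := by
        have := hmemW (φ.symm z) (φ.map_target hzt) (by simpa [φ.right_inv hzt] using hz)
        simpa [hW, φ.right_inv hzt] using this.2
      have hG : ContMDiffAt 𝓘(ℝ, E) 𝓘(ℝ, E) ∞ (fun z => x * φ.symm z) z :=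
        contMDiffAt_const.mul (contMDiffAt_chartAt_symm (1 : G) hzt)
      have hhs : DifferentiableAt ℝ h z := by
        have : ContDiffAt ℝ ∞ h z := contMDiffAt_iff_contDiffAt.1
          (ContMDiffAt.comp z (contMDiffAt_chartAt 1 (hmul z hz).1) hG)
        exact this.differentiableAt (by simp)
      have h3 := leftForm_comp_fderiv l hzt hhs.hasFDerivAt
        (hball (hmul z hz).2) (a := x) (by
          filter_upwards [hG.continuousAt.preimage_mem_nhds
            (φ.open_source.mem_nhds (hmul z hz).1)] with w hw
          exact φ.left_inv hw)
      have h4 := ((hf (h z) (hmul z hz).2).comp z hhs.hasFDerivAt).sub (hf z hzr)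
      rw [h3, sub_self] at h4
      exact h4
    have hconst := Metric.isOpen_ball.is_const_of_fderiv_eq_zero (𝕜 := ℝ)
      (convex_ball (φ 1) ε).isPreconnected
      (fun z hz => (hder z hz).differentiableAt.differentiableWithinAt)
      (fun z hz => (hder z hz).fderiv) hy (Metric.mem_ball_self hε)
    simp only [hh, φ.left_inv hys, φ.left_inv h1, mul_one] at hconst
    simp only [hc]
    linarith

end LeftInvariantForm

/-! ### Extension of local homomorphisms by monodromy -/

section Monodromy

variable {G A : Type*} [TopologicalSpace G] [Group G] [IsTopologicalGroup G]
  [AddCommGroup A]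

/-- The covering of `G` by the local extensions of a local homomorphism `c`. -/
def localHomBundle [TopologicalSpace A] [DiscreteTopology A] (V : Set G) (hV : IsOpen V)
    (h1 : (1 : G) ∈ V) (c : G → A)
    (hc : ∀ x ∈ V, ∀ y ∈ V, c (x * y) = c x + c y) : FiberBundleCore G G A where
  baseSet i := {x | i⁻¹ * x ∈ V}
  isOpen_baseSet i := hV.preimage (by fun_prop)
  indexAt x := x
  mem_baseSet_at x := by simpa using h1
  -- A value `v` over `x` has `i`-coordinate `v - c (i⁻¹ * x)`, so sections with constant
  -- `i`-coordinate are the translates of `c` at `i`. By additivity of `c` the change of coordinates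
  -- is locally constant in `x`.
  coordChange i j x s := s + (c (i⁻¹ * x) - c (j⁻¹ * x))
  coordChange_self i x _ s := by simp
  continuousOn_coordChange i j := by
    rintro ⟨x, s⟩ ⟨⟨hi, hj⟩, -⟩
    refine ContinuousAt.continuousWithinAt ?_
    have h2 : ∀ᶠ z in 𝓝 x, x⁻¹ * z ∈ V := by
      refine ContinuousAt.preimage_mem_nhds (f := fun z => x⁻¹ * z) (by fun_prop) ?_
      simpa using hV.mem_nhds h1
    have h3 : ∀ᶠ p in 𝓝 (x, s), p.2 + (c (i⁻¹ * p.1) - c (j⁻¹ * p.1)) =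
        p.2 + (c (i⁻¹ * x) - c (j⁻¹ * x)) := by
      filter_upwards [continuous_fst.continuousAt.eventually h2] with p hp
      have e1 := hc _ hi _ hp
      have e2 := hc _ hj _ hp
      rw [show i⁻¹ * x * (x⁻¹ * p.1) = i⁻¹ * p.1 by group] at e1
      rw [show j⁻¹ * x * (x⁻¹ * p.1) = j⁻¹ * p.1 by group] at e2
      rw [e1, e2]
      abel
    refine ContinuousAt.congr ?_ (h3.mono fun p hp => hp.symm)
    exact (continuous_of_discreteTopology (f := fun a : A => a + (c (i⁻¹ * x) - c (j⁻¹ * x)))).comp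
      continuous_snd |>.continuousAt
  coordChange_comp i j k x _ s := by abel

/-- A local homomorphism on a simply connected group extends to the whole group. -/
theorem exists_hom_of_local_hom [SimplyConnectedSpace G] [LocallyPathConnectedSpace G]
    (V : Set G) (hV : IsOpen V) (h1 : (1 : G) ∈ V) (c : G → A)
    (hc : ∀ x ∈ V, ∀ y ∈ V, c (x * y) = c x + c y) :
    ∃ χ : G → A, (∀ x y, χ (x * y) = χ x + χ y) ∧ χ =ᶠ[𝓝 1] c := by
  let _ : TopologicalSpace A := ⊥
  have : DiscreteTopology A := ⟨rfl⟩
  set Z := localHomBundle V hV h1 c hc with hZ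
  have hc1 : c 1 = 0 := by simpa using hc 1 h1 1 h1
  -- The discrete fibre makes the bundle a covering, so the identity of the simply connected `G`
  -- lifts to a global section.
  have hcov : IsCoveringMap (Bundle.TotalSpace.proj : Bundle.TotalSpace A Z.Fiber → G) :=
    FiberBundle.isCoveringMap (F := A) (E := Z.Fiber)
  obtain ⟨F, ⟨-, hF⟩, -⟩ := hcov.existsUnique_continuousMap_lifts (ContinuousMap.id G) 1
    (⟨1, (0 : A)⟩ : Bundle.TotalSpace A Z.Fiber) rfl
  have hF' : ∀ x, (F x).proj = x := fun x => congrFun hF x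
  set v : G → A := fun x => (F x).snd with hv
  have hloc : ∀ x₀, ∀ᶠ x in 𝓝 x₀, v x = v x₀ + c (x₀⁻¹ * x) := by
    intro x₀
    have hmem : F x₀ ∈ (Z.localTriv x₀).source := by
      rw [FiberBundleCore.mem_localTriv_source, hF']
      exact Z.mem_baseSet_at x₀
    have hcont : ContinuousAt (fun x => (Z.localTriv x₀ (F x)).2) x₀ :=
      continuous_snd.continuousAt.comp
        (((Z.localTriv x₀).continuousOn.continuousAt
          ((Z.localTriv x₀).open_source.mem_nhds hmem)).comp F.continuous.continuousAt)
    have heq : ∀ x, (Z.localTriv x₀ (F x)).2 = v x - c (x₀⁻¹ * x) := by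
      intro x
      rw [FiberBundleCore.localTriv_apply]
      change v x + (c ((F x).proj⁻¹ * (F x).proj) - c (x₀⁻¹ * (F x).proj)) = _
      rw [hF', inv_mul_cancel, hc1]
      abel
    have := hcont.eventually_mem ((isOpen_discrete {(Z.localTriv x₀ (F x₀)).2}).mem_nhds rfl)
    filter_upwards [this] with x hx
    rw [mem_singleton_iff, heq, heq, inv_mul_cancel, hc1, sub_zero] at hx
    rw [← hx]; abel
  -- The increments of `v` near `x₀` depend only on `x₀⁻¹ * x`, which is unchanged by left
  -- translation by `h`; so the difference is locally constant.
  have hconst : ∀ h x, v (h * x) - v x = v h - v 1 := by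
    intro h x
    have hlc : IsLocallyConstant fun x => v (h * x) - v x := by
      rw [IsLocallyConstant.iff_eventually_eq]
      intro x₀
      have h2 : ∀ᶠ x in 𝓝 x₀, v (h * x) = v (h * x₀) + c ((h * x₀)⁻¹ * (h * x)) :=
        (continuous_const.mul continuous_id).continuousAt.eventually (hloc (h * x₀))
      filter_upwards [h2, hloc x₀] with x e1 e2
      rw [e1, e2, show (h * x₀)⁻¹ * (h * x) = x₀⁻¹ * x by group]
      abel
    simpa using hlc.apply_eq_of_preconnectedSpace x 1
  refine ⟨fun x => v x - v 1, fun x y => ?_, ?_⟩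
  · have := hconst x y
    change v (x * y) - v 1 = (v x - v 1) + (v y - v 1)
    rw [← this]; abel
  · filter_upwards [hloc 1] with x hx
    rw [hx]; simp

end Monodromy

/-! ### Existence of a nontrivial character -/

section Character

variable {E : Type*} [NormedAddCommGroup E] [NormedSpace ℝ E] [FiniteDimensional ℝ E]
  {G : Type*} [TopologicalSpace G] [ChartedSpace E G] [Group G] [LieGroup 𝓘(ℝ, E) ∞ G]

/-- A simply connected solvable Lie group of positive dimension has a nontrivial smooth character
with values in `ℝ`. -/
theorem exists_character [SimplyConnectedSpace G] [Group.IsSolvable G] [Nontrivial G] :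
    ∃ (χ : G → ℝ) (l : E →L[ℝ] ℝ), (∀ x y, χ (x * y) = χ x + χ y) ∧
      ContMDiff 𝓘(ℝ, E) 𝓘(ℝ, ℝ) ∞ χ ∧ HasDiffAt χ 1 l ∧ l ≠ 0 := by
  have : IsTopologicalGroup G := topologicalGroup_of_lieGroup 𝓘(ℝ, E) ∞
  have : LocallyPathConnectedSpace G := ChartedSpace.locallyPathConnectedSpace E G
  obtain ⟨l, hl0, hl⟩ := exists_ne_zero_comp_adjointMap_eq (E := E)
    (commutator_ne_top_of_isSolvable G)
  obtain ⟨V, c, hVo, hV1, hcs, hcd, hc⟩ := exists_local_hom l hl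
  obtain ⟨χ, hχ, hχc⟩ := exists_hom_of_local_hom V hVo hV1 c hc
  refine ⟨χ, l, hχ, fun x => ?_, hcd.congr hχc, hl0⟩
  have h1 : ContMDiffAt 𝓘(ℝ, E) 𝓘(ℝ, ℝ) ∞ χ 1 := (hcs 1 hV1).congr_of_eventuallyEq hχc
  -- Additivity carries smoothness from `1` to every point.
  have h2 : χ = fun y => χ x + χ (x⁻¹ * y) := by
    ext y; rw [← hχ]; simp
  rw [h2]
  refine contMDiffAt_const.add (ContMDiffAt.comp x (g := χ) ?_
    (contMDiff_const_mul (E := E) x⁻¹).contMDiffAt)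
  rw [inv_mul_cancel]; exact h1

end Character

/-! ### Smooth global sections of a character -/

section Section

variable {E : Type*} [NormedAddCommGroup E] [NormedSpace ℝ E]
  {G : Type*} [TopologicalSpace G] [ChartedSpace E G] [Group G] [LieGroup 𝓘(ℝ, E) ∞ G]

/-- A smooth local section of a character extends to a global one: periodic gluing. -/
theorem exists_section_of_local_section_of_two {χ : G → ℝ} (hχ : ∀ x y, χ (x * y) = χ x + χ y)
    {s : ℝ → G} (hs : ∀ t ∈ Ioo (-2 : ℝ) 2, ContMDiffAt 𝓘(ℝ, ℝ) 𝓘(ℝ, E) ∞ s t) (hs0 : s 0 = 1)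
    (hχs : ∀ t ∈ Ioo (-2 : ℝ) 2, χ (s t) = t) :
    ∃ σ : ℝ → G, ContMDiff 𝓘(ℝ, ℝ) 𝓘(ℝ, E) ∞ σ ∧ ∀ t, χ (σ t) = t := by
  -- A smooth step, equal to `0` up to `1/3` and to `1` from `2/3` on.
  set β : ℝ → ℝ := fun t => Real.smoothTransition (3 * t - 1) with hβ
  have hβ0 : ∀ t ≤ 1 / 3, β t = 0 := fun t ht =>
    Real.smoothTransition.zero_of_nonpos (by linarith)
  have hβ1 : ∀ t, 2 / 3 ≤ t → β t = 1 := fun t ht =>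
    Real.smoothTransition.one_of_one_le (by linarith)
  have hβn : ∀ t, 0 ≤ β t := fun t => Real.smoothTransition.nonneg _
  have hβl : ∀ t, β t ≤ 1 := fun t => Real.smoothTransition.le_one _
  have hβs : ContDiff ℝ ∞ β :=
    Real.smoothTransition.contDiff.comp ((contDiff_const.mul contDiff_id).sub contDiff_const)
  -- Near `0` this is `s t`, near `1` it is `s (t - 1) * s 1`; so the pieces `τ (t - k) * s 1 ^ k`
  -- fit together at the integers.
  set τ : ℝ → G := fun t => s (t - β t) * s (β t) with hτ
  have hmem1 : ∀ t ∈ Ioo (-1/3 : ℝ) (4/3), t - β t ∈ Ioo (-2 : ℝ) 2 := fun t ht =>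
    ⟨by linarith [ht.1, hβl t], by linarith [ht.2, hβn t]⟩
  have hmem2 : ∀ t, β t ∈ Ioo (-2 : ℝ) 2 := fun t => ⟨by linarith [hβn t], by linarith [hβl t]⟩
  have hτs : ∀ t ∈ Ioo (-1/3 : ℝ) (4/3), ContMDiffAt 𝓘(ℝ, ℝ) 𝓘(ℝ, E) ∞ τ t := by
    intro t ht
    refine ContMDiffAt.mul ?_ ?_
    · exact ContMDiffAt.comp t (hs _ (hmem1 t ht)) (contDiff_id.sub hβs).contMDiff.contMDiffAt
    · exact ContMDiffAt.comp t (hs _ (hmem2 t)) hβs.contMDiff.contMDiffAt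
  have hχ1 : χ 1 = 0 := by simpa using hχ 1 1
  have hχz : ∀ (a : G) (k : ℤ), χ (a ^ k) = k * χ a := by
    intro a k
    let f : G →* Multiplicative ℝ :=
      { toFun := fun g => Multiplicative.ofAdd (χ g)
        map_one' := by rw [hχ1]; rfl
        map_mul' := fun x y => by rw [hχ]; rfl }
    have := congrArg Multiplicative.toAdd (map_zpow f a k)
    simpa [f] using this
  set σ : ℝ → G := fun t => τ (Int.fract t) * s 1 ^ ⌊t⌋ with hσ
  -- The window exceeds `[0, 1]` by `1/3` on each side, exactly the range where `β` is constant in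
  -- both neighbouring formulas.
  have key : ∀ (k : ℤ) (t : ℝ), t - k ∈ Ioo (-1/3 : ℝ) (4/3) → σ t = τ (t - k) * s 1 ^ k := by
    intro k t ht
    have h1 := Int.floor_le t
    have h2 := Int.lt_floor_add_one t
    have hk1 : k - 1 ≤ ⌊t⌋ := by
      rw [Int.le_floor]; push_cast; linarith [ht.1]
    have hk2 : ⌊t⌋ ≤ k + 1 := by
      rw [← Int.lt_add_one_iff, Int.floor_lt]; push_cast; linarith [ht.2]
    simp only [hσ, Int.fract]
    rcases (by omega : ⌊t⌋ = k - 1 ∨ ⌊t⌋ = k ∨ ⌊t⌋ = k + 1) with h | h | h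
    · rw [h] at h1 h2 ⊢
      push_cast at h1 h2 ⊢
      have e1 : β (t - (k - 1)) = 1 := hβ1 _ (by linarith [ht.1])
      have e2 : β (t - k) = 0 := hβ0 _ (by linarith)
      simp only [hτ, e1, e2, hs0]
      rw [show t - ((k : ℝ) - 1) - 1 = t - k - 0 by ring, mul_one, zpow_sub_one,
        (Commute.self_zpow (s 1) k).inv_left.symm.eq]
      group
    · rw [h]
    · rw [h] at h1 h2 ⊢
      push_cast at h1 h2 ⊢
      have e1 : β (t - (k + 1)) = 0 := hβ0 _ (by linarith [ht.2])
      have e2 : β (t - k) = 1 := hβ1 _ (by linarith)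
      simp only [hτ, e1, e2, hs0]
      rw [show t - ((k : ℝ) + 1) - 0 = t - k - 1 by ring, mul_one, zpow_add_one,
        (Commute.self_zpow (s 1) k).symm.eq, mul_assoc]
  have hfl : ∀ t : ℝ, t - ⌊t⌋ ∈ Ioo (-1/3 : ℝ) (4/3) := fun t =>
    ⟨by linarith [Int.floor_le t], by linarith [Int.lt_floor_add_one t]⟩
  refine ⟨σ, fun t => ?_, fun t => ?_⟩
  · have hev : ∀ᶠ u in 𝓝 t, u - (⌊t⌋ : ℝ) ∈ Ioo (-1/3 : ℝ) (4/3) :=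
      ContinuousAt.eventually_mem (f := fun u : ℝ => u - (⌊t⌋ : ℝ)) (by fun_prop)
        (isOpen_Ioo.mem_nhds (hfl t))
    refine ContMDiffAt.congr_of_eventuallyEq ?_ (hev.mono fun u hu => key ⌊t⌋ u hu)
    refine ContMDiffAt.mul ?_ contMDiffAt_const
    exact ContMDiffAt.comp t (hτs _ (hfl t)) (contDiff_id.sub contDiff_const).contMDiff.contMDiffAt
  · rw [key ⌊t⌋ t (hfl t), hχ, hχz, hχ, hχs _ (hmem1 _ (hfl t)), hχs _ (hmem2 _),
      hχs 1 (by norm_num)]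
    ring

/-- Rescaling by `ε / 2` carries `(-2, 2)` to `(-ε, ε)`. -/
theorem exists_section_of_local_section {χ : G → ℝ} (hχ : ∀ x y, χ (x * y) = χ x + χ y)
    {s : ℝ → G} {ε : ℝ} (hε : 0 < ε)
    (hs : ∀ t ∈ Ioo (-ε) ε, ContMDiffAt 𝓘(ℝ, ℝ) 𝓘(ℝ, E) ∞ s t) (hs0 : s 0 = 1)
    (hχs : ∀ t ∈ Ioo (-ε) ε, χ (s t) = t) :
    ∃ σ : ℝ → G, ContMDiff 𝓘(ℝ, ℝ) 𝓘(ℝ, E) ∞ σ ∧ ∀ t, χ (σ t) = t := by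
  have hmem : ∀ t ∈ Ioo (-2 : ℝ) 2, ε / 2 * t ∈ Ioo (-ε) ε := fun t ht =>
    ⟨by nlinarith [ht.1], by nlinarith [ht.2]⟩
  obtain ⟨σ, hσ, hσχ⟩ := exists_section_of_local_section_of_two (E := E)
    (χ := fun g => (ε / 2)⁻¹ * χ g) (s := fun t => s (ε / 2 * t))
    (fun x y => by simp only [hχ]; ring)
    (fun t ht => ContMDiffAt.comp t (hs _ (hmem t ht))
      (contDiff_const.mul contDiff_id).contMDiff.contMDiffAt)
    (by simpa using hs0) (fun t ht => by rw [hχs _ (hmem t ht)]; field_simp)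
  refine ⟨fun t => σ ((ε / 2)⁻¹ * t), hσ.comp (contDiff_const.mul contDiff_id).contMDiff,
    fun t => ?_⟩
  have := hσχ ((ε / 2)⁻¹ * t)
  exact mul_left_cancel₀ (by positivity) this

end Section

/-! ### Charts adapted to a character -/

section CharacterChart

variable (E E' : Type*) [NormedAddCommGroup E] [NormedSpace ℝ E]
  [NormedAddCommGroup E'] [NormedSpace ℝ E']
  {G : Type*} [TopologicalSpace G] [ChartedSpace E G] [Group G]

/-- A chart at `1` whose first coordinate is the given function `χ`. -/
structure CharacterChart (χ : G → ℝ) where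
  chart : OpenPartialHomeomorph G (ℝ × E')
  one_mem : 1 ∈ chart.source
  map_one : chart 1 = 0
  fst_eq : ∀ g ∈ chart.source, (chart g).1 = χ g
  smooth : ContMDiffOn 𝓘(ℝ, E) 𝓘(ℝ, ℝ × E') ∞ chart chart.source
  smooth_symm : ContMDiffOn 𝓘(ℝ, ℝ × E') 𝓘(ℝ, E) ∞ chart.symm chart.target

variable {E E'}

/-- Choose `v` with `l v = 1`, project onto the kernel of `l` along `v`, and identify the kernel
with `E'` by dimension. -/
theorem exists_linear_complement [FiniteDimensional ℝ E] [FiniteDimensional ℝ E']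
    (hdim : Module.finrank ℝ E = Module.finrank ℝ E' + 1) (l : E →L[ℝ] ℝ) (hl : l ≠ 0) :
    ∃ m : E →L[ℝ] E', Function.Bijective (l.prod m) := by
  obtain ⟨v, hv⟩ : ∃ v, l v = 1 := by
    obtain ⟨w, hw⟩ := DFunLike.ne_iff.1 hl
    exact ⟨(l w)⁻¹ • w, by simpa using inv_mul_cancel₀ hw⟩
  have hrange : LinearMap.range l.toLinearMap = ⊤ := by
    rw [LinearMap.range_eq_top]
    exact fun t => ⟨t • v, by simp [hv]⟩
  have hker : Module.finrank ℝ (LinearMap.ker l.toLinearMap) = Module.finrank ℝ E' := by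
    have := LinearMap.finrank_range_add_finrank_ker l.toLinearMap
    rw [hrange, finrank_top, Module.finrank_self, hdim] at this
    omega
  let e := LinearEquiv.ofFinrankEq _ _ hker
  let p : E →ₗ[ℝ] LinearMap.ker l.toLinearMap :=
    LinearMap.codRestrict _ (LinearMap.id - l.toLinearMap.smulRight v) fun w => by simp [hv]
  refine ⟨LinearMap.toContinuousLinearMap (e.toLinearMap.comp p), ?_⟩
  have hinj : Function.Injective
      (l.prod (LinearMap.toContinuousLinearMap (e.toLinearMap.comp p))) := by
    rw [injective_iff_map_eq_zero]
    intro w hw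
    have h1 : l w = 0 := congrArg Prod.fst hw
    have h2 : e (p w) = 0 := congrArg Prod.snd hw
    have h3 : p w = 0 := by simpa using h2
    have h4 : w - l w • v = 0 := congrArg Subtype.val h3
    simpa [h1] using h4
  refine ⟨hinj, ?_⟩
  refine (LinearMap.injective_iff_surjective_of_finrank_eq_finrank
    (f := (l.prod (LinearMap.toContinuousLinearMap (e.toLinearMap.comp p))).toLinearMap) ?_).1 hinj
  rw [Module.finrank_prod, Module.finrank_self, hdim, add_comm]

/-- Since `l ≠ 0`, the character is a submersion at `1`; completing it by linear coordinates
complementary to `l` gives a local diffeomorphism. -/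
theorem exists_characterChart [FiniteDimensional ℝ E] [FiniteDimensional ℝ E']
    [LieGroup 𝓘(ℝ, E) ∞ G]
    (hdim : Module.finrank ℝ E = Module.finrank ℝ E' + 1) {χ : G → ℝ} (hχ1 : χ 1 = 0)
    (hχ : ContMDiff 𝓘(ℝ, E) 𝓘(ℝ, ℝ) ∞ χ) {l : E →L[ℝ] ℝ} (hl : HasDiffAt χ 1 l) (hl0 : l ≠ 0) :
    Nonempty (CharacterChart E E' χ) := by
  have : CompleteSpace E := FiniteDimensional.complete ℝ E
  have : CompleteSpace E' := FiniteDimensional.complete ℝ E'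
  obtain ⟨m, hm⟩ := exists_linear_complement hdim l hl0
  set φ := chartAt E (1 : G) with hφ
  have h1 : (1 : G) ∈ φ.source := mem_chart_source E 1
  set f : E → ℝ × E' := fun w => (χ (φ.symm w), m (w - φ 1)) with hf
  have hfs : ContDiffOn ℝ ∞ f φ.target := by
    refine ContDiffOn.prodMk (fun w hw => ?_) ?_
    · refine ContDiffAt.contDiffWithinAt (contMDiffAt_iff_contDiffAt.1 ?_)
      exact ContMDiffAt.comp w hχ.contMDiffAt (contMDiffAt_chartAt_symm (1 : G) hw)
    · exact (m.contDiff.comp (contDiff_id.sub contDiff_const)).contDiffOn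
  have hfd : HasFDerivAt f (l.prod m) (φ 1) := by
    refine HasFDerivAt.prodMk ?_ ?_
    · exact hasDiffAt_iff_hasFDerivAt.1 (hl.comp (hasDiffAt_chartAt_symm (1 : G)) (φ.left_inv h1))
    · exact m.hasFDerivAt.comp (φ 1) ((hasFDerivAt_id (φ 1)).sub_const (φ 1))
  obtain ⟨e, he1, he2, he3, he4⟩ := exists_openPartialHomeomorph_of_fderiv_bijective
    φ.open_target hfs (mem_chart_target E (1 : G)) (by rw [hfd.fderiv]; exact hm)
  have hsrc : (φ.trans e).source = φ.source ∩ φ ⁻¹' e.source := φ.trans_source e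
  have htgt : (φ.trans e).target = e.target ∩ e.symm ⁻¹' φ.target := φ.trans_target e
  refine ⟨⟨φ.trans e, ?_, ?_, ?_, ?_, ?_⟩⟩
  · rw [hsrc]; exact ⟨h1, he1⟩
  · change e (φ 1) = 0
    rw [he3]
    simp [hf, φ.left_inv h1, hχ1]
  · intro g hg
    rw [hsrc] at hg
    change (e (φ g)).1 = _
    rw [he3]
    simp [hf, φ.left_inv hg.1]
  · rw [hsrc]
    intro g hg
    refine ContMDiffAt.contMDiffWithinAt ?_
    change ContMDiffAt _ _ _ (fun g => e (φ g)) g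
    simp only [he3]
    refine ContMDiffAt.comp g (g := f) (I' := 𝓘(ℝ, E)) ?_ (contMDiffAt_chartAt 1 hg.1)
    exact (hfs.contDiffAt (φ.open_target.mem_nhds (φ.map_source hg.1))).contMDiffAt
  · rw [htgt]
    intro w hw
    refine ContMDiffAt.contMDiffWithinAt ?_
    change ContMDiffAt _ _ _ (fun w => φ.symm (e.symm w)) w
    refine ContMDiffAt.comp w (g := φ.symm) (I' := 𝓘(ℝ, E)) (contMDiffAt_chartAt_symm 1 hw.2) ?_
    exact (he4.contDiffAt (e.open_target.mem_nhds hw.1)).contMDiffAt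

theorem CharacterChart.exists_section [LieGroup 𝓘(ℝ, E) ∞ G] {χ : G → ℝ}
    (c : CharacterChart E E' χ) (hχ : ∀ x y, χ (x * y) = χ x + χ y) :
    ∃ σ : ℝ → G, ContMDiff 𝓘(ℝ, ℝ) 𝓘(ℝ, E) ∞ σ ∧ ∀ t, χ (σ t) = t := by
  have h0 : (0 : ℝ × E') ∈ c.chart.target := c.map_one ▸ c.chart.map_source c.one_mem
  have hnhds : (fun t : ℝ => (t, (0 : E'))) ⁻¹' c.chart.target ∈ 𝓝 (0 : ℝ) :=
    (c.chart.open_target.preimage (by fun_prop)).mem_nhds h0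
  obtain ⟨ε, hε, hball⟩ := Metric.mem_nhds_iff.1 hnhds
  rw [Real.ball_eq_Ioo, zero_sub, zero_add] at hball
  refine exists_section_of_local_section (E := E) hχ (s := fun t => c.chart.symm (t, 0)) hε
    (fun t ht => ?_) ?_ fun t ht => ?_
  · refine ContMDiffAt.comp t (g := c.chart.symm) (I' := 𝓘(ℝ, ℝ × E'))
      (c.smooth_symm.contMDiffAt (c.chart.open_target.mem_nhds (hball ht))) ?_
    exact (contDiff_id.prodMk contDiff_const).contMDiff.contMDiffAt
  · change c.chart.symm 0 = 1
    rw [← c.map_one, c.chart.left_inv c.one_mem]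
  · rw [← c.fst_eq _ (c.chart.map_target (hball ht)), c.chart.right_inv (hball ht)]

end CharacterChart

/-! ### The kernel of a character as a Lie group -/

namespace CharacterChart

variable {E E' : Type*} [NormedAddCommGroup E] [NormedSpace ℝ E]
  [NormedAddCommGroup E'] [NormedSpace ℝ E']
  {G : Type*} [TopologicalSpace G] [ChartedSpace E G] [Group G]
  {χ : G → ℝ}

theorem chart_symm_mem (c : CharacterChart E E' χ) (N : Subgroup G) (hN : ∀ g, g ∈ N ↔ χ g = 0)
    {u : E'} (hu : ((0 : ℝ), u) ∈ c.chart.target) :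
    c.chart.symm (0, u) ∈ N := by
  rw [hN, ← c.fst_eq _ (c.chart.map_target hu), c.chart.right_inv hu]

variable (c : CharacterChart E E' χ) (N : Subgroup G) (hN : ∀ g, g ∈ N ↔ χ g = 0)

open Classical in
/-- The chart at `1` of the kernel of a character. -/
def kerChart : OpenPartialHomeomorph N E' where
  toFun n := (c.chart n).2
  invFun u := if h : ((0 : ℝ), u) ∈ c.chart.target then
    ⟨c.chart.symm (0, u), c.chart_symm_mem N hN h⟩ else 1
  source := {n | (n : G) ∈ c.chart.source}
  target := {u | ((0 : ℝ), u) ∈ c.chart.target}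
  map_source' n hn := by
    have h1 : (c.chart n).1 = 0 := (c.fst_eq _ hn).trans ((hN n).1 n.2)
    have h2 : ((0 : ℝ), (c.chart n).2) = c.chart n := Prod.ext h1.symm rfl
    rw [mem_ofPred_eq, h2]
    exact c.chart.map_source hn
  map_target' u hu := by
    rw [mem_ofPred_eq] at hu
    rw [dif_pos hu]
    exact c.chart.map_target hu
  left_inv' n hn := by
    have h1 : (c.chart n).1 = 0 := (c.fst_eq _ hn).trans ((hN n).1 n.2)
    have h2 : ((0 : ℝ), (c.chart n).2) = c.chart n := Prod.ext h1.symm rfl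
    have h3 : ((0 : ℝ), (c.chart n).2) ∈ c.chart.target := h2 ▸ c.chart.map_source hn
    rw [dif_pos h3]
    apply Subtype.ext
    simp only [h2]
    exact c.chart.left_inv hn
  right_inv' u hu := by
    rw [mem_ofPred_eq] at hu
    rw [dif_pos hu]
    simp [c.chart.right_inv hu]
  open_source := c.chart.open_source.preimage continuous_subtype_val
  open_target := c.chart.open_target.preimage (by fun_prop)
  continuousOn_toFun := by
    refine continuous_snd.comp_continuousOn
      (c.chart.continuousOn.comp continuous_subtype_val.continuousOn fun n hn => hn)
  continuousOn_invFun := by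
    rw [Topology.IsInducing.subtypeVal.continuousOn_iff]
    have h : ContinuousOn (fun u : E' => c.chart.symm (0, u)) {u | ((0 : ℝ), u) ∈ c.chart.target} :=
      c.chart.continuousOn_symm.comp (by fun_prop) fun u hu => hu
    refine h.congr fun u hu => ?_
    rw [mem_ofPred_eq] at hu
    simp [hu]

open Classical in
theorem kerChart_symm_coe {u : E'} (hu : u ∈ (c.kerChart N hN).target) :
    ((c.kerChart N hN).symm u : G) = c.chart.symm (0, u) := by
  change ((0 : ℝ), u) ∈ c.chart.target at hu
  change (((if h : ((0 : ℝ), u) ∈ c.chart.target then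
    ⟨c.chart.symm (0, u), c.chart_symm_mem N hN h⟩ else 1 : N)) : G) = _
  rw [dif_pos hu]

/-- For `a = m⁻¹ * n` this is the transition map from the kernel chart at `n` to the one at `m`. -/
theorem contDiffAt_chart_snd [LieGroup 𝓘(ℝ, E) ∞ G] (a : G) {u : E'}
    (hu : ((0 : ℝ), u) ∈ c.chart.target)
    (ha : a * c.chart.symm (0, u) ∈ c.chart.source) :
    ContDiffAt ℝ ∞ (fun u : E' => (c.chart (a * c.chart.symm (0, u))).2) u := by
  refine contMDiffAt_iff_contDiffAt.1 ?_
  refine ContMDiffAt.comp u (g := Prod.snd) (I' := 𝓘(ℝ, ℝ × E')) contDiff_snd.contMDiff.contMDiffAt ?_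
  refine ContMDiffAt.comp u (g := c.chart) (I' := 𝓘(ℝ, E))
    (c.smooth.contMDiffAt (c.chart.open_source.mem_nhds ha)) ?_
  refine contMDiffAt_const.mul ?_
  refine ContMDiffAt.comp u (g := c.chart.symm) (I' := 𝓘(ℝ, ℝ × E'))
    (c.smooth_symm.contMDiffAt (c.chart.open_target.mem_nhds hu)) ?_
  exact (contDiff_const.prodMk contDiff_id).contMDiff.contMDiffAt

variable [IsTopologicalGroup G]

/-- The chart at `n` of the kernel of a character. -/
def kerChartAt (n : N) : OpenPartialHomeomorph N E' :=
  (Homeomorph.mulLeft n⁻¹).transOpenPartialHomeomorph (c.kerChart N hN)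

theorem mem_kerChartAt_source (n m : N) :
    m ∈ (c.kerChartAt N hN n).source ↔ (n : G)⁻¹ * m ∈ c.chart.source := Iff.rfl

theorem kerChartAt_apply (n m : N) :
    c.kerChartAt N hN n m = (c.chart ((n : G)⁻¹ * m)).2 := rfl

theorem kerChartAt_symm_coe (n : N) {u : E'} (hu : ((0 : ℝ), u) ∈ c.chart.target) :
    ((c.kerChartAt N hN n).symm u : G) = n * c.chart.symm (0, u) := by
  change ((((n⁻¹)⁻¹ : N) * (c.kerChart N hN).symm u : N) : G) = _
  rw [inv_inv, Subgroup.coe_mul, c.kerChart_symm_coe N hN hu]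

/-- The kernel of a character is a manifold. -/
@[reducible]
def kerChartedSpace : ChartedSpace E' N where
  atlas := range (c.kerChartAt N hN)
  chartAt := c.kerChartAt N hN
  mem_chart_source n := by
    rw [mem_kerChartAt_source, inv_mul_cancel]
    exact c.one_mem
  chart_mem_atlas n := mem_range_self n

theorem isManifold_ker [LieGroup 𝓘(ℝ, E) ∞ G] :
    @IsManifold ℝ _ E' _ _ E' _ 𝓘(ℝ, E') ∞ N _ (c.kerChartedSpace N hN) := by
  let _ := c.kerChartedSpace N hN
  apply isManifold_of_contDiffOn
  rintro _ _ ⟨n, rfl⟩ ⟨m, rfl⟩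
  rintro u ⟨⟨hu1, hu2⟩, -⟩
  have hu1' : ((0 : ℝ), u) ∈ c.chart.target := hu1
  have hu2' : (c.kerChartAt N hN n).symm u ∈ (c.kerChartAt N hN m).source := hu2
  rw [mem_kerChartAt_source, c.kerChartAt_symm_coe N hN n hu1', ← mul_assoc] at hu2'
  refine ContDiffAt.contDiffWithinAt ?_
  refine (c.contDiffAt_chart_snd _ hu1' hu2').congr_of_eventuallyEq ?_
  have : ∀ᶠ v in 𝓝 u, ((0 : ℝ), v) ∈ c.chart.target :=
    (c.chart.open_target.preimage (f := fun v : E' => ((0 : ℝ), v)) (by fun_prop)).mem_nhds hu1'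
  filter_upwards [this] with v hv
  change c.kerChartAt N hN m ((c.kerChartAt N hN n).symm v) = _
  rw [kerChartAt_apply, c.kerChartAt_symm_coe N hN n hv, mul_assoc]

theorem contMDiff_ker_val [LieGroup 𝓘(ℝ, E) ∞ G] :
    @ContMDiff ℝ _ E' _ _ E' _ 𝓘(ℝ, E') N _ (c.kerChartedSpace N hN) E _ _ E _ 𝓘(ℝ, E) G _ _ ∞
      (fun n : N => (n : G)) := by
  let _ := c.kerChartedSpace N hN
  have := c.isManifold_ker N hN
  intro n
  have h1 : ContMDiffAt 𝓘(ℝ, E') 𝓘(ℝ, E') ∞ (chartAt E' n) n :=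
    contMDiffAt_chartAt n (mem_chart_source E' n)
  have hev : ∀ᶠ m in 𝓝 n, m ∈ (chartAt E' n).source :=
    (chartAt E' n).open_source.mem_nhds (mem_chart_source E' n)
  have h2 : ∀ m ∈ (chartAt E' n).source,
      (m : G) = n * c.chart.symm (0, chartAt E' n m) := by
    intro m hm
    rw [← c.kerChartAt_symm_coe N hN n ((chartAt E' n).map_source hm)]
    exact congrArg Subtype.val ((chartAt E' n).left_inv hm).symm
  refine ContMDiffAt.congr_of_eventuallyEq ?_ (hev.mono h2)
  refine contMDiffAt_const.mul ?_
  refine ContMDiffAt.comp n (g := fun u : E' => c.chart.symm (0, u)) (I' := 𝓘(ℝ, E')) ?_ h1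
  refine ContMDiffAt.comp _ (g := c.chart.symm) (I' := 𝓘(ℝ, ℝ × E'))
    (c.smooth_symm.contMDiffAt (c.chart.open_target.mem_nhds
      ((chartAt E' n).map_source (mem_chart_source E' n)))) ?_
  exact (contDiff_const.prodMk contDiff_id).contMDiff.contMDiffAt

/-- The kernel charts are restrictions of smooth maps on open subsets of `G`, so smoothness into the
kernel can be tested in `G`. The group operations of the kernel and the retraction onto it are
handled this way. -/
theorem contMDiff_ker_of_val [LieGroup 𝓘(ℝ, E) ∞ G] {F H X : Type*} [NormedAddCommGroup F]
    [NormedSpace ℝ F] [TopologicalSpace H] {I : ModelWithCorners ℝ F H} [TopologicalSpace X]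
    [ChartedSpace H X] {f : X → N} (hf : ContMDiff I 𝓘(ℝ, E) ∞ (fun x => (f x : G))) :
    @ContMDiff ℝ _ F _ _ H _ I X _ _ E' _ _ E' _ 𝓘(ℝ, E') N _ (c.kerChartedSpace N hN) ∞ f := by
  let _ := c.kerChartedSpace N hN
  have := c.isManifold_ker N hN
  intro x
  rw [contMDiffAt_iff_target]
  refine ⟨(hf.continuous.subtype_mk _).continuousAt, ?_⟩
  change ContMDiffAt I 𝓘(ℝ, E') ∞ (fun y => (c.chart ((f x : G)⁻¹ * f y)).2) x
  refine ContMDiffAt.comp x (g := Prod.snd) (I' := 𝓘(ℝ, ℝ × E')) contDiff_snd.contMDiff.contMDiffAt ?_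
  refine ContMDiffAt.comp x (g := c.chart) (I' := 𝓘(ℝ, E))
    (c.smooth.contMDiffAt (c.chart.open_source.mem_nhds ?_)) (contMDiffAt_const.mul hf.contMDiffAt)
  rw [inv_mul_cancel]
  exact c.one_mem

theorem lieGroup_ker [LieGroup 𝓘(ℝ, E) ∞ G] :
    @LieGroup ℝ _ E' _ E' _ _ 𝓘(ℝ, E') ∞ N _ _ (c.kerChartedSpace N hN) := by
  let _ := c.kerChartedSpace N hN
  have := c.isManifold_ker N hN
  have hv := c.contMDiff_ker_val N hN
  exact
    { contMDiff_mul := c.contMDiff_ker_of_val N hN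
        ((hv.comp contMDiff_fst).mul (hv.comp contMDiff_snd))
      contMDiff_inv := c.contMDiff_ker_of_val N hN hv.inv }

end CharacterChart

/-! ### Global coordinates on simply connected solvable groups -/

/-- A retract of a simply connected space is simply connected. -/
theorem simplyConnectedSpace_of_retract {X Y : Type*} [TopologicalSpace X] [TopologicalSpace Y]
    [SimplyConnectedSpace X] (i : C(Y, X)) (r : C(X, Y)) (h : ∀ y, r (i y) = y) :
    SimplyConnectedSpace Y := by
  rw [simply_connected_iff_paths_homotopic']
  have hsurj : Function.Surjective r := fun y => ⟨i y, h y⟩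
  refine ⟨hsurj.pathConnectedSpace r.continuous, fun {x y} p q => ?_⟩
  have h1 : ContinuousMap.HomotopicRel (p.map i.continuous).toContinuousMap
      (q.map i.continuous).toContinuousMap {0, 1} :=
    SimplyConnectedSpace.paths_homotopic (p.map i.continuous) (q.map i.continuous)
  have h2 := ContinuousMap.HomotopicRel.comp_continuousMap h1 r
  have h3 : ∀ p : Path x y, r.comp (p.map i.continuous).toContinuousMap = p.toContinuousMap := by
    intro p; ext t; exact h (p t)
  rw [h3, h3] at h2
  exact h2

theorem subsingleton_of_chartedSpace_of_subsingleton (E G : Type*) [TopologicalSpace E]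
    [Subsingleton E] [TopologicalSpace G] [ChartedSpace E G] [PreconnectedSpace G] :
    Subsingleton G := by
  have hs : ∀ x : G, IsOpen ({x} : Set G) := by
    intro x
    have : (chartAt E x).source = {x} := by
      refine subset_antisymm (fun y hy => ?_) (singleton_subset_iff.2 (mem_chart_source E x))
      exact (chartAt E x).injOn hy (mem_chart_source E x) (Subsingleton.elim _ _)
    rw [← this]
    exact (chartAt E x).open_source
  have : DiscreteTopology G := discreteTopology_iff_isOpen_singleton.2 hs
  exact PreconnectedSpace.trivial_of_discrete

theorem nontrivial_of_chartedSpace (E G : Type*) [NormedAddCommGroup E] [NormedSpace ℝ E]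
    [Nontrivial E] [TopologicalSpace G] [ChartedSpace E G] [Nonempty G] : Nontrivial G := by
  by_contra hG
  rw [not_nontrivial_iff_subsingleton] at hG
  obtain ⟨x⟩ := ‹Nonempty G›
  have hsub : (chartAt E x).target = {chartAt E x x} := by
    refine subset_antisymm (fun y hy => ?_) (singleton_subset_iff.2 (mem_chart_target E x))
    rw [mem_singleton_iff, ← (chartAt E x).right_inv hy,
      Subsingleton.elim ((chartAt E x).symm y) x]
  have : (𝓝[≠] (chartAt E x x)).NeBot := Module.punctured_nhds_neBot ℝ E _
  exact not_isOpen_singleton (chartAt E x x) (hsub ▸ (chartAt E x).open_target)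

universe u

/-- A simply connected solvable Lie group has global coordinates, compatible with left translation
by the subgroups on which the first coordinates vanish. -/
theorem exists_solvable_coordinates (q : ℕ) : ∀ (G : Type u) [TopologicalSpace G]
    [ChartedSpace (EuclideanSpace ℝ (Fin q)) G] [Group G] [LieGroup (𝓡 q) ∞ G]
    [SimplyConnectedSpace G] [Group.IsSolvable G],
    ∃ T : G ≃ₘ^∞⟮𝓡 q, 𝓡 q⟯ EuclideanSpace ℝ (Fin q),
      ∀ (j : Fin q) (h : G), (∀ k < j, T h k = 0) → ∀ g, T (h * g) j = T h j + T g j := by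
  induction q with
  | zero =>
    intro G _ _ _ _ _ _
    have : Subsingleton G :=
      subsingleton_of_chartedSpace_of_subsingleton (EuclideanSpace ℝ (Fin 0)) G
    exact ⟨{ toFun := fun _ => 0
             invFun := fun _ => 1
             left_inv := fun g => Subsingleton.elim _ _
             right_inv := fun g => Subsingleton.elim _ _
             contMDiff_toFun := contMDiff_const
             contMDiff_invFun := contMDiff_const }, fun j => j.elim0⟩
  | succ q ih =>
    intro G _ _ _ _ _ _
    have : IsTopologicalGroup G := topologicalGroup_of_lieGroup (𝓡 (q + 1)) ∞
    have : Nontrivial G := nontrivial_of_chartedSpace (EuclideanSpace ℝ (Fin (q + 1))) G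
    obtain ⟨χ, l, hχ, hχs, hχd, hl⟩ :=
      exists_character (E := EuclideanSpace ℝ (Fin (q + 1))) (G := G)
    have hχ1 : χ 1 = 0 := by simpa using hχ 1 1
    have hχinv : ∀ x, χ x⁻¹ = -χ x := fun x => by
      have := hχ x x⁻¹
      rw [mul_inv_cancel, hχ1] at this
      linarith
    obtain ⟨c⟩ := exists_characterChart (E' := EuclideanSpace ℝ (Fin q)) (by simp) hχ1 hχs hχd hl
    obtain ⟨σ, hσ, hσχ⟩ := c.exists_section hχ
    let N : Subgroup G :=
      { carrier := {g | χ g = 0}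
        one_mem' := hχ1
        mul_mem' := fun {a b} ha hb => by
          change χ (a * b) = 0
          rw [hχ, show χ a = 0 from ha, show χ b = 0 from hb, add_zero]
        inv_mem' := fun {a} ha => by
          change χ a⁻¹ = 0
          rw [hχinv, show χ a = 0 from ha, neg_zero] }
    have hN : ∀ g, g ∈ N ↔ χ g = 0 := fun g => Iff.rfl
    let _ := c.kerChartedSpace N hN
    have : LieGroup (𝓡 q) ∞ N := c.lieGroup_ker N hN
    have hσ1 : ∀ n : N, χ n = 0 := fun n => n.2
    -- the retraction onto the kernel
    let r : G → N := fun g => ⟨g * (σ (χ g))⁻¹ * σ 0, by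
      rw [hN, hχ, hχ, hχinv, hσχ, hσχ]; ring⟩
    have hrs : ContMDiff (𝓡 (q + 1)) (𝓡 q) ∞ r :=
      c.contMDiff_ker_of_val N hN ((contMDiff_id.mul (hσ.comp hχs).inv).mul contMDiff_const)
    have hvs : ContMDiff (𝓡 q) (𝓡 (q + 1)) ∞ (fun n : N => (n : G)) := c.contMDiff_ker_val N hN
    -- The section need not satisfy `σ 0 = 1`; the factor `σ 0` in `r` compensates for this.
    have hrN : ∀ n : N, r n = n := fun n => Subtype.ext (by simp [r, hσ1 n])
    have : SimplyConnectedSpace N := simplyConnectedSpace_of_retract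
      ⟨fun n : N => (n : G), hvs.continuous⟩ ⟨r, hrs.continuous⟩ hrN
    obtain ⟨T, hT⟩ := ih N
    -- Left translation by the kernel preserves `χ`, so `r` is equivariant; this transfers the
    -- additivity of the coordinates from `N` to `G`.
    have hrmul : ∀ (h : N) (g : G), r (h * g) = h * r g := by
      intro h g
      apply Subtype.ext
      simp only [r, hχ, hσ1 h, zero_add, Subgroup.coe_mul, mul_assoc]
    let toF : G → EuclideanSpace ℝ (Fin (q + 1)) := fun g =>
      WithLp.toLp 2 (Fin.cons (χ g) (T (r g)))
    -- Solving the definition of `r` for `g` gives `g = r g * (σ 0)⁻¹ * σ (χ g)`.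
    let invF : EuclideanSpace ℝ (Fin (q + 1)) → G := fun v =>
      (T.symm (WithLp.toLp 2 (Fin.tail v)) : G) * ((σ 0)⁻¹ * σ (v 0))
    have hcons : ContDiff ℝ ∞ (fun p : ℝ × EuclideanSpace ℝ (Fin q) =>
        (WithLp.toLp 2 (Fin.cons p.1 p.2) : EuclideanSpace ℝ (Fin (q + 1)))) := by
      rw [contDiff_euclidean]
      intro i
      refine Fin.cases ?_ (fun i => ?_) i
      · exact contDiff_fst
      · exact (contDiff_euclidean.1 (contDiff_snd (𝕜 := ℝ) (E := ℝ)
          (F := EuclideanSpace ℝ (Fin q)))) i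
    have htail : ContDiff ℝ ∞ (fun v : EuclideanSpace ℝ (Fin (q + 1)) =>
        (WithLp.toLp 2 (Fin.tail v) : EuclideanSpace ℝ (Fin q))) := by
      rw [contDiff_euclidean]
      intro i
      exact (contDiff_euclidean.1 (contDiff_id (𝕜 := ℝ)
        (E := EuclideanSpace ℝ (Fin (q + 1))))) i.succ
    have hzero : ContDiff ℝ ∞ (fun v : EuclideanSpace ℝ (Fin (q + 1)) => v 0) :=
      (contDiff_euclidean.1 (contDiff_id (𝕜 := ℝ) (E := EuclideanSpace ℝ (Fin (q + 1))))) 0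
    refine ⟨{ toFun := toF
              invFun := invF
              left_inv := fun g => ?_
              right_inv := fun v => ?_
              contMDiff_toFun := ?_
              contMDiff_invFun := ?_ }, ?_⟩
    · simp [toF, invF, r]
    · have e1 : χ (invF v) = v 0 := by
        simp [invF, hχ, hχinv, hσχ, hσ1]
      have e2 : r (invF v) = T.symm (WithLp.toLp 2 (Fin.tail v)) := by
        simp only [invF]
        rw [hrmul]
        have e3 : r ((σ 0)⁻¹ * σ (v 0)) = 1 :=
          Subtype.ext (by simp [r, hχ, hχinv, hσχ, mul_assoc])
        rw [e3, mul_one]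
      simp only [toF, e1, e2]
      simp
    · exact hcons.contMDiff.comp (hχs.prodMk_space (T.contMDiff.comp hrs))
    · exact (hvs.comp (T.symm.contMDiff.comp htail.contMDiff)).mul
        (contMDiff_const.mul (hσ.comp hzero.contMDiff))
    · intro j
      refine Fin.cases ?_ (fun j => ?_) j
      · intro h _ g
        exact hχ h g
      · intro h hh g
        have h0 : χ h = 0 := hh 0 (Fin.succ_pos j)
        have h1 : r (h * g) = ⟨h, h0⟩ * r g := hrmul ⟨h, h0⟩ g
        have h2 : r h = ⟨h, h0⟩ := hrN ⟨h, h0⟩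
        have h3 := hT j ⟨h, h0⟩ (fun k hk => by
          have := hh k.succ (Fin.succ_lt_succ_iff.2 hk)
          rw [← h2]
          exact this) (r g)
        change T (r (h * g)) j = T (r h) j + T (r g) j
        rw [h1, h2, h3]

/-! ### Leaves and plaques -/

namespace Foliation

variable {E F Q M : Type*}
  [NormedAddCommGroup E] [NormedSpace ℝ E] [NormedAddCommGroup F] [NormedSpace ℝ F]
  [NormedAddCommGroup Q] [NormedSpace ℝ Q] [TopologicalSpace M] [ChartedSpace E M]
  (𝓕 : Foliation E F Q M)

theorem mem_leafSet_self (x : M) : x ∈ 𝓕.leafSet x :=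
  mem_connectedComponent (α := 𝓕.LeafSpace) (x := x)

theorem leafSet_eq_of_mem {x y : M} (h : y ∈ 𝓕.leafSet x) : 𝓕.leafSet y = 𝓕.leafSet x :=
  (connectedComponent_eq (α := 𝓕.LeafSpace) h).symm

theorem leafSet_eq_of_mem_leaves {L : Set M} (hL : L ∈ 𝓕.leaves) {x : M} (hx : x ∈ L) :
    𝓕.leafSet x = L := by
  obtain ⟨y, rfl⟩ := hL
  exact 𝓕.leafSet_eq_of_mem hx

/-- The inclusion of a plaque, as a map into the leaf space. -/
def plaqueMap (e : OpenPartialHomeomorph M (F × Q)) (c : Q) (u : F) : 𝓕.LeafSpace :=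
  (e.symm (u, c) : M)

theorem contMDiffOn_plaqueMap {e : OpenPartialHomeomorph M (F × Q)} (he : e ∈ 𝓕.charts) (c : Q) :
    ContMDiffOn 𝓘(ℝ, F) 𝓘(ℝ, F) ∞ (𝓕.plaqueMap e c) {u | (u, c) ∈ e.target} :=
  contMDiffOn_symm_of_mem_maximalAtlas
    (IsManifold.subset_maximalAtlas (I := 𝓘(ℝ, F)) (n := ∞) (M := 𝓕.LeafSpace)
      ⟨e, he, c, rfl⟩)

theorem mem_leafSet_of_isPreconnected {e : OpenPartialHomeomorph M (F × Q)} (he : e ∈ 𝓕.charts)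
    {c : Q} {B : Set F} (hB : IsPreconnected B) (hBt : ∀ u ∈ B, (u, c) ∈ e.target) {u v : F}
    (hu : u ∈ B) (hv : v ∈ B) : e.symm (u, c) ∈ 𝓕.leafSet (e.symm (v, c)) := by
  have h := hB.image (𝓕.plaqueMap e c) ((𝓕.contMDiffOn_plaqueMap he c).continuousOn.mono hBt)
  exact h.subset_connectedComponent (mem_image_of_mem _ hv) (mem_image_of_mem _ hu)

/-- The plaque of a foliated chart, as a subset of the leaf space. -/
def plaque (e : OpenPartialHomeomorph M (F × Q)) (c : Q) : Set 𝓕.LeafSpace :=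
  {w : M | w ∈ e.source ∧ (e w).2 = c}

theorem isOpen_plaque {e : OpenPartialHomeomorph M (F × Q)} (he : e ∈ 𝓕.charts) (c : Q) :
    IsOpen (𝓕.plaque e c) :=
  (𝓕.plaqueChart e he c).open_source

/-- The plaques of `e'` cut disjoint open sets out of one plaque of `e`, whose coordinates lie in
the second countable space `F`. -/
theorem countable_plaque_inter [SecondCountableTopology F] {e e' : OpenPartialHomeomorph M (F × Q)}
    (he : e ∈ 𝓕.charts) (he' : e' ∈ 𝓕.charts) (c : Q) :
    {c' : Q | (𝓕.plaque e c ∩ 𝓕.plaque e' c').Nonempty}.Countable := by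
  refine Set.PairwiseDisjoint.countable_of_isOpen (s := fun c' : Q =>
    {u : F | (u, c) ∈ e.target ∧ (e.symm (u, c) : 𝓕.LeafSpace) ∈ 𝓕.plaque e' c'}) ?_ ?_ ?_
  · intro c₁ _ c₂ _ hne
    refine Set.disjoint_left.2 ?_
    rintro u ⟨-, -, h1⟩ ⟨-, -, h2⟩
    exact hne (h1.symm.trans h2)
  · intro c' _
    exact (𝓕.isOpen_leafSpace_iff _).1 (𝓕.isOpen_plaque he' c') e he c
  · rintro c' ⟨w, ⟨hw1, hw2⟩, hw3⟩
    have h1 : ((e w).1, c) = e w := Prod.ext rfl hw2.symm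
    refine ⟨(e w).1, ?_, ?_⟩
    · rw [h1]; exact e.map_source hw1
    · have : e.symm ((e w).1, c) = w := by rw [h1, e.left_inv hw1]
      rw [this]; exact hw3

/-- A leaf of a foliation of a second countable manifold meets every foliated chart in countably
many plaques. -/
theorem countable_leafSet_plaques [SecondCountableTopology F] [SecondCountableTopology M] (x : M)
    {e : OpenPartialHomeomorph M (F × Q)} (he : e ∈ 𝓕.charts) :
    {c : Q | ∃ y ∈ 𝓕.leafSet x, y ∈ e.source ∧ (e y).2 = c}.Countable := by
  obtain ⟨s, hsc, hs⟩ := TopologicalSpace.countable_cover_nhds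
    (fun y : M => (𝓕.chartNear y).open_source.mem_nhds (𝓕.mem_chartNear_source y))
  have hcov : ∀ y : M, ∃ i ∈ s, y ∈ (𝓕.chartNear i).source := fun y => by
    simpa using hs.symm.subset (mem_univ y)
  let P : M × Q → Set 𝓕.LeafSpace := fun a => 𝓕.plaque (𝓕.chartNear a.1) a.2
  have hP : ∀ a, IsOpen (P a) := fun a => 𝓕.isOpen_plaque (𝓕.chartNear_mem a.1) a.2
  obtain ⟨i₀, hi₀, hxi₀⟩ := hcov x
  let next : Set (M × Q) → Set (M × Q) := fun S => {b | b.1 ∈ s ∧ ∃ a ∈ S, (P a ∩ P b).Nonempty}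
  -- Plaques joined to that of `x` by a chain of `n` successive intersections in a countable family
  -- of charts. Their union over all `n` is clopen in the leaf topology, so it contains the leaf.
  let S : ℕ → Set (M × Q) := fun n => next^[n] {(i₀, (𝓕.chartNear i₀ x).2)}
  have hS : ∀ n, (S n).Countable := by
    intro n
    induction n with
    | zero => exact countable_singleton _
    | succ n ih =>
      have : S (n + 1) ⊆ ⋃ a ∈ S n, ⋃ i ∈ s, (fun c => (i, c)) ''
          {c | (P a ∩ 𝓕.plaque (𝓕.chartNear i) c).Nonempty} := by
        intro b hb
        have hb' : b ∈ next (S n) := by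
          have : S (n + 1) = next (S n) := Function.iterate_succ_apply' next n _
          rwa [← this]
        obtain ⟨hbs, a, ha, hab⟩ := hb'
        simp only [mem_iUnion]
        exact ⟨a, ha, b.1, hbs, b.2, hab, rfl⟩
      refine Countable.mono this (ih.biUnion fun a _ => hsc.biUnion fun i _ => ?_)
      exact (𝓕.countable_plaque_inter (𝓕.chartNear_mem a.1) (𝓕.chartNear_mem i) a.2).image _
  let U : Set 𝓕.LeafSpace := ⋃ n, ⋃ a ∈ S n, P a
  have hUmem : ∀ y : 𝓕.LeafSpace, y ∈ U → ∃ n, ∃ a ∈ S n, y ∈ P a := by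
    intro y hy
    obtain ⟨n, hn⟩ := mem_iUnion.1 hy
    obtain ⟨a, ha, hya⟩ := mem_iUnion₂.1 hn
    exact ⟨n, a, ha, hya⟩
  have hUo : IsOpen U := isOpen_iUnion fun n => isOpen_biUnion fun a _ => hP a
  have hUc : IsClosed U := by
    rw [← isOpen_compl_iff, isOpen_iff_forall_mem_open]
    intro y hy
    obtain ⟨i, hi, hyi⟩ := hcov y
    refine ⟨P (i, (𝓕.chartNear i y).2), ?_, hP _, hyi, rfl⟩
    intro z hz hzU
    apply hy
    obtain ⟨n, a, ha, hza⟩ := hUmem z hzU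
    refine mem_iUnion.2 ⟨n + 1, mem_iUnion₂.2 ⟨(i, (𝓕.chartNear i y).2), ?_, hyi, rfl⟩⟩
    have : S (n + 1) = next (S n) := Function.iterate_succ_apply' next n _
    rw [this]
    exact ⟨hi, a, ha, z, hza, hz⟩
  have hxU : x ∈ U := mem_iUnion.2 ⟨0, mem_iUnion₂.2 ⟨_, rfl, hxi₀, rfl⟩⟩
  have hsub : 𝓕.leafSet x ⊆ U := IsClopen.connectedComponent_subset ⟨hUc, hUo⟩ hxU
  have hfin : {c : Q | ∃ y ∈ 𝓕.leafSet x, y ∈ e.source ∧ (e y).2 = c} ⊆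
      ⋃ n, ⋃ a ∈ S n, {c | (P a ∩ 𝓕.plaque e c).Nonempty} := by
    rintro c ⟨y, hy, hye, hyc⟩
    obtain ⟨n, a, ha, hya⟩ := hUmem y (hsub hy)
    exact mem_iUnion.2 ⟨n, mem_iUnion₂.2 ⟨a, ha, y, hya, hye, hyc⟩⟩
  refine Countable.mono hfin (countable_iUnion fun n => (hS n).biUnion fun a _ => ?_)
  exact 𝓕.countable_plaque_inter (𝓕.chartNear_mem a.1) he a.2

/-- A continuous map with values in a leaf stays locally in a plaque. -/
theorem eventually_snd_eq_of_mem_leafSet [SecondCountableTopology F] [SecondCountableTopology M]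
    {Z : Type*} [TopologicalSpace Z] [LocallyConnectedSpace Z] {f : Z → M} {W : Set Z}
    (hW : IsOpen W) (hf : ContinuousOn f W) {x : M} (hfx : ∀ z ∈ W, f z ∈ 𝓕.leafSet x) {z₀ : Z}
    (hz₀ : z₀ ∈ W) {e : OpenPartialHomeomorph M (F × Q)} (he : e ∈ 𝓕.charts)
    (hze : f z₀ ∈ e.source) :
    ∀ᶠ z in 𝓝 z₀, f z ∈ e.source ∧ (e (f z)).2 = (e (f z₀)).2 := by
  have hW' : W ∩ f ⁻¹' e.source ∈ 𝓝 z₀ :=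
    (hf.isOpen_inter_preimage hW e.open_source).mem_nhds ⟨hz₀, hze⟩
  obtain ⟨C, ⟨hCo, hzC, hC⟩, hCW⟩ := (LocallyConnectedSpace.open_connected_basis z₀).mem_iff.1 hW'
  have hcont : ContinuousOn (fun z => (e (f z)).2) C :=
    continuous_snd.comp_continuousOn
      (e.continuousOn.comp (hf.mono fun z hz => (hCW hz).1) fun z hz => (hCW hz).2)
  -- A connected set of transverse coordinates inside a countable set is at most a point.
  have himg : ((fun z => (e (f z)).2) '' C).Subsingleton := by
    refine (𝓕.countable_leafSet_plaques x he).isTotallyDisconnected _ ?_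
      (hC.isPreconnected.image _ hcont)
    rintro _ ⟨z, hz, rfl⟩
    exact ⟨f z, hfx z (hCW hz).1, (hCW hz).2, rfl⟩
  filter_upwards [hCo.mem_nhds hzC] with z hz
  exact ⟨(hCW hz).2, himg (mem_image_of_mem _ hz) (mem_image_of_mem _ hzC)⟩

end Foliation

/-! ### Flow boxes of a transverse action -/

namespace Foliation.IsInvariantUnderTransverseAction

variable {E F Q M EG G : Type*}
  [NormedAddCommGroup E] [NormedSpace ℝ E] [NormedAddCommGroup F] [NormedSpace ℝ F]
  [NormedAddCommGroup Q] [NormedSpace ℝ Q] [TopologicalSpace M] [ChartedSpace E M]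
  [NormedAddCommGroup EG] [NormedSpace ℝ EG] [TopologicalSpace G] [ChartedSpace EG G] [Group G]
  [MulAction G M] {𝓕 : Foliation E F Q M}

theorem contMDiffSMul (h : 𝓕.IsInvariantUnderTransverseAction EG G) :
    ContMDiffSMul 𝓘(ℝ, EG) 𝓘(ℝ, E) ∞ G M :=
  ⟨h.contMDiff_action⟩

theorem leafSet_smul (h : 𝓕.IsInvariantUnderTransverseAction EG G) (g : G) (x : M) :
    (fun y : M => g • y) '' 𝓕.leafSet x = 𝓕.leafSet (g • x) :=
  (𝓕.leafSet_eq_of_mem_leaves (h.invariant g _ ⟨x, rfl⟩)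
    (mem_image_of_mem _ (𝓕.mem_leafSet_self x))).symm

theorem smul_mem_leafSet (h : 𝓕.IsInvariantUnderTransverseAction EG G) (g : G) {x y : M}
    (hy : y ∈ 𝓕.leafSet x) : g • y ∈ 𝓕.leafSet (g • x) :=
  h.leafSet_smul g x ▸ mem_image_of_mem _ hy

/-- The transverse coordinate of the orbit map is a local diffeomorphism. -/
theorem bijective_transverse [FiniteDimensional ℝ EG] [FiniteDimensional ℝ Q]
    (h : 𝓕.IsInvariantUnderTransverseAction EG G)
    {e : OpenPartialHomeomorph M (F × Q)} (he : e ∈ 𝓕.charts) {x : M} (hx : x ∈ e.source)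
    {A : EG →L[ℝ] Q} (hA : HasDiffAt (fun g : G => (e (g • x)).2) 1 A) :
    Function.Bijective A := by
  have hes : ContMDiffAt 𝓘(ℝ, E) 𝓘(ℝ, F × Q) ∞ e x :=
    (𝓕.smooth e he).contMDiffAt (e.open_source.mem_nhds hx)
  have hesym : ContMDiffAt 𝓘(ℝ, F × Q) 𝓘(ℝ, E) ∞ e.symm (e x) :=
    (𝓕.smooth_symm e he).contMDiffAt (e.open_target.mem_nhds (e.map_source hx))
  have he2 : ContMDiffAt 𝓘(ℝ, E) 𝓘(ℝ, Q) ∞ (fun y => (e y).2) x :=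
    ContMDiffAt.comp x (g := Prod.snd) (I' := 𝓘(ℝ, F × Q)) contDiff_snd.contMDiff.contMDiffAt hes
  have : ContMDiffSMul 𝓘(ℝ, EG) 𝓘(ℝ, E) ∞ G M := h.contMDiffSMul
  have horb : ContMDiffAt 𝓘(ℝ, EG) 𝓘(ℝ, E) ∞ (fun g : G => g • x) 1 :=
    ContMDiffAt.smul contMDiffAt_id contMDiffAt_const
  have hcomp := he2.hasDiffAt.comp horb.hasDiffAt (one_smul G x)
  have hAeq : A = (diffAt E Q (fun y => (e y).2) x).comp (diffAt EG E (fun g : G => g • x) 1) :=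
    hA.unique hcomp
  have hsurj2 : Function.Surjective (diffAt E Q (fun y => (e y).2) x) := by
    have h1 := he2.hasDiffAt.comp hesym.hasDiffAt (e.left_inv hx)
    have h2 : HasDiffAt (fun p : F × Q => p.2) (e x) (ContinuousLinearMap.snd ℝ F Q) :=
      hasDiffAt_iff_hasFDerivAt.2 hasFDerivAt_snd
    have h3 := h1.unique (h2.congr (by
      filter_upwards [e.open_target.mem_nhds (e.map_source hx)] with p hp
      rw [e.right_inv hp]))
    intro w
    exact ⟨_, DFunLike.congr_fun h3 (0, w)⟩
  -- The leaf component of a vector is killed by the transverse coordinate, so by transversality its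
  -- orbit component has the same image. Injectivity then follows by equality of dimensions.
  have hsurj : Function.Surjective A := by
    intro w
    obtain ⟨v, hv⟩ := hsurj2 w
    have hv' : (show TangentSpace 𝓘(ℝ, E) x from v) ∈ orbitTangent EG E G x ⊔ 𝓕.tangent x := by
      rw [h.transverse x]; trivial
    obtain ⟨o, ⟨X, hX⟩, t, ht, hot⟩ := Submodule.mem_sup.1 hv'
    have ht' := (Submodule.mem_iInf _).1 ht ⟨e, he, hx⟩
    have ht'' : diffAt E Q (fun y => (e y).2) x t = 0 := ht'
    refine ⟨X, ?_⟩
    have hX' : diffAt EG E (fun g : G => g • x) 1 X = o := hX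
    have hot' : diffAt E Q (fun y => (e y).2) x v =
        diffAt E Q (fun y => (e y).2) x o + diffAt E Q (fun y => (e y).2) x t :=
      (congrArg (diffAt E Q (fun y => (e y).2) x) hot.symm).trans
        ((diffAt E Q (fun y => (e y).2) x).map_add o t)
    rw [hAeq, ContinuousLinearMap.comp_apply, hX', ← hv, hot', ht'', add_zero]
  exact ⟨(LinearMap.injective_iff_surjective_of_finrank_eq_finrank
    (f := A.toLinearMap) h.finrank_group).2 hsurj, hsurj⟩

/-- The product structure of a foliated manifold near a point, in coordinates. -/
theorem exists_flowBox_coord [FiniteDimensional ℝ EG] [FiniteDimensional ℝ Q]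
    [FiniteDimensional ℝ F] [LieGroup 𝓘(ℝ, EG) ∞ G]
    (h : 𝓕.IsInvariantUnderTransverseAction EG G)
    {e : OpenPartialHomeomorph M (F × Q)} (he : e ∈ 𝓕.charts) {x : M} (hx : x ∈ e.source) :
    ∃ B : OpenPartialHomeomorph (EG × F) (F × Q),
      (chartAt EG (1 : G) 1, (e x).1) ∈ B.source ∧
      (∀ p ∈ B.source, p.1 ∈ (chartAt EG (1 : G)).target ∧ (p.2, (e x).2) ∈ e.target ∧
        (chartAt EG (1 : G)).symm p.1 • e.symm (p.2, (e x).2) ∈ e.source ∧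
        B p = e ((chartAt EG (1 : G)).symm p.1 • e.symm (p.2, (e x).2))) ∧
      ContDiffOn ℝ ∞ B.symm B.target := by
  have : ContMDiffSMul 𝓘(ℝ, EG) 𝓘(ℝ, E) ∞ G M := h.contMDiffSMul
  have : CompleteSpace EG := FiniteDimensional.complete ℝ EG
  have : CompleteSpace F := FiniteDimensional.complete ℝ F
  have : CompleteSpace Q := FiniteDimensional.complete ℝ Q
  set φ := chartAt EG (1 : G) with hφ
  have h1 : (1 : G) ∈ φ.source := mem_chart_source EG 1
  set c := (e x).2 with hc
  set θ : EG × F → M := fun p => φ.symm p.1 • e.symm (p.2, c) with hθ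
  set U₀ : Set (EG × F) := {p | p.1 ∈ φ.target ∧ (p.2, c) ∈ e.target} with hU₀
  have hU₀o : IsOpen U₀ := (φ.open_target.preimage continuous_fst).inter
    (e.open_target.preimage (f := fun p : EG × F => (p.2, c)) (by fun_prop))
  have hθs : ∀ p ∈ U₀, ContMDiffAt 𝓘(ℝ, EG × F) 𝓘(ℝ, E) ∞ θ p := by
    intro p hp
    refine ContMDiffAt.smul (I := 𝓘(ℝ, EG)) ?_ ?_
    · exact ContMDiffAt.comp p (g := φ.symm) (I' := 𝓘(ℝ, EG)) (contMDiffAt_chartAt_symm (1 : G) hp.1)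
        contDiff_fst.contMDiff.contMDiffAt
    · exact ContMDiffAt.comp p (g := e.symm) (I' := 𝓘(ℝ, F × Q))
        ((𝓕.smooth_symm e he).contMDiffAt (e.open_target.mem_nhds hp.2))
        (contDiff_snd.prodMk contDiff_const).contMDiff.contMDiffAt
  set U : Set (EG × F) := U₀ ∩ θ ⁻¹' e.source with hU
  have hUo : IsOpen U := ContinuousOn.isOpen_inter_preimage
    (fun p hp => (hθs p hp).continuousAt.continuousWithinAt) hU₀o e.open_source
  have hes : ∀ p ∈ U, ContDiffAt ℝ ∞ (fun p => e (θ p)) p := by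
    intro p hp
    refine contMDiffAt_iff_contDiffAt.1 (ContMDiffAt.comp p (g := e) (I' := 𝓘(ℝ, E)) ?_ (hθs p hp.1))
    exact (𝓕.smooth e he).contMDiffAt (e.open_source.mem_nhds hp.2)
  have hex : ((e x).1, c) = e x := rfl
  have hp₀ : (φ 1, (e x).1) ∈ U := by
    refine ⟨⟨φ.map_source h1, ?_⟩, ?_⟩
    · simp only [hex]; exact e.map_source hx
    · simp only [mem_preimage, hθ, hex, e.left_inv hx, φ.left_inv h1, one_smul]
      exact hx
  set D := fderiv ℝ (fun p => e (θ p)) (φ 1, (e x).1) with hD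
  have hDd : HasFDerivAt (fun p => e (θ p)) D (φ 1, (e x).1) :=
    ((hes _ hp₀).differentiableAt (by simp)).hasFDerivAt
  have hDr : D.comp (ContinuousLinearMap.inr ℝ EG F) = ContinuousLinearMap.inl ℝ F Q := by
    have e1 : HasFDerivAt (fun u : F => e (θ (φ 1, u))) (D.comp (ContinuousLinearMap.inr ℝ EG F))
        (e x).1 := hDd.comp (e x).1 (hasFDerivAt_prodMk_right _ _)
    have e2 : HasFDerivAt (fun u : F => (u, c)) (ContinuousLinearMap.inl ℝ F Q) (e x).1 :=
      hasFDerivAt_prodMk_left _ _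
    refine e1.unique (e2.congr_of_eventuallyEq ?_)
    have : ∀ᶠ u in 𝓝 (e x).1, (u, c) ∈ e.target :=
      (e.open_target.preimage (f := fun u : F => (u, c)) (by fun_prop)).mem_nhds
        (e.map_source hx)
    filter_upwards [this] with u hu
    simp only [hθ, φ.left_inv h1, one_smul, e.right_inv hu]
  have hA : HasDiffAt (fun g : G => (e (g • x)).2) 1
      ((ContinuousLinearMap.snd ℝ F Q).comp (D.comp (ContinuousLinearMap.inl ℝ EG F))) := by
    have e1 : HasFDerivAt (fun w : EG => e (θ (w, (e x).1)))
        (D.comp (ContinuousLinearMap.inl ℝ EG F)) (φ 1) :=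
      HasFDerivAt.comp (g := fun p => e (θ p)) (f := fun w : EG => (w, (e x).1)) (φ 1) hDd
        (hasFDerivAt_prodMk_left _ _)
    have e2 := (hasDiffAt_iff_hasFDerivAt.2 (hasFDerivAt_snd.comp (φ 1) e1)).comp
      (hasDiffAt_chartAt (1 : G)) rfl
    refine HasDiffAt.congr e2 ?_
    filter_upwards [φ.open_source.mem_nhds h1] with g hg
    simp only [hθ, hex, e.left_inv hx, Function.comp, ← hφ, φ.left_inv hg]
  have hAb := h.bijective_transverse he hx hA
  have hDdec : ∀ p : EG × F, D p = D (p.1, 0) + (p.2, 0) := by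
    intro p
    have e1 : D (0, p.2) = (p.2, 0) := DFunLike.congr_fun hDr p.2
    rw [← e1, ← map_add]
    simp
  have hD0 : D (0, 0) = 0 := map_zero D
  -- `D` is block triangular: the identity on the leaf directions `F`, and the bijection of
  -- `bijective_transverse` from `EG` to `Q`.
  have hDb : Function.Bijective D := by
    constructor
    · rw [injective_iff_map_eq_zero]
      intro p hp
      rw [hDdec] at hp
      have e1 : (D (p.1, 0)).2 = 0 := by simpa using congrArg Prod.snd hp
      have e2 : p.1 = 0 := hAb.1 (by simpa [hD0] using e1)
      have e3 : p.2 = 0 := by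
        have := congrArg Prod.fst hp
        rw [e2, hD0] at this
        simpa using this
      exact Prod.ext e2 e3
    · intro w
      obtain ⟨X, hX⟩ := hAb.2 w.2
      refine ⟨(X, w.1 - (D (X, 0)).1), ?_⟩
      rw [hDdec]
      refine Prod.ext (by simp) ?_
      simpa using hX
  obtain ⟨B, hB1, hB2, hB3, hB4⟩ := exists_openPartialHomeomorph_of_fderiv_bijective hUo
    (fun p hp => (hes p hp).contDiffWithinAt) hp₀ hDb
  exact ⟨B, hB1, fun p hp => ⟨(hB2 hp).1.1, (hB2 hp).1.2, (hB2 hp).2, hB3 p⟩, hB4⟩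

/-- The product structure of a foliated manifold near a point `x`: every point near `x` is uniquely
a translate, by an element of `G` near `1`, of a point of the plaque of `x`. -/
theorem exists_flowBox [FiniteDimensional ℝ EG] [FiniteDimensional ℝ Q]
    [FiniteDimensional ℝ F] [LieGroup 𝓘(ℝ, EG) ∞ G]
    (h : 𝓕.IsInvariantUnderTransverseAction EG G)
    {e : OpenPartialHomeomorph M (F × Q)} (he : e ∈ 𝓕.charts) {x : M} (hx : x ∈ e.source) :
    ∃ (V : Set M) (γ : M → G) (υ : M → F), IsOpen V ∧ x ∈ V ∧ γ x = 1 ∧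
      (∀ y ∈ V, ContMDiffAt 𝓘(ℝ, E) 𝓘(ℝ, EG) ∞ γ y) ∧
      (∀ y ∈ V, ContMDiffAt 𝓘(ℝ, E) 𝓘(ℝ, F) ∞ υ y) ∧
      (∀ y ∈ V, (υ y, (e x).2) ∈ e.target ∧ γ y • e.symm (υ y, (e x).2) = y ∧
        e.symm (υ y, (e x).2) ∈ 𝓕.leafSet x) ∧
      ∀ᶠ p : G × F in 𝓝 (1, (e x).1), γ (p.1 • e.symm (p.2, (e x).2)) = p.1 := by
  have : ContMDiffSMul 𝓘(ℝ, EG) 𝓘(ℝ, E) ∞ G M := h.contMDiffSMul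
  obtain ⟨B, hB0, hB, hBs⟩ := h.exists_flowBox_coord he hx
  set φ := chartAt EG (1 : G) with hφ
  have h1 : (1 : G) ∈ φ.source := mem_chart_source EG 1
  set c := (e x).2 with hc
  have hex : ((e x).1, c) = e x := rfl
  have hBx : B (φ 1, (e x).1) = e x := by
    rw [(hB _ hB0).2.2.2, φ.left_inv h1, one_smul]
    simp only [hex, e.left_inv hx]
  have hBsx : B.symm (e x) = (φ 1, (e x).1) := by
    have := B.left_inv hB0
    rwa [hBx] at this
  have hexB : e x ∈ B.target := hBx ▸ B.map_source hB0
  -- a ball of plaque coordinates, which is connected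
  obtain ⟨r, hr, hball⟩ := Metric.mem_nhds_iff.1
    ((e.open_target.preimage (f := fun u : F => (u, c)) (by fun_prop)).mem_nhds
      (show (e x).1 ∈ (fun u : F => (u, c)) ⁻¹' e.target from e.map_source hx))
  set O : Set (F × Q) := B.target ∩ B.symm ⁻¹' (Prod.snd ⁻¹' Metric.ball (e x).1 r) with hO
  have hOo : IsOpen O :=
    B.symm.isOpen_inter_preimage (Metric.isOpen_ball.preimage continuous_snd)
  refine ⟨e.source ∩ e ⁻¹' O, fun y => φ.symm (B.symm (e y)).1, fun y => (B.symm (e y)).2,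
    e.isOpen_inter_preimage hOo, ⟨hx, hexB, ?_⟩, ?_, ?_, ?_, ?_, ?_⟩
  · simp only [mem_preimage, hBsx]
    exact Metric.mem_ball_self hr
  · simp only [hBsx, φ.left_inv h1]
  · rintro y ⟨hy, hyB, -⟩
    refine ContMDiffAt.comp y (g := φ.symm) (I' := 𝓘(ℝ, EG))
      (contMDiffAt_chartAt_symm (1 : G) (hB _ (B.map_target hyB)).1) ?_
    refine ContMDiffAt.comp y (g := fun p => (B.symm p).1) (I' := 𝓘(ℝ, F × Q)) ?_
      ((𝓕.smooth e he).contMDiffAt (e.open_source.mem_nhds hy))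
    exact (contDiff_fst.contDiffAt.comp _ (hBs.contDiffAt (B.open_target.mem_nhds hyB))).contMDiffAt
  · rintro y ⟨hy, hyB, -⟩
    refine ContMDiffAt.comp y (g := fun p => (B.symm p).2) (I' := 𝓘(ℝ, F × Q)) ?_
      ((𝓕.smooth e he).contMDiffAt (e.open_source.mem_nhds hy))
    exact (contDiff_snd.contDiffAt.comp _ (hBs.contDiffAt (B.open_target.mem_nhds hyB))).contMDiffAt
  · rintro y ⟨hy, hyB, hyr⟩
    obtain ⟨h2, h3, h4, h5⟩ := hB _ (B.map_target hyB)
    refine ⟨h3, ?_, ?_⟩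
    · rw [B.right_inv hyB] at h5
      exact e.injOn h4 hy h5.symm
    · have := 𝓕.mem_leafSet_of_isPreconnected he (convex_ball (e x).1 r).isPreconnected
        (fun u hu => hball hu) hyr (Metric.mem_ball_self hr)
      rwa [hex, e.left_inv hx] at this
  · have hcont : ContinuousAt (fun p : G × F => (φ p.1, p.2)) (1, (e x).1) :=
      (ContinuousAt.comp (g := φ) (f := Prod.fst) (x := ((1 : G), (e x).1)) (φ.continuousAt h1)
        continuousAt_fst).prodMk continuousAt_snd
    have hBnhds : B.source ∈ 𝓝 (φ 1, (e x).1) := B.open_source.mem_nhds hB0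
    filter_upwards [hcont.preimage_mem_nhds hBnhds,
      continuousAt_fst.preimage_mem_nhds (φ.open_source.mem_nhds h1)] with p hp hp1
    obtain ⟨h2, h3, h4, h5⟩ := hB _ hp
    rw [φ.left_inv hp1] at h5
    rw [← h5, B.left_inv hp, φ.left_inv hp1]

/-- A continuous map to `G` which moves a point within a leaf is locally constant. -/
theorem eventually_eq_of_smul_mem_leafSet [FiniteDimensional ℝ EG] [FiniteDimensional ℝ Q]
    [FiniteDimensional ℝ F] [LieGroup 𝓘(ℝ, EG) ∞ G] [SecondCountableTopology M]
    (h : 𝓕.IsInvariantUnderTransverseAction EG G)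
    {Z : Type*} [TopologicalSpace Z] [LocallyConnectedSpace Z] {k : Z → G} {W : Set Z}
    (hW : IsOpen W) (hk : ContinuousOn k W) {x y : M} (hky : ∀ z ∈ W, k z • y ∈ 𝓕.leafSet x) {z₀ : Z}
    (hz₀ : z₀ ∈ W) : ∀ᶠ z in 𝓝 z₀, k z = k z₀ := by
  have : ContMDiffSMul 𝓘(ℝ, EG) 𝓘(ℝ, E) ∞ G M := h.contMDiffSMul
  have : ContinuousSMul G M := ContMDiffSMul.continuousSMul (I := 𝓘(ℝ, EG)) (I' := 𝓘(ℝ, E)) ∞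
  have : IsTopologicalGroup G := topologicalGroup_of_lieGroup 𝓘(ℝ, EG) ∞
  have : SecondCountableTopology F := secondCountable_of_proper
  set e := 𝓕.chartNear y
  have he : e ∈ 𝓕.charts := 𝓕.chartNear_mem y
  have hy : y ∈ e.source := 𝓕.mem_chartNear_source y
  obtain ⟨V, γ, υ, -, -, -, -, -, -, hev⟩ := h.exists_flowBox he hy
  set f : Z → M := fun z => ((k z₀)⁻¹ * k z) • y with hf
  have hf₀ : f z₀ = y := by simp [hf]
  have hκ : ContinuousOn (fun z => (k z₀)⁻¹ * k z) W := continuousOn_const.mul hk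
  have hfc : ContinuousOn f W := hκ.smul continuousOn_const
  have hfx : ∀ z ∈ W, f z ∈ 𝓕.leafSet ((k z₀)⁻¹ • x) := by
    intro z hz
    simp only [hf, mul_smul]
    exact h.smul_mem_leafSet _ (hky z hz)
  have h1 := 𝓕.eventually_snd_eq_of_mem_leafSet hW hfc hfx hz₀ he (by rw [hf₀]; exact hy)
  rw [hf₀] at h1
  have hfz : ContinuousAt f z₀ := hfc.continuousAt (hW.mem_nhds hz₀)
  have hκz : ContinuousAt (fun z => (k z₀)⁻¹ * k z) z₀ := hκ.continuousAt (hW.mem_nhds hz₀)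
  have h2 : Filter.Tendsto (fun z => ((k z₀)⁻¹ * k z, (e y).1)) (𝓝 z₀) (𝓝 (1, (e y).1)) := by
    have : ContinuousAt (fun z => ((k z₀)⁻¹ * k z, (e y).1)) z₀ := hκz.prodMk continuousAt_const
    simpa [ContinuousAt] using this
  have h3 : Filter.Tendsto (fun z => ((1 : G), (e (f z)).1)) (𝓝 z₀) (𝓝 (1, (e y).1)) := by
    have he' : ContinuousAt e (f z₀) := e.continuousAt (by rw [hf₀]; exact hy)
    have : ContinuousAt (fun z => ((1 : G), (e (f z)).1)) z₀ :=
      continuousAt_const.prodMk (continuousAt_fst.comp (he'.comp hfz))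
    simpa [ContinuousAt, hf₀] using this
  -- The point `f z` stays in the plaque of `y`, so it is both the translate of `y` by `(k z₀)⁻¹ * k
  -- z` and the translate by `1` of a plaque point; uniqueness in the flow box equates the two group
  -- elements.
  filter_upwards [h1, h2.eventually hev, h3.eventually hev] with z ⟨hz1, hz2⟩ hz3 hz4
  have hey : ((e y).1, (e y).2) = e y := rfl
  have hefz : ((e (f z)).1, (e y).2) = e (f z) := Prod.ext rfl hz2.symm
  simp only [hey, e.left_inv hy] at hz3
  simp only [hefz, e.left_inv hz1, one_smul] at hz4
  have h5 : (k z₀)⁻¹ * k z = 1 := hz3.symm.trans hz4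
  exact (inv_mul_eq_one.1 h5).symm

end Foliation.IsInvariantUnderTransverseAction

/-! ### Locally exact forms and their primitives -/

section ClosedForms

variable {E M : Type*} [NormedAddCommGroup E] [NormedSpace ℝ E] [TopologicalSpace M]
  [ChartedSpace E M]

theorem contMDiffAt_atlas_symm [IsManifold 𝓘(ℝ, E) ∞ M] {e : OpenPartialHomeomorph M E}
    (he : e ∈ atlas E M) {y : E} (hy : y ∈ e.target) :
    ContMDiffAt 𝓘(ℝ, E) 𝓘(ℝ, E) ∞ e.symm y :=
  (contMDiffOn_symm_of_mem_maximalAtlas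
    (IsManifold.subset_maximalAtlas he)).contMDiffAt (e.open_target.mem_nhds hy)

/-- A `1`-form which is locally the differential of a smooth function is smooth and closed. -/
theorem mem_closedOneForms_of_locally_exact [IsManifold 𝓘(ℝ, E) ∞ M] {η : OneForm E M}
    (h : ∀ x : M, ∃ V : Set M, IsOpen V ∧ x ∈ V ∧ ∃ α : M → ℝ, ∀ y ∈ V,
      ContMDiffAt 𝓘(ℝ, E) 𝓘(ℝ, ℝ) ∞ α y ∧ η y = mfderiv 𝓘(ℝ, E) 𝓘(ℝ, ℝ) α y) :
    η ∈ closedOneForms E M := by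
  have key : ∀ e ∈ atlas E M, ∀ y ∈ e.target, ∃ f : E → ℝ, ContDiffAt ℝ ∞ f y ∧
      η.inChart e =ᶠ[𝓝 y] fderiv ℝ f := by
    intro e he y hy
    obtain ⟨V, hV, hyV, α, hα⟩ := h (e.symm y)
    have hf : ∀ z ∈ e.target, e.symm z ∈ V → ContMDiffAt 𝓘(ℝ, E) 𝓘(ℝ, ℝ) ∞ (fun z => α (e.symm z)) z :=
      fun z hz hzV => ContMDiffAt.comp z (hα _ hzV).1 (contMDiffAt_atlas_symm he hz)
    refine ⟨fun z => α (e.symm z), contMDiffAt_iff_contDiffAt.1 (hf y hy hyV), ?_⟩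
    filter_upwards [e.open_target.mem_nhds hy,
      (e.continuousAt_symm hy).preimage_mem_nhds (hV.mem_nhds hyV)] with z hz hzV
    have h1 := (hα _ hzV).1.mdifferentiableAt (by simp)
    have h2 := (contMDiffAt_atlas_symm he hz).mdifferentiableAt (by simp)
    have h3 := mfderiv_comp z h1 h2
    rw [mfderiv_eq_fderiv] at h3
    change (η (e.symm z)).comp (mfderiv 𝓘(ℝ, E) 𝓘(ℝ, E) e.symm z) = _
    rw [(hα _ hzV).2]
    exact h3.symm
  refine ⟨fun e he y hy => ?_, fun e he y hy => ?_⟩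
  · obtain ⟨f, hf, hη⟩ := key e he y hy
    exact ((hf.fderiv_right (m := ∞) (by simp)).congr_of_eventuallyEq hη).contDiffWithinAt
  · obtain ⟨f, hf, hη⟩ := key e he y hy
    have h1 : (fun z => ContinuousAlternatingMap.ofSubsingleton ℝ E ℝ (0 : Fin 1) (η.inChart e z))
        =ᶠ[𝓝 y] extDeriv (fun z => ContinuousAlternatingMap.constOfIsEmpty ℝ E (Fin 0) (f z)) := by
      filter_upwards [hη] with z hz
      rw [hz, extDeriv_constOfIsEmpty]
    rw [h1.extDeriv_eq]
    refine extDeriv_extDeriv_apply (r := ∞) ?_ ?_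
    · exact (ContinuousAlternatingMap.constOfIsEmptyLIE ℝ E ℝ (Fin 0)).contDiff.contDiffAt.comp y hf
    · rw [minSmoothness_of_isRCLikeNormedField]
      exact WithTop.coe_le_coe.2 (le_top : (2 : ℕ∞) ≤ ⊤)

theorem exists_primitive_of_mem_closedOneForms (hM : Subsingleton (DeRhamH1 E M)) {η : OneForm E M}
    (hη : η ∈ closedOneForms E M) : η.IsExact := by
  have h1 : Submodule.Quotient.mk (p := (exactOneForms E M).comap (closedOneForms E M).subtype)
      ⟨η, hη⟩ = 0 := Subsingleton.elim _ _
  exact (Submodule.Quotient.mk_eq_zero _).1 h1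

/-- Functions with the same differential on an open set differ by a locally constant function. -/
theorem eventually_sub_eq_of_mfderiv_eq [IsManifold 𝓘(ℝ, E) ∞ M] {α β : M → ℝ} {V : Set M}
    (hV : IsOpen V) {x : M} (hx : x ∈ V) (hα : ∀ y ∈ V, ContMDiffAt 𝓘(ℝ, E) 𝓘(ℝ, ℝ) ∞ α y)
    (hβ : ∀ y ∈ V, ContMDiffAt 𝓘(ℝ, E) 𝓘(ℝ, ℝ) ∞ β y)
    (h : ∀ y ∈ V, mfderiv 𝓘(ℝ, E) 𝓘(ℝ, ℝ) α y = mfderiv 𝓘(ℝ, E) 𝓘(ℝ, ℝ) β y) :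
    ∀ᶠ y in 𝓝 x, α y - β y = α x - β x := by
  set φ := chartAt E x with hφ
  have hxs : x ∈ φ.source := mem_chart_source E x
  have hO : φ.target ∩ φ.symm ⁻¹' V ∈ 𝓝 (φ x) :=
    (φ.symm.isOpen_inter_preimage hV).mem_nhds ⟨φ.map_source hxs, by
      rw [mem_preimage, φ.left_inv hxs]; exact hx⟩
  obtain ⟨r, hr, hball⟩ := Metric.mem_nhds_iff.1 hO
  have hder : ∀ z ∈ Metric.ball (φ x) r,
      HasFDerivAt (fun z => α (φ.symm z) - β (φ.symm z)) (0 : E →L[ℝ] ℝ) z := by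
    intro z hz
    have h0 := (contMDiffAt_chartAt_symm x (hball hz).1).hasDiffAt
    have h1 := hasDiffAt_iff_hasFDerivAt.1 ((hα _ (hball hz).2).hasDiffAt.comp h0 rfl)
    have h2 := hasDiffAt_iff_hasFDerivAt.1 ((hβ _ (hball hz).2).hasDiffAt.comp h0 rfl)
    have h3 : diffAt E ℝ α (φ.symm z) = diffAt E ℝ β (φ.symm z) := h _ (hball hz).2
    have h4 := h1.sub h2
    rw [h3, sub_self] at h4
    exact h4
  filter_upwards [φ.open_source.mem_nhds hxs,
    (φ.continuousAt hxs).preimage_mem_nhds (Metric.ball_mem_nhds _ hr)] with y hys hy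
  have hconst := Metric.isOpen_ball.is_const_of_fderiv_eq_zero (𝕜 := ℝ)
    (convex_ball (φ x) r).isPreconnected
    (fun z hz => (hder z hz).differentiableAt.differentiableWithinAt)
    (fun z hz => (hder z hz).fderiv) hy (Metric.mem_ball_self hr)
  simpa only [φ.left_inv hys, φ.left_inv hxs] using hconst

end ClosedForms

/-! ### Stabilizers of leaves and periods of closed forms -/

namespace Foliation

section LeafInclusion

variable {E F Q M : Type*}
  [NormedAddCommGroup E] [NormedSpace ℝ E] [NormedAddCommGroup F] [NormedSpace ℝ F]
  [NormedAddCommGroup Q] [NormedSpace ℝ Q] [TopologicalSpace M] [ChartedSpace E M]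
  (𝓕 : Foliation E F Q M)

/-- The identity, as a map from the leaf space to the manifold. -/
def leafSpaceVal (y : 𝓕.LeafSpace) : M := y

theorem contMDiff_leafSpaceVal : ContMDiff 𝓘(ℝ, F) 𝓘(ℝ, E) ∞ 𝓕.leafSpaceVal := by
  intro y
  set e := 𝓕.chartNear y with he
  set c := (e (𝓕.leafSpaceVal y)).2 with hc
  have hes : e ∈ 𝓕.charts := 𝓕.chartNear_mem y
  have hy : y ∈ (chartAt F y).source := mem_chart_source F y
  have h1 : ContMDiffAt 𝓘(ℝ, F) 𝓘(ℝ, F) ∞ (chartAt F y) y := contMDiffAt_chartAt y hy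
  have h2 : ∀ z ∈ (chartAt F y).source, 𝓕.leafSpaceVal z = e.symm (chartAt F y z, c) := by
    intro z hz
    exact ((chartAt F y).left_inv hz).symm
  refine ContMDiffAt.congr_of_eventuallyEq ?_
    (Filter.mem_of_superset ((chartAt F y).open_source.mem_nhds hy) h2)
  refine ContMDiffAt.comp y (g := fun u : F => e.symm (u, c)) (I' := 𝓘(ℝ, F)) ?_ h1
  refine ContMDiffAt.comp _ (g := e.symm) (I' := 𝓘(ℝ, F × Q))
    ((𝓕.smooth_symm e hes).contMDiffAt (e.open_target.mem_nhds ?_)) ?_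
  · exact (chartAt F y).map_source hy
  · exact (contDiff_id.prodMk contDiff_const).contMDiff.contMDiffAt

/-- The inclusion of a leaf. -/
def leafVal (x : M) (y : 𝓕.leaf x) : M := 𝓕.leafSpaceVal y.1

theorem contMDiff_leafVal (x : M) : ContMDiff 𝓘(ℝ, F) 𝓘(ℝ, E) ∞ (𝓕.leafVal x) :=
  𝓕.contMDiff_leafSpaceVal.comp contMDiff_subtype_val

theorem leafVal_mem (x : M) (y : 𝓕.leaf x) : 𝓕.leafVal x y ∈ 𝓕.leafSet x := y.2

instance (x : M) : ConnectedSpace (𝓕.leaf x) :=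
  isConnected_iff_connectedSpace.1 (isConnected_connectedComponent (α := 𝓕.LeafSpace) (x := x))

end LeafInclusion

namespace IsInvariantUnderTransverseAction

variable {E F Q M EG G : Type*}
  [NormedAddCommGroup E] [NormedSpace ℝ E] [NormedAddCommGroup F] [NormedSpace ℝ F]
  [NormedAddCommGroup Q] [NormedSpace ℝ Q] [TopologicalSpace M] [ChartedSpace E M]
  [NormedAddCommGroup EG] [NormedSpace ℝ EG] [TopologicalSpace G] [ChartedSpace EG G] [Group G]
  [MulAction G M] {𝓕 : Foliation E F Q M}

theorem smul_mem_leafSet_of_mem (h : 𝓕.IsInvariantUnderTransverseAction EG G) {x y z : M} {g : G}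
    (hy : y ∈ 𝓕.leafSet x) (hgy : g • y ∈ 𝓕.leafSet x) (hz : z ∈ 𝓕.leafSet x) :
    g • z ∈ 𝓕.leafSet x := by
  have h1 := h.smul_mem_leafSet g (𝓕.leafSet_eq_of_mem hy ▸ hz)
  rwa [𝓕.leafSet_eq_of_mem hgy] at h1

variable [FiniteDimensional ℝ EG] [FiniteDimensional ℝ Q] [FiniteDimensional ℝ F]
  [LieGroup 𝓘(ℝ, EG) ∞ G]

/-- On a connected manifold the group permutes the leaves transitively. -/
theorem exists_inv_smul_mem_leafSet [PreconnectedSpace M]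
    (h : 𝓕.IsInvariantUnderTransverseAction EG G) (x₀ x : M) :
    ∃ g : G, g⁻¹ • x ∈ 𝓕.leafSet x₀ := by
  set O : Set M := {x | ∃ g : G, g⁻¹ • x ∈ 𝓕.leafSet x₀} with hO
  -- Nearby leaves are translates of each other, which makes both `O` and its complement open.
  have hloc : ∀ x : M, ∃ V, IsOpen V ∧ x ∈ V ∧ ∀ y ∈ V, ∃ g : G, g⁻¹ • y ∈ 𝓕.leafSet x := by
    intro x
    obtain ⟨V, γ, υ, hV, hxV, -, -, -, hγ, -⟩ :=
      h.exists_flowBox (𝓕.chartNear_mem x) (𝓕.mem_chartNear_source x)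
    refine ⟨V, hV, hxV, fun y hy => ⟨γ y, ?_⟩⟩
    obtain ⟨-, h2, h3⟩ := hγ y hy
    rwa [← eq_inv_smul_iff.2 h2]
  have hopen : IsOpen O := by
    rw [isOpen_iff_forall_mem_open]
    rintro x ⟨g, hg⟩
    obtain ⟨V, hV, hxV, hVx⟩ := hloc x
    refine ⟨V, fun y hy => ?_, hV, hxV⟩
    obtain ⟨a, ha⟩ := hVx y hy
    refine ⟨a * g, ?_⟩
    have := h.smul_mem_leafSet g⁻¹ ha
    rwa [𝓕.leafSet_eq_of_mem hg, smul_smul, ← mul_inv_rev] at this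
  have hclosed : IsClosed O := by
    rw [← isOpen_compl_iff, isOpen_iff_forall_mem_open]
    intro x hx
    obtain ⟨V, hV, hxV, hVx⟩ := hloc x
    refine ⟨V, fun y hy => ?_, hV, hxV⟩
    rintro ⟨b, hb⟩
    obtain ⟨a, ha⟩ := hVx y hy
    apply hx
    refine ⟨a⁻¹ * b, ?_⟩
    have h1 := h.smul_mem_leafSet (b⁻¹ * a) (𝓕.leafSet_eq_of_mem ha ▸ 𝓕.mem_leafSet_self x)
    have h2 : (b⁻¹ * a) • a⁻¹ • y = b⁻¹ • y := by simp [smul_smul]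
    rw [h2, 𝓕.leafSet_eq_of_mem hb] at h1
    simpa [mul_inv_rev] using h1
  have huniv : O = univ := IsClopen.eq_univ ⟨hclosed, hopen⟩
    ⟨x₀, 1, by simpa using 𝓕.mem_leafSet_self x₀⟩
  exact huniv.symm.subset (mem_univ x)

/-- Locally, the points of `M` can be moved smoothly into a given leaf. -/
theorem exists_local_translation [PreconnectedSpace M] [IsManifold 𝓘(ℝ, E) ∞ M]
    (h : 𝓕.IsInvariantUnderTransverseAction EG G) (x₀ x : M) :
    ∃ (V : Set M) (γ : M → G), IsOpen V ∧ x ∈ V ∧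
      (∀ y ∈ V, ContMDiffAt 𝓘(ℝ, E) 𝓘(ℝ, EG) ∞ γ y) ∧
      (∀ y ∈ V, (γ y)⁻¹ • y ∈ 𝓕.leafSet x₀) ∧
      ∃ e ∈ 𝓕.charts, ∃ (c : Q) (υ : M → F),
        ∀ y ∈ V, ContMDiffAt 𝓘(ℝ, E) 𝓘(ℝ, F) ∞ υ y ∧ (υ y, c) ∈ e.target ∧
          (γ y)⁻¹ • y = e.symm (υ y, c) := by
  have : ContMDiffSMul 𝓘(ℝ, EG) 𝓘(ℝ, E) ∞ G M := h.contMDiffSMul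
  obtain ⟨g, hg⟩ := h.exists_inv_smul_mem_leafSet x₀ x
  obtain ⟨V, γ, υ, hV, hxV, -, hγs, hυs, hγ, -⟩ :=
    h.exists_flowBox (𝓕.chartNear_mem (g⁻¹ • x)) (𝓕.mem_chartNear_source (g⁻¹ • x))
  have hs : ContMDiff 𝓘(ℝ, E) 𝓘(ℝ, E) ∞ (fun y : M => g⁻¹ • y) :=
    ContMDiffSMul.contMDiff_const_smul (I := 𝓘(ℝ, EG)) g⁻¹
  have hkey : ∀ y, g⁻¹ • y ∈ V → (g * γ (g⁻¹ • y))⁻¹ • y = (𝓕.chartNear (g⁻¹ • x)).symm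
      (υ (g⁻¹ • y), (𝓕.chartNear (g⁻¹ • x) (g⁻¹ • x)).2) := by
    intro y hy
    rw [mul_inv_rev, mul_smul, inv_smul_eq_iff]
    exact (hγ _ hy).2.1.symm
  refine ⟨(fun y => g⁻¹ • y) ⁻¹' V, fun y => g * γ (g⁻¹ • y), hV.preimage hs.continuous, hxV,
    fun y hy => ?_, fun y hy => ?_, _, 𝓕.chartNear_mem (g⁻¹ • x),
    (𝓕.chartNear (g⁻¹ • x) (g⁻¹ • x)).2, fun y => υ (g⁻¹ • y), fun y hy => ⟨?_, ?_, ?_⟩⟩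
  · exact contMDiffAt_const.mul (ContMDiffAt.comp y (hγs _ hy) hs.contMDiffAt)
  · rw [hkey y hy, ← 𝓕.leafSet_eq_of_mem hg]
    exact (hγ _ hy).2.2
  · exact ContMDiffAt.comp y (hυs _ hy) hs.contMDiffAt
  · exact (hγ _ hy).1
  · exact hkey y hy

/-- A quasi-homomorphism on the stabilizer of a leaf gives a closed form on `M`; if the first
cohomology of `M` vanishes then it is constant on the stabilizer. -/
theorem apply_eq_apply_one_of_smul_mem_leafSet [ConnectedSpace M] [IsManifold 𝓘(ℝ, E) ∞ M]
    [SecondCountableTopology M] [PreconnectedSpace G]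
    (h : 𝓕.IsInvariantUnderTransverseAction EG G) (hM : Subsingleton (DeRhamH1 E M)) (x₀ : M)
    {t χ : G → ℝ} (hts : ContMDiff 𝓘(ℝ, EG) 𝓘(ℝ, ℝ) ∞ t)
    (ht : ∀ a : G, a • x₀ ∈ 𝓕.leafSet x₀ → ∀ g, t (a * g) = χ a + t g) {a : G}
    (ha : a • x₀ ∈ 𝓕.leafSet x₀) : t a = t 1 := by
  have : ContMDiffSMul 𝓘(ℝ, EG) 𝓘(ℝ, E) ∞ G M := h.contMDiffSMul
  have : ContinuousSMul G M := ContMDiffSMul.continuousSMul (I := 𝓘(ℝ, EG)) (I' := 𝓘(ℝ, E)) ∞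
  have : IsTopologicalGroup G := topologicalGroup_of_lieGroup 𝓘(ℝ, EG) ∞
  have : LocallyConnectedSpace M := ChartedSpace.locallyConnectedSpace E M
  have hx₀ := 𝓕.mem_leafSet_self x₀
  choose V γ hVo hxV hγs hγL _ using h.exists_local_translation x₀
  -- Inverses appear because `t` is additive under left translation by the stabilizer, whereas `γ`
  -- is determined only up to right multiplication by it.
  set α : M → M → ℝ := fun x y => t (γ x y)⁻¹ with hα
  have hαs : ∀ x, ∀ y ∈ V x, ContMDiffAt 𝓘(ℝ, E) 𝓘(ℝ, ℝ) ∞ (α x) y := fun x y hy =>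
    ContMDiffAt.comp y hts.contMDiffAt (hγs x y hy).inv
  -- Two local translations differ by a locally constant stabilizer element, so these functions
  -- differ by local constants and their differentials glue.
  have hαα : ∀ x, ∀ y ∈ V x, ∃ b : ℝ, α y =ᶠ[𝓝 y] fun z => b + α x z := by
    intro x y hy
    have hkL : ∀ z ∈ V y ∩ V x, ((γ y z)⁻¹ * γ x z) • x₀ ∈ 𝓕.leafSet x₀ := by
      intro z hz
      refine h.smul_mem_leafSet_of_mem (hγL x z hz.2) ?_ hx₀
      have := hγL y z hz.1
      simpa [smul_smul] using this
    have hk := h.eventually_eq_of_smul_mem_leafSet ((hVo y).inter (hVo x))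
      (k := fun z => (γ y z)⁻¹ * γ x z)
      (fun z hz => ((hγs y z hz.1).inv.mul (hγs x z hz.2)).continuousAt.continuousWithinAt)
      hkL ⟨hxV y, hy⟩
    refine ⟨χ ((γ y y)⁻¹ * γ x y), ?_⟩
    filter_upwards [hk] with z hz
    have h1 := ht _ (hkL y ⟨hxV y, hy⟩) (γ x z)⁻¹
    rw [← hz, mul_inv_cancel_right] at h1
    simp only [hα]
    rw [h1, hz]
  let η : OneForm E M := fun x => mfderiv 𝓘(ℝ, E) 𝓘(ℝ, ℝ) (α x) x
  have hη : ∀ x, ∀ y ∈ V x, η y = mfderiv 𝓘(ℝ, E) 𝓘(ℝ, ℝ) (α x) y := by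
    intro x y hy
    obtain ⟨b, hb⟩ := hαα x y hy
    have h1 := (hαs x y hy).hasDiffAt
    have h2 := (hasDiffAt_iff_hasFDerivAt.2 ((hasFDerivAt_id (𝕜 := ℝ) (α x y)).const_add b)).comp
      h1 rfl
    exact HasMFDerivAt.mfderiv (h2.congr hb)
  have hclosed : η ∈ closedOneForms E M := mem_closedOneForms_of_locally_exact fun x =>
    ⟨V x, hVo x, hxV x, α x, fun y hy => ⟨hαs x y hy, hη x y hy⟩⟩
  obtain ⟨v, hv, hηv⟩ := exists_primitive_of_mem_closedOneForms hM hclosed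
  have hvα : ∀ x, ∀ᶠ y in 𝓝 x, v y - α x y = v x - α x x := fun x =>
    eventually_sub_eq_of_mfderiv_eq (hVo x) (hxV x) (fun y _ => hv.contMDiffAt) (hαs x)
      fun y hy => (hηv y).symm.trans (hη x y hy)
  -- the function comparing `t` and the primitive on `G × L`
  have hlc : LocallyConnectedSpace (G × 𝓕.leaf x₀) := by
    have : LocallyConnectedSpace (ModelProd EG F) :=
      inferInstanceAs (LocallyConnectedSpace (EG × F))
    exact ChartedSpace.locallyConnectedSpace (ModelProd EG F) (G × 𝓕.leaf x₀)
  set act : G × 𝓕.leaf x₀ → M := fun p => p.1 • 𝓕.leafVal x₀ p.2 with hact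
  have hactc : Continuous act :=
    continuous_fst.smul ((𝓕.contMDiff_leafVal x₀).continuous.comp continuous_snd)
  -- Near a given point of `G × L`, the group component differs from `γ` by a constant stabilizer
  -- element, and `v` differs from `α` by a constant.
  have hΨ : IsLocallyConstant fun p : G × 𝓕.leaf x₀ => t p.1⁻¹ - v (act p) := by
    rw [IsLocallyConstant.iff_eventually_eq]
    intro p
    set x := act p with hx
    have hkL : ∀ z ∈ act ⁻¹' V x, ((γ x (act z))⁻¹ * z.1) • x₀ ∈ 𝓕.leafSet x₀ := by
      intro z hz
      refine h.smul_mem_leafSet_of_mem (𝓕.leafVal_mem x₀ z.2) ?_ hx₀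
      rw [mul_smul]
      exact hγL x (act z) hz
    have hk := h.eventually_eq_of_smul_mem_leafSet ((hVo x).preimage hactc)
      (k := fun z => (γ x (act z))⁻¹ * z.1)
      (fun z hz => by
        have h1 : ContinuousAt (fun z => γ x (act z)) z :=
          ContinuousAt.comp (g := γ x) (hγs x (act z) hz).continuousAt hactc.continuousAt
        exact (h1.inv.mul continuousAt_fst).continuousWithinAt)
      hkL (z₀ := p) (hxV x)
    filter_upwards [hk, hactc.continuousAt.eventually (hvα x),
      hactc.continuousAt.preimage_mem_nhds ((hVo x).mem_nhds (hxV x))] with z hz1 hz2 hz3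
    have e1 := ht _ (hkL p (hxV x)) z.1⁻¹
    have e2 := ht _ (hkL p (hxV x)) p.1⁻¹
    rw [← hz1, mul_inv_cancel_right] at e1
    rw [mul_inv_cancel_right, ← hz1] at e2
    simp only [hα] at hz2
    linarith
  have hconst := fun p p' => hΨ.apply_eq_of_preconnectedSpace p p'
  -- Both points are mapped to `x₀` by the action, so the values of `v` cancel.
  have h1 := hconst (1, ⟨x₀, hx₀⟩) (a⁻¹, ⟨a • x₀, ha⟩)
  have e1 : act (1, ⟨x₀, hx₀⟩) = x₀ := one_smul G x₀
  have e2 : act (a⁻¹, ⟨a • x₀, ha⟩) = x₀ := inv_smul_smul a x₀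
  simp only [e1, e2, inv_one, inv_inv] at h1
  linarith

end IsInvariantUnderTransverseAction

end Foliation

/-! ### The product decomposition -/

namespace Foliation

section Tangent

variable {E F Q M : Type*}
  [NormedAddCommGroup E] [NormedSpace ℝ E] [NormedAddCommGroup F] [NormedSpace ℝ F]
  [NormedAddCommGroup Q] [NormedSpace ℝ Q] [TopologicalSpace M] [ChartedSpace E M]
  {B EB : Type*} [NormedAddCommGroup EB] [NormedSpace ℝ EB] [TopologicalSpace B] [ChartedSpace EB B]
  (𝓕 : Foliation E F Q M)

/-- The differential of a map which is constant on the leaves kills the vectors killed by the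
differential of the transverse coordinate of a foliated chart. -/
theorem diffAt_apply_eq_zero {e : OpenPartialHomeomorph M (F × Q)} (he : e ∈ 𝓕.charts) {f : M → B}
    {x : M} (hx : x ∈ e.source) (hf : ContMDiffAt 𝓘(ℝ, E) 𝓘(ℝ, EB) ∞ f x)
    (hfL : ∀ y ∈ 𝓕.leafSet x, f y = f x) {D : E →L[ℝ] F × Q} {D' : F × Q →L[ℝ] E}
    (hD : HasDiffAt e x D) (hD' : HasDiffAt e.symm (e x) D') {v : E} (hv : (D v).2 = 0) :
    diffAt E EB f x v = 0 := by
  have hD'D : D'.comp D = ContinuousLinearMap.id ℝ E :=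
    (hD'.comp hD rfl).unique ((hasDiffAt_id x).congr (by
      filter_upwards [e.open_source.mem_nhds hx] with y hy
      rw [e.left_inv hy]))
  have hι : HasDiffAt (fun u : F => (u, (e x).2)) (e x).1 (ContinuousLinearMap.inl ℝ F Q) :=
    hasDiffAt_iff_hasFDerivAt.2 (hasFDerivAt_prodMk_left (e x).1 (e x).2)
  -- Near `x` the plaque lies in the leaf of `x`, so `f` is constant along it.
  have h0 : ((diffAt E EB f x).comp D').comp (ContinuousLinearMap.inl ℝ F Q) = 0 := by
    refine ((hf.hasDiffAt.comp hD' (e.left_inv hx)).comp hι rfl).unique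
      ((hasDiffAt_const (f x) (e x).1).congr ?_)
    have hT : {u : F | (u, (e x).2) ∈ e.target} ∈ 𝓝 (e x).1 :=
      (e.open_target.preimage (f := fun u : F => (u, (e x).2)) (by fun_prop)).mem_nhds
        (e.map_source hx)
    obtain ⟨r, hr, hrT⟩ := Metric.mem_nhds_iff.1 hT
    filter_upwards [Metric.ball_mem_nhds _ hr] with u hu
    have h1 := 𝓕.mem_leafSet_of_isPreconnected he (c := (e x).2)
      (convex_ball (e x).1 r).isPreconnected (fun v hv => hrT hv) hu (Metric.mem_ball_self hr)
    have h2 : e.symm ((e x).1, (e x).2) = x := e.left_inv hx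
    rw [h2] at h1
    exact hfL _ h1
  have h1 : D v = ContinuousLinearMap.inl ℝ F Q (D v).1 := Prod.ext rfl hv
  have h2 : D' (D v) = v := DFunLike.congr_fun hD'D v
  have h3 : diffAt E EB f x (D' (ContinuousLinearMap.inl ℝ F Q (D v).1)) = 0 :=
    DFunLike.congr_fun h0 (D v).1
  rwa [← h1, h2] at h3

/-- One inclusion is constancy along plaques. Both differentials are onto spaces of equal dimension,
so the kernels have equal dimension too. -/
theorem ker_diffAt_snd_eq_ker_diffAt [FiniteDimensional ℝ E] [FiniteDimensional ℝ Q]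
    [FiniteDimensional ℝ EB] (hd : Module.finrank ℝ EB = Module.finrank ℝ Q)
    {e : OpenPartialHomeomorph M (F × Q)} (he : e ∈ 𝓕.charts) {f : M → B}
    {x : M} (hx : x ∈ e.source) (hf : ContMDiffAt 𝓘(ℝ, E) 𝓘(ℝ, EB) ∞ f x)
    (hfx : Function.Surjective (diffAt E EB f x)) (hfL : ∀ y ∈ 𝓕.leafSet x, f y = f x) :
    (diffAt E Q (fun y => (e y).2) x).ker = (diffAt E EB f x).ker := by
  have hD := ((𝓕.smooth e he).contMDiffAt (e.open_source.mem_nhds hx)).hasDiffAt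
  have hD' := ((𝓕.smooth_symm e he).contMDiffAt
    (e.open_target.mem_nhds (e.map_source hx))).hasDiffAt
  have hA : diffAt E Q (fun y => (e y).2) x =
      (ContinuousLinearMap.snd ℝ F Q).comp (diffAt E (F × Q) e x) :=
    ((hasDiffAt_iff_hasFDerivAt.2 (hasFDerivAt_snd (p := e x))).comp hD rfl).diffAt_eq
  have hDD' : (diffAt E (F × Q) e x).comp (diffAt (F × Q) E e.symm (e x)) =
      ContinuousLinearMap.id ℝ (F × Q) :=
    (hD.comp hD' (e.left_inv hx)).unique ((hasDiffAt_id (e x)).congr (by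
      filter_upwards [e.open_target.mem_nhds (e.map_source hx)] with y hy
      rw [e.right_inv hy]))
  rw [hA]
  have hAs : Function.Surjective
      ((ContinuousLinearMap.snd ℝ F Q).comp (diffAt E (F × Q) e x)) := fun w =>
    ⟨_, congrArg Prod.snd (DFunLike.congr_fun hDD' (0, w))⟩
  refine Submodule.eq_of_le_of_finrank_eq
    (fun v hv => 𝓕.diffAt_apply_eq_zero he hx hf hfL hD hD' hv) ?_
  have e1 := ((ContinuousLinearMap.snd ℝ F Q).comp
    (diffAt E (F × Q) e x)).toLinearMap.finrank_range_add_finrank_ker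
  have e2 := (diffAt E EB f x).toLinearMap.finrank_range_add_finrank_ker
  rw [LinearMap.range_eq_top.2 hAs, finrank_top] at e1
  rw [LinearMap.range_eq_top.2 hfx, finrank_top] at e2
  omega

/-- A submersion which is constant on the leaves, with values in a manifold whose dimension is the
codimension of the foliation, has the tangent spaces of the leaves as kernels of its
differential. -/
theorem tangent_eq_ker_mfderiv [FiniteDimensional ℝ E] [FiniteDimensional ℝ Q]
    [FiniteDimensional ℝ EB] (hd : Module.finrank ℝ EB = Module.finrank ℝ Q) {f : M → B} {x : M}
    (hf : ContMDiffAt 𝓘(ℝ, E) 𝓘(ℝ, EB) ∞ f x)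
    (hfx : Function.Surjective (diffAt E EB f x)) (hfL : ∀ y ∈ 𝓕.leafSet x, f y = f x) :
    𝓕.tangent x = LinearMap.ker (mfderiv 𝓘(ℝ, E) 𝓘(ℝ, EB) f x).toLinearMap := by
  have key : ∀ e ∈ 𝓕.charts, x ∈ e.source → ∀ v : E,
      diffAt E Q (fun y => (e y).2) x v = 0 ↔ diffAt E EB f x v = 0 := fun e he hx v =>
    (SetLike.ext_iff.1 (𝓕.ker_diffAt_snd_eq_ker_diffAt hd he hx hf hfx hfL) v)
  refine Submodule.ext fun v => ⟨fun hv => ?_, fun hv => ?_⟩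
  · exact (key _ (𝓕.chartNear_mem x) (𝓕.mem_chartNear_source x) v).1
      ((Submodule.mem_iInf _).1 hv ⟨_, 𝓕.chartNear_mem x, 𝓕.mem_chartNear_source x⟩)
  · exact (Submodule.mem_iInf _).2 fun e => (key e.1 e.2.1 e.2.2 v).2 hv

end Tangent

namespace IsInvariantUnderTransverseAction

variable {E F Q M EG G : Type*}
  [NormedAddCommGroup E] [NormedSpace ℝ E] [NormedAddCommGroup F] [NormedSpace ℝ F]
  [NormedAddCommGroup Q] [NormedSpace ℝ Q] [TopologicalSpace M] [ChartedSpace E M]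
  [NormedAddCommGroup EG] [NormedSpace ℝ EG] [TopologicalSpace G] [ChartedSpace EG G] [Group G]
  [MulAction G M] {𝓕 : Foliation E F Q M}

theorem eq_of_inv_smul_mem_leafSet (h : 𝓕.IsInvariantUnderTransverseAction EG G) {x₀ : M}
    (hst : ∀ a : G, a • x₀ ∈ 𝓕.leafSet x₀ → a = 1) {a b : G} {x : M}
    (ha : a⁻¹ • x ∈ 𝓕.leafSet x₀) (hb : b⁻¹ • x ∈ 𝓕.leafSet x₀) : a = b := by
  have h1 := hst (b⁻¹ * a) (h.smul_mem_leafSet_of_mem ha (by simpa [mul_smul] using hb)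
    (𝓕.mem_leafSet_self x₀))
  exact (inv_mul_eq_one.1 h1).symm

/-- If the stabilizer of a leaf is trivial, then the action gives a product decomposition. -/
theorem exists_diffeomorph [FiniteDimensional ℝ EG] [FiniteDimensional ℝ Q]
    [FiniteDimensional ℝ F] [LieGroup 𝓘(ℝ, EG) ∞ G] [PreconnectedSpace M]
    [IsManifold 𝓘(ℝ, E) ∞ M] (h : 𝓕.IsInvariantUnderTransverseAction EG G) {x₀ : M}
    (hst : ∀ a : G, a • x₀ ∈ 𝓕.leafSet x₀ → a = 1) :
    ∃ ψ : M ≃ₘ^∞⟮𝓘(ℝ, E), 𝓘(ℝ, EG).prod 𝓘(ℝ, F)⟯ (G × 𝓕.leaf x₀),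
      ∀ p, ψ.symm p = p.1 • 𝓕.leafVal x₀ p.2 := by
  have : ContMDiffSMul 𝓘(ℝ, EG) 𝓘(ℝ, E) ∞ G M := h.contMDiffSMul
  choose f hf using h.exists_inv_smul_mem_leafSet x₀
  have huniq : ∀ {x : M} {a : G}, a⁻¹ • x ∈ 𝓕.leafSet x₀ → f x = a := fun ha =>
    h.eq_of_inv_smul_mem_leafSet hst (hf _) ha
  let π : M → 𝓕.leaf x₀ := fun x => ⟨((f x)⁻¹ • x : M), hf x⟩
  -- By uniqueness the chosen `f` agrees with the smooth local translation `γ`. Smoothness of `π`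
  -- for the leaf structure is then seen through a single plaque.
  have hloc : ∀ x : M, ContMDiffAt 𝓘(ℝ, E) 𝓘(ℝ, EG) ∞ f x ∧ ContMDiffAt 𝓘(ℝ, E) 𝓘(ℝ, F) ∞ π x := by
    intro x
    obtain ⟨V, γ, hV, hxV, hγ, hγL, e, he, c, υ, hυ⟩ := h.exists_local_translation x₀ x
    have hfγ : ∀ y ∈ V, f y = γ y := fun y hy => huniq (hγL y hy)
    refine ⟨(hγ x hxV).congr_of_eventuallyEq
      (Filter.mem_of_superset (hV.mem_nhds hxV) hfγ), ?_⟩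
    refine (ContMDiffAt.subtypeVal_comp_iff (𝓕.leaf x₀) π x).1 ?_
    have h1 : ContMDiffAt 𝓘(ℝ, E) 𝓘(ℝ, F) ∞ (fun y => 𝓕.plaqueMap e c (υ y)) x :=
      ContMDiffAt.comp x (g := 𝓕.plaqueMap e c) (I' := 𝓘(ℝ, F))
        ((𝓕.contMDiffOn_plaqueMap he c).contMDiffAt
          ((e.open_target.preimage (f := fun u : F => (u, c)) (by fun_prop)).mem_nhds
            (hυ x hxV).2.1)) (hυ x hxV).1
    refine h1.congr_of_eventuallyEq (Filter.mem_of_superset (hV.mem_nhds hxV) fun y hy => ?_)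
    change (f y)⁻¹ • y = e.symm (υ y, c)
    rw [hfγ y hy]
    exact (hυ y hy).2.2
  refine ⟨⟨⟨fun x => (f x, π x), fun p => p.1 • 𝓕.leafVal x₀ p.2, fun x => ?_, fun p => ?_⟩,
    ?_, ?_⟩, fun p => rfl⟩
  · exact smul_inv_smul (f x) x
  · obtain ⟨g, y⟩ := p
    have h1 : f (g • 𝓕.leafVal x₀ y) = g :=
      huniq (by rw [inv_smul_smul]; exact 𝓕.leafVal_mem x₀ y)
    refine Prod.ext h1 (Subtype.ext ?_)
    change (f (g • 𝓕.leafVal x₀ y))⁻¹ • g • 𝓕.leafVal x₀ y = 𝓕.leafVal x₀ y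
    rw [h1, inv_smul_smul]
  · exact fun x => (hloc x).1.prodMk (hloc x).2
  · exact contMDiff_fst.smul ((𝓕.contMDiff_leafVal x₀).comp contMDiff_snd)

/-- In a product decomposition given by the action, the foliation is given by the projection. -/
theorem isGivenBy_of_diffeomorph [FiniteDimensional ℝ E] [FiniteDimensional ℝ EG]
    [FiniteDimensional ℝ Q] (h : 𝓕.IsInvariantUnderTransverseAction EG G) {x₀ : M}
    (ψ : M ≃ₘ^∞⟮𝓘(ℝ, E), 𝓘(ℝ, EG).prod 𝓘(ℝ, F)⟯ (G × 𝓕.leaf x₀))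
    (hψ : ∀ p, ψ.symm p = p.1 • 𝓕.leafVal x₀ p.2) :
    𝓕.IsGivenBy EG (fun y => (ψ y).1) := by
  set f : M → G := fun y => (ψ y).1 with hf
  have hfs : ContMDiff 𝓘(ℝ, E) 𝓘(ℝ, EG) ∞ f := contMDiff_fst.comp ψ.contMDiff
  have hfL : ∀ y : M, (f y)⁻¹ • y ∈ 𝓕.leafSet x₀ := by
    intro y
    have h1 : f y • 𝓕.leafVal x₀ (ψ y).2 = y := (hψ (ψ y)).symm.trans (ψ.symm_apply_apply y)
    rw [← eq_inv_smul_iff.2 h1]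
    exact 𝓕.leafVal_mem x₀ _
  have hfg : ∀ (y : M) (g : G), g⁻¹ • y ∈ 𝓕.leafSet x₀ → f y = g := by
    intro y g hy
    have h1 : ψ.symm (g, ⟨g⁻¹ • y, hy⟩) = y := (hψ _).trans (smul_inv_smul g y)
    have h2 : ψ y = (g, ⟨g⁻¹ • y, hy⟩) := by rw [← ψ.apply_symm_apply (g, _), h1]
    simp only [hf, h2]
  have hleaf : ∀ x : M, 𝓕.leafSet x = f ⁻¹' {f x} := by
    intro x
    ext y
    have hx := 𝓕.leafSet_eq_of_mem (hfL x)
    constructor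
    · intro hy
      have h1 := h.smul_mem_leafSet (f x)⁻¹ hy
      rw [hx] at h1
      exact hfg y _ h1
    · intro hy
      have hy' : f y = f x := hy
      have h1 := hfL y
      rw [← hx, hy'] at h1
      simpa using h.smul_mem_leafSet (f x) h1
  have hsurj : Function.Surjective f := fun g =>
    ⟨ψ.symm (g, (ψ x₀).2), by simp only [hf, ψ.apply_symm_apply]⟩
  have hdiff : ∀ x : M, Function.Surjective (diffAt E EG f x) := by
    intro x
    have h1 : ContMDiffAt 𝓘(ℝ, EG) 𝓘(ℝ, E) ∞ (fun g : G => ψ.symm (g, (ψ x).2)) (f x) :=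
      (ψ.symm.contMDiff.comp (contMDiff_id.prodMk contMDiff_const)).contMDiffAt
    have h2 := hfs.contMDiffAt.hasDiffAt.comp h1.hasDiffAt (ψ.symm_apply_apply x)
    have h3 := h2.unique ((hasDiffAt_id (f x)).congr (.of_forall fun g => by
      simp only [hf, ψ.apply_symm_apply]))
    exact fun w => ⟨_, DFunLike.congr_fun h3 w⟩
  refine ⟨hfs, hsurj, hdiff, ?_, fun x => ?_⟩
  · refine Subset.antisymm ?_ ?_
    · rintro _ ⟨x, rfl⟩
      exact ⟨f x, (hleaf x).symm⟩
    · rintro _ ⟨g, rfl⟩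
      obtain ⟨x, rfl⟩ := hsurj g
      exact ⟨x, hleaf x⟩
  · refine 𝓕.tangent_eq_ker_mfderiv h.finrank_group hfs.contMDiffAt (hdiff x) fun y hy => ?_
    rw [hleaf x] at hy
    exact hy

/-- The stabilizer of a leaf is trivial if the group is solvable and simply connected and the first
cohomology of the manifold vanishes. -/
theorem eq_one_of_smul_mem_leafSet {q : ℕ} {G : Type*} [TopologicalSpace G]
    [ChartedSpace (EuclideanSpace ℝ (Fin q)) G] [Group G] [LieGroup (𝓡 q) ∞ G]
    [SimplyConnectedSpace G] [Group.IsSolvable G] [MulAction G M] [FiniteDimensional ℝ Q]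
    [FiniteDimensional ℝ F] [ConnectedSpace M] [IsManifold 𝓘(ℝ, E) ∞ M]
    [SecondCountableTopology M]
    (h : 𝓕.IsInvariantUnderTransverseAction (EuclideanSpace ℝ (Fin q)) G)
    (hM : Subsingleton (DeRhamH1 E M)) (x₀ : M) {a : G} (ha : a • x₀ ∈ 𝓕.leafSet x₀) : a = 1 := by
  obtain ⟨T, hT⟩ := exists_solvable_coordinates q G
  -- Taking `h = g = 1` in the additivity relation forces the coordinates of `1` to vanish, one
  -- after the other.
  have hT1 : ∀ j, T 1 j = 0 := by
    intro j
    induction j using WellFoundedLT.induction with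
    | _ j ih =>
      have := hT j 1 ih 1
      rw [mul_one] at this
      linarith
  -- Once the earlier coordinates vanish on the stabilizer, the `j`-th one is additive under left
  -- translation by it, and the period argument kills it as well.
  have hTa : ∀ j, ∀ b : G, b • x₀ ∈ 𝓕.leafSet x₀ → T b j = 0 := by
    intro j
    induction j using WellFoundedLT.induction with
    | _ j ih =>
      intro b hb
      have hts : ContMDiff (𝓡 q) 𝓘(ℝ, ℝ) ∞ (fun g : G => T g j) :=
        ContMDiff.comp (g := EuclideanSpace.proj (𝕜 := ℝ) j) (I' := 𝓡 q)
          (EuclideanSpace.proj (𝕜 := ℝ) j).contDiff.contMDiff T.contMDiff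
      have := h.apply_eq_apply_one_of_smul_mem_leafSet hM x₀ hts (χ := fun g => T g j)
        (fun c hc g => hT j c (fun k hk => ih k hk c hc) g) hb
      rw [this, hT1]
  refine T.injective ?_
  ext j
  exact (hTa j a ha).trans (hT1 j).symm

end IsInvariantUnderTransverseAction

end Foliation

end

theorem theorem3 {n p q : ℕ}
    {M : Type*} [TopologicalSpace M] [ChartedSpace (EuclideanSpace ℝ (Fin n)) M]
    [IsManifold (𝓡 n) ∞ M] [T2Space M] [SecondCountableTopology M] [ConnectedSpace M]
    {G : Type*} [TopologicalSpace G] [ChartedSpace (EuclideanSpace ℝ (Fin q)) G]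
    [Group G] [LieGroup (𝓡 q) ∞ G] [T2Space G] [SecondCountableTopology G]
    [SimplyConnectedSpace G] [Group.IsSolvable G] [MulAction G M]
    (𝓕 : Foliation (EuclideanSpace ℝ (Fin n)) (EuclideanSpace ℝ (Fin p))
      (EuclideanSpace ℝ (Fin q)) M)
    (h𝓕 : 𝓕.IsInvariantUnderTransverseAction (EuclideanSpace ℝ (Fin q)) G)
    (hM : Subsingleton (DeRhamH1 (EuclideanSpace ℝ (Fin n)) M)) :
    (∀ x : M, ∃ ψ : M ≃ₘ^∞⟮𝓡 n, (𝓡 q).prod (𝓡 p)⟯ (G × 𝓕.leaf x),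
      𝓕.IsGivenBy (EuclideanSpace ℝ (Fin q)) (fun y => (ψ y).1)) ∧
    Nonempty (G ≃ₘ^∞⟮𝓡 q, 𝓡 q⟯ EuclideanSpace ℝ (Fin q)) := by
  refine ⟨fun x => ?_, ?_⟩
  · obtain ⟨ψ, hψ⟩ := h𝓕.exists_diffeomorph (x₀ := x)
      fun a ha => h𝓕.eq_one_of_smul_mem_leafSet hM x ha
    exact ⟨ψ, h𝓕.isGivenBy_of_diffeomorph ψ hψ⟩
  · obtain ⟨T, -⟩ := exists_solvable_coordinates q G
    exact ⟨T⟩
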